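/- Let $\Bbbk$ be a field, let $Q_A$ and $Q_B$ be finite quivers, and let $A=\Bbbk Q_A/I_A$ and $B=\Bbbk Q_B/I_B$ be finite dimensional algebras, where $I_A$, $I_B$ are admissible ideals (an ideal $I$ of $\Bbbk Q$ is admissible if $J_Q^m\subseteq I\subseteq J_Q^2$ for some $m\ge 2$, where $J_Q$ is the ideal generated by the arrows). Paths are composed from left to right. Let $C=\Bbbk Q_C/I_C$, where * the vertex set ${Q_C}_0$ is the disjoint union of ${Q_A}_0$ and ${Q_B}_0$; * the arrows of $Q_C$ are those of $Q_A$, those of $Q_B$, a finite family $(\alpha_j)_{j\in J}$ of arrows with source in ${Q_A}_0$ and target in ${Q_B}_0$, and a finite family $(\beta_k)_{k\in K}$ of arrows with source in ${Q_B}_0$ and target in ${Q_A}_0$; * $I_C$ is the two-sided ideal of $\Bbbk Q_C$ generated by $I_A$, $I_B$ and all the products $\alpha\alpha_j$, $\beta\beta_k$, $\alpha_j\beta_k$, $\beta_k\alpha_j$, where $\alpha$ runs over the arrows of $Q_A$, $\beta$ over the arrows of $Q_B$, $j$ over $J$ and $k$ over $K$. For a finite dimensional algebra $\Lambda$, let $\operatorname{mod}\Lambda$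 be the category of finitely generated right $\Lambda$-modules, let $\Omega(M)$ be the kernel of the projective cover of $M$, and let $K_0(\Lambda)$ be the abelian group generated by the symbols $[M]$, $M\in\operatorname{mod}\Lambda$, modulo the relations $[M]=[M']+[M'']$ if $M\cong M'\oplus M''$, and $[P]=0$ if $P$ is projective. Let $\bar\Omega$ be the endomorphism of $K_0(\Lambda)$ with $\bar\Omega([M])=[\Omega(M)]$. For $M\in\operatorname{mod}\Lambda$ let $\langle\operatorname{add}M\rangle\subseteq K_0(\Lambda)$ be the subgroup generated by the classes of the indecomposable direct summands of $M$, let $\phi(M)$ be the least $l\ge 0$ such that $\bar\Omega$ is injective on $\bar\Omega^{m}(\langle\operatorname{add}M\rangle)$ for all $m\ge l$, and put $\phi\dim(\Lambda)=\sup\{\phi(M): M\in\operatorname{mod}\Lambda\}\in\mathbb N\cup\{\infty\}$. Then 1. $\max\{\phi\dim(A),\phi\dim(B)\}\le\phi\dim(C)\le\max\{\phi\dim(A),\phi\dim(B)\}+|{Q_A}_0|+|{Q_B}_0|+1$; 2. $\max\{\phi\dim(A^{op}),\phi\dim(B^{op})\}\le\phi\dim(C^{op})\le\max\{\phi\dim(A^{op}),\phi\dim(B^{op})\}+|{Q_A}_0|+|{Q_B}_0|+1$.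 -/

import Mathlib

/-! ### Projective covers, syzygies and the Igusa–Todorov function -/

universe u v w

namespace IgusaTodorov

section Covers

variable {R : Type u} [Ring R]

/-- A projective cover: a surjection from a projective module with superfluous kernel. -/
structure IsProjectiveCover {P M : Type u} [AddCommGroup P] [Module R P] [AddCommGroup M]
    [Module R M] (f : P →ₗ[R] M) : Prop where
  projective : Module.Projective R P
  surjective : Function.Surjective f
  superfluous : ∀ N : Submodule R P, N ⊔ LinearMap.ker f = ⊤ → N = ⊤

theorem exists_projectiveCover [IsArtinianRing R] (M : FGModuleCat.{u} R) :
    ∃ (P : FGModuleCat.{u} R) (f : P →ₗ[R] M), IsProjectiveCover f := by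
  obtain ⟨n, f, hf⟩ := Module.Finite.exists_fin' R M
  let S : Set (Submodule R (Fin n → R)) := {Q | Module.Projective R Q ∧ Q.map f = ⊤}
  have hS : S.Nonempty := ⟨⊤, Module.Projective.of_equiv
    (Submodule.topEquiv (R := R) (M := Fin n → R)).symm,
    by rw [Submodule.map_top, LinearMap.range_eq_top.2 hf]⟩
  obtain ⟨Q, ⟨hQp, hQm⟩, hmin⟩ := IsArtinian.set_has_minimal S hS
  refine ⟨FGModuleCat.of R Q, f.comp Q.subtype, ⟨hQp, ?_, ?_⟩⟩
  · rw [← LinearMap.range_eq_top, LinearMap.range_comp, Submodule.range_subtype, hQm]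
  · intro N hN
    change Submodule R Q at N
    change N ⊔ LinearMap.ker (f.comp Q.subtype) = ⊤ at hN
    have hfN : Function.Surjective ((f.comp Q.subtype).comp N.subtype) := by
      rw [← LinearMap.range_eq_top, LinearMap.range_comp, Submodule.range_subtype]
      have := congrArg (Submodule.map (f.comp Q.subtype)) hN
      rw [Submodule.map_sup, Submodule.map_top, LinearMap.range_comp, Submodule.range_subtype,
        hQm, LinearMap.le_ker_iff_map.1 le_rfl, sup_bot_eq] at this
      exact this
    obtain ⟨g, hg⟩ := Module.projective_lifting_property _ (f.comp Q.subtype) hfN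
    let e : Module.End R Q := N.subtype.comp g
    have he : ∀ x, f (e x : Fin n → R) = f x := fun x => LinearMap.congr_fun hg x
    have hek : ∀ (k : ℕ) x, f ((e ^ k) x : Fin n → R) = f x := by
      intro k
      induction k with
      | zero => intro x; simp
      | succ k ih => intro x; rw [pow_succ, Module.End.mul_apply, ih, he]
    obtain ⟨k, hk0, hk⟩ :=
      ((Filter.eventually_ge_atTop 1).and e.eventually_isCompl_ker_pow_range_pow).exists
    have hproj : Module.Projective R (LinearMap.range (e ^ k)) := by
      refine Module.Projective.of_split (LinearMap.range (e ^ k)).subtype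
        (Submodule.projectionOnto _ _ hk.symm) ?_
      ext1 x
      exact Submodule.projectionOnto_apply_left hk.symm x
    have hmem : (LinearMap.range (e ^ k)).map Q.subtype ∈ S := by
      refine ⟨Module.Projective.of_equiv
        (Submodule.equivMapOfInjective Q.subtype Q.injective_subtype _), ?_⟩
      rw [eq_top_iff]
      rintro m -
      have : m ∈ Q.map f := by rw [hQm]; trivial
      obtain ⟨q, hq, rfl⟩ := this
      exact ⟨((e ^ k) ⟨q, hq⟩ : Q), ⟨_, ⟨_, rfl⟩, rfl⟩, hek k ⟨q, hq⟩⟩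
    have hnot := hmin _ hmem
    rw [eq_top_iff]
    rintro x -
    have hx : (x : Fin n → R) ∈ (LinearMap.range (e ^ k)).map Q.subtype := by
      by_contra hcon
      refine hnot (lt_of_le_of_ne (Submodule.map_subtype_le _ _) ?_)
      intro heq
      rw [heq] at hcon
      exact hcon x.2
    obtain ⟨y, ⟨z, rfl⟩, hy⟩ := hx
    have hyx : (e ^ k) z = x := Subtype.ext hy
    rw [← hyx]
    obtain ⟨j, rfl⟩ := Nat.exists_eq_add_of_le hk0
    rw [pow_add, pow_one, Module.End.mul_apply]
    exact (g ((e ^ j) z)).2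

/-- The domain `P(M)` of a projective cover of `M` (unique up to isomorphism). -/
noncomputable def projectiveCover [IsArtinianRing R] (M : FGModuleCat.{u} R) : FGModuleCat.{u} R :=
  (exists_projectiveCover M).choose

/-- The projection `P(M) → M`. -/
noncomputable def projectiveCoverMap [IsArtinianRing R] (M : FGModuleCat.{u} R) :
    projectiveCover M →ₗ[R] M :=
  (exists_projectiveCover M).choose_spec.choose

theorem isProjectiveCover_map [IsArtinianRing R] (M : FGModuleCat.{u} R) :
    IsProjectiveCover (projectiveCoverMap M) :=
  (exists_projectiveCover M).choose_spec.choose_spec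

/-- The syzygy `Ω(M)`: the kernel of the projective cover of `M`. -/
noncomputable def syzygy [IsArtinianRing R] (M : FGModuleCat.{u} R) : FGModuleCat.{u} R :=
  FGModuleCat.of R (LinearMap.ker (projectiveCoverMap M))

end Covers

section K0

variable (R : Type u) [Ring R]

/-- The defining relations of `K₀(R)`: `[M] - [M'] - [M'']` whenever `M ≅ M' ⊕ M''`, and `[P]` for
`P` projective. -/
def K0Relations : Set (FreeAbelianGroup (FGModuleCat.{u} R)) :=
  {x | ∃ M M' M'' : FGModuleCat.{u} R, Nonempty (M ≃ₗ[R] (M' × M'')) ∧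
      x = FreeAbelianGroup.of M - FreeAbelianGroup.of M' - FreeAbelianGroup.of M''} ∪
  {x | ∃ P : FGModuleCat.{u} R, Module.Projective R P ∧ x = FreeAbelianGroup.of P}

/-- The Igusa–Todorov group `K₀(R)`: the abelian group generated by the symbols `[M]`, for `M` a
finitely generated left `R`-module, modulo direct sums and projective modules. -/
def K0 : Type (u + 1) :=
  FreeAbelianGroup (FGModuleCat.{u} R) ⧸ AddSubgroup.closure (K0Relations R)

noncomputable instance : AddCommGroup (K0 R) :=
  inferInstanceAs (AddCommGroup
    (FreeAbelianGroup (FGModuleCat.{u} R) ⧸ AddSubgroup.closure (K0Relations R)))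

variable {R}

/-- The class `[M]` in `K₀(R)`. -/
def K0.mk (M : FGModuleCat.{u} R) : K0 R :=
  QuotientAddGroup.mk (FreeAbelianGroup.of M)

theorem K0.mk_eq_add {M M' M'' : FGModuleCat.{u} R} (e : M ≃ₗ[R] (M' × M'')) :
    K0.mk M = K0.mk M' + K0.mk M'' := by
  have h : (QuotientAddGroup.mk (FreeAbelianGroup.of M - FreeAbelianGroup.of M' -
      FreeAbelianGroup.of M'') : FreeAbelianGroup (FGModuleCat.{u} R) ⧸
        AddSubgroup.closure (K0Relations R)) = 0 :=
    (QuotientAddGroup.eq_zero_iff _).2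
      (AddSubgroup.subset_closure (Or.inl ⟨M, M', M'', ⟨e⟩, rfl⟩))
  rw [QuotientAddGroup.mk_sub, QuotientAddGroup.mk_sub, sub_sub, sub_eq_zero] at h
  exact h

theorem K0.mk_projective {P : FGModuleCat.{u} R} (h : Module.Projective R P) : K0.mk P = 0 :=
  (QuotientAddGroup.eq_zero_iff _).2 (AddSubgroup.subset_closure (Or.inr ⟨P, h, rfl⟩))

theorem K0.mk_congr {M N : FGModuleCat.{u} R} (e : M ≃ₗ[R] N) : K0.mk M = K0.mk N := by
  have h := K0.mk_eq_add (M := M) (M' := N) (M'' := FGModuleCat.of R PUnit.{u + 1})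
    (e.trans (LinearEquiv.prodUnique (R := R) (M := N) (M₂ := PUnit.{u + 1})).symm)
  rwa [K0.mk_projective (P := FGModuleCat.of R PUnit.{u + 1})
    (inferInstanceAs (Module.Projective R PUnit.{u + 1})), add_zero] at h

/-- If `g : E → P` is onto and `P` is projective, then `[E] = [ker g]`. -/
theorem K0.mk_eq_mk_ker [IsNoetherianRing R] {E P : FGModuleCat.{u} R} (g : E →ₗ[R] P)
    (hg : Function.Surjective g) (hP : Module.Projective R P) :
    K0.mk E = K0.mk (FGModuleCat.of R (LinearMap.ker g)) := by
  obtain ⟨s, hs⟩ := Module.projective_lifting_property g LinearMap.id hg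
  have hs' : ∀ y, g (s y) = y := fun y => LinearMap.congr_fun hs y
  let e : E ≃ₗ[R] (LinearMap.ker g × P) :=
    { toFun := fun x => (⟨x - s (g x), by simp [hs']⟩, g x)
      invFun := fun z => z.1 + s z.2
      map_add' := fun x y => by
        ext
        · simp only [map_add, Prod.fst_add, Submodule.coe_add]; abel
        · simp
      map_smul' := fun c x => by
        ext
        · simp [smul_sub]
        · simp
      left_inv := fun x => by simp
      right_inv := fun z => by
        have : g (z.1 : E) = 0 := z.1.2
        ext <;> simp [hs', this] }
  rw [K0.mk_eq_add (M' := FGModuleCat.of R (LinearMap.ker g)) (M'' := P) e,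
    K0.mk_projective hP, add_zero]

/-- Schanuel's lemma in `K₀(R)`. -/
theorem K0.mk_ker_eq_mk_ker [IsNoetherianRing R] {P P' M : FGModuleCat.{u} R}
    (f : P →ₗ[R] M) (f' : P' →ₗ[R] M) (hf : Function.Surjective f) (hf' : Function.Surjective f')
    (hP : Module.Projective R P) (hP' : Module.Projective R P') :
    K0.mk (FGModuleCat.of R (LinearMap.ker f)) = K0.mk (FGModuleCat.of R (LinearMap.ker f')) := by
  let E : Submodule R (P × P') :=
    LinearMap.ker (f.comp (LinearMap.fst R P P') - f'.comp (LinearMap.snd R P P'))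
  have hE : ∀ z : P × P', z ∈ E ↔ f z.1 = f' z.2 := fun z => by
    simp [E, LinearMap.mem_ker, sub_eq_zero]
  let g : E →ₗ[R] P := (LinearMap.fst R P P').comp E.subtype
  let g' : E →ₗ[R] P' := (LinearMap.snd R P P').comp E.subtype
  have hg : Function.Surjective g := fun p => by
    obtain ⟨p', hp'⟩ := hf' (f p)
    exact ⟨⟨(p, p'), (hE _).2 hp'.symm⟩, rfl⟩
  have hg' : Function.Surjective g' := fun p' => by
    obtain ⟨p, hp⟩ := hf (f' p')
    exact ⟨⟨(p, p'), (hE _).2 hp⟩, rfl⟩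
  let a : LinearMap.ker g ≃ₗ[R] LinearMap.ker f' :=
    { toFun := fun z => ⟨z.1.1.2, by
        have h1 := (hE _).1 z.1.2
        have h2 : z.1.1.1 = 0 := z.2
        rw [LinearMap.mem_ker, ← h1, h2, map_zero]⟩
      invFun := fun y => ⟨⟨(0, y.1), (hE _).2 (by simp)⟩, rfl⟩
      map_add' := fun _ _ => rfl
      map_smul' := fun _ _ => rfl
      left_inv := fun z => by
        have h2 : z.1.1.1 = 0 := z.2
        ext
        · exact h2.symm
        · rfl
      right_inv := fun _ => rfl }
  let b : LinearMap.ker g' ≃ₗ[R] LinearMap.ker f :=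
    { toFun := fun z => ⟨z.1.1.1, by
        have h1 := (hE _).1 z.1.2
        have h2 : z.1.1.2 = 0 := z.2
        rw [LinearMap.mem_ker, h1, h2, map_zero]⟩
      invFun := fun y => ⟨⟨(y.1, 0), (hE _).2 (by simp)⟩, rfl⟩
      map_add' := fun _ _ => rfl
      map_smul' := fun _ _ => rfl
      left_inv := fun z => by
        have h2 : z.1.1.2 = 0 := z.2
        ext
        · rfl
        · exact h2.symm
      right_inv := fun _ => rfl }
  have h1 := K0.mk_eq_mk_ker (E := FGModuleCat.of R E) (P := P) g hg hP
  have h2 := K0.mk_eq_mk_ker (E := FGModuleCat.of R E) (P := P') g' hg' hP'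
  have h3 := K0.mk_congr (M := FGModuleCat.of R (LinearMap.ker g))
    (N := FGModuleCat.of R (LinearMap.ker f')) a
  have h4 := K0.mk_congr (M := FGModuleCat.of R (LinearMap.ker g'))
    (N := FGModuleCat.of R (LinearMap.ker f)) b
  exact h4.symm.trans (h2.symm.trans (h1.trans h3))

variable [IsArtinianRing R]

theorem K0.mk_syzygy {P M : FGModuleCat.{u} R} (f : P →ₗ[R] M) (hf : Function.Surjective f)
    (hP : Module.Projective R P) :
    K0.mk (syzygy M) = K0.mk (FGModuleCat.of R (LinearMap.ker f)) :=
  K0.mk_ker_eq_mk_ker _ f (isProjectiveCover_map M).surjective hf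
    (isProjectiveCover_map M).projective hP

theorem K0.mk_syzygy_projective {P : FGModuleCat.{u} R} (hP : Module.Projective R P) :
    K0.mk (syzygy P) = 0 := by
  rw [K0.mk_syzygy (P := P) LinearMap.id Function.surjective_id hP]
  refine K0.mk_projective ?_
  have : Subsingleton (LinearMap.ker (LinearMap.id : P →ₗ[R] P)) := by
    rw [LinearMap.ker_id]; infer_instance
  exact inferInstanceAs (Module.Projective R (LinearMap.ker (LinearMap.id : P →ₗ[R] P)))

theorem K0.mk_syzygy_eq_add {M M' M'' : FGModuleCat.{u} R} (e : M ≃ₗ[R] (M' × M'')) :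
    K0.mk (syzygy M) = K0.mk (syzygy M') + K0.mk (syzygy M'') := by
  let f' := projectiveCoverMap M'
  let f'' := projectiveCoverMap M''
  have hP' := (isProjectiveCover_map M').projective
  have hP'' := (isProjectiveCover_map M'').projective
  let f : (projectiveCover M' × projectiveCover M'') →ₗ[R] M :=
    e.symm.toLinearMap.comp (f'.prodMap f'')
  have hf : Function.Surjective f :=
    e.symm.surjective.comp (Function.Surjective.prodMap (isProjectiveCover_map M').surjective
      (isProjectiveCover_map M'').surjective)
  rw [K0.mk_syzygy (P := FGModuleCat.of R (projectiveCover M' × projectiveCover M'')) f hf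
    (inferInstanceAs (Module.Projective R (projectiveCover M' × projectiveCover M'')))]
  have hker : ∀ z, z ∈ LinearMap.ker f ↔ f' z.1 = 0 ∧ f'' z.2 = 0 := fun z => by
    simp [f]
  let c : LinearMap.ker f ≃ₗ[R] (LinearMap.ker f' × LinearMap.ker f'') :=
    { toFun := fun z => (⟨z.1.1, ((hker _).1 z.2).1⟩, ⟨z.1.2, ((hker _).1 z.2).2⟩)
      invFun := fun w => ⟨(w.1.1, w.2.1), (hker _).2 ⟨w.1.2, w.2.2⟩⟩
      map_add' := fun _ _ => rfl
      map_smul' := fun _ _ => rfl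
      left_inv := fun _ => rfl
      right_inv := fun _ => rfl }
  exact K0.mk_eq_add (M := FGModuleCat.of R (LinearMap.ker f)) (M' := syzygy M')
    (M'' := syzygy M'') c

variable (R) in
/-- The endomorphism of `K₀(R)` induced by the syzygy: `Ω̄[M] = [Ω(M)]`. -/
noncomputable def syzygyHom : K0 R →+ K0 R :=
  QuotientAddGroup.lift (AddSubgroup.closure (K0Relations R))
    (FreeAbelianGroup.lift fun M => K0.mk (syzygy M)) <| by
      rw [AddSubgroup.closure_le]
      rintro x (⟨M, M', M'', ⟨e⟩, rfl⟩ | ⟨P, hP, rfl⟩)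
      · simp [K0.mk_syzygy_eq_add e]
      · simp [K0.mk_syzygy_projective hP]

theorem syzygyHom_mk (M : FGModuleCat.{u} R) : syzygyHom R (K0.mk M) = K0.mk (syzygy M) :=
  FreeAbelianGroup.lift_apply_of _ _

end K0

section Phi

/-- For an endomorphism `f` of an abelian group and a subgroup `X`, the least `k` such that the
restriction of `f` to `f^m(X)` is injective for every `m ≥ k` (and `⊤` if there is no such `k`). -/
noncomputable def eta {G : Type*} [AddCommGroup G] (f : G →+ G) (X : AddSubgroup G) : ℕ∞ :=
  ⨅ (k : ℕ) (_ : ∀ m ≥ k, Set.InjOn f (f^[m] '' (X : Set G))), (k : ℕ∞)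

variable {R : Type u} [Ring R]

/-- Indecomposable modules: nonzero, and not an internal direct sum of two nonzero submodules. -/
def IsIndecomposable (N : Type u) [AddCommGroup N] [Module R N] : Prop :=
  Nontrivial N ∧ ∀ p q : Submodule R N, IsCompl p q → p = ⊥ ∨ q = ⊥

/-- The subgroup `⟨add M⟩` of `K₀(R)` generated by the classes of the indecomposable direct
summands of `M`. -/
noncomputable def addClosure (M : FGModuleCat.{u} R) : AddSubgroup (K0 R) :=
  AddSubgroup.closure {x | ∃ N N' : FGModuleCat.{u} R, Nonempty (M ≃ₗ[R] (N × N')) ∧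
    IsIndecomposable (R := R) N ∧ x = K0.mk N}

/-- The Igusa–Todorov function `φ(M)` of a finitely generated left `R`-module. -/
noncomputable def leftPhi [IsArtinianRing R] (M : FGModuleCat.{u} R) : ℕ∞ :=
  eta (syzygyHom R) (addClosure M)

variable (R) in
/-- The supremum of `φ(M)` over all finitely generated left `R`-modules. -/
noncomputable def leftPhiDim [IsArtinianRing R] : ℕ∞ :=
  ⨆ M : FGModuleCat.{u} R, leftPhi M

/-- The `φ`-dimension of a finite dimensional `k`-algebra `A`: the supremum of `φ(M)` over all
finitely generated right `A`-modules, that is, left modules over `Aᵐᵒᵖ`. -/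
noncomputable def phiDim (k : Type*) [Field k] (A : Type u) [Ring A] [Algebra k A]
    [Module.Finite k A] : ℕ∞ :=
  haveI : IsArtinianRing Aᵐᵒᵖ := IsArtinianRing.of_finite k Aᵐᵒᵖ
  leftPhiDim Aᵐᵒᵖ

end Phi

end IgusaTodorov

/-! ### Path algebras and bound quiver algebras -/

/-- All paths of a quiver, with their source and target. -/
abbrev QuiverPath (V : Type u) [Quiver.{v} V] : Type (max u v) :=
  Σ a : V, Σ b : V, Quiver.Path a b

/-- The path algebra `kQ`: the vector space with basis the paths of `Q` (trivial paths included).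
A finite quiver is given by a finite type `V` of vertices and finite types `a ⟶ b` of arrows. -/
def PathAlgebra (k : Type w) (V : Type u) [Field k] [Quiver.{v} V] : Type (max u v w) :=
  QuiverPath V →₀ k

namespace PathAlgebra

variable {k : Type w} {V : Type u} [Field k] [Quiver.{v} V]

noncomputable instance : AddCommGroup (PathAlgebra k V) :=
  inferInstanceAs (AddCommGroup (QuiverPath V →₀ k))

noncomputable instance : Module k (PathAlgebra k V) :=
  inferInstanceAs (Module k (QuiverPath V →₀ k))

/-- The basis of the path algebra given by the paths. -/
noncomputable def basis (k : Type w) (V : Type u) [Field k] [Quiver.{v} V] :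
    Module.Basis (QuiverPath V) k (PathAlgebra k V) :=
  Module.Basis.ofRepr (LinearEquiv.refl k (QuiverPath V →₀ k))

/-- A path as an element of the path algebra. -/
noncomputable def ofPath (k : Type w) {V : Type u} [Field k] [Quiver.{v} V] {a b : V}
    (p : Quiver.Path a b) : PathAlgebra k V :=
  basis k V ⟨a, b, p⟩

open Classical in
/-- The product of two paths, composed from left to right: the concatenation "first `p`, then `q`"
if `p` ends where `q` starts, and `0` otherwise. -/
noncomputable def pathMul (k : Type w) {V : Type u} [Field k] [Quiver.{v} V]
    (p q : QuiverPath V) : PathAlgebra k V :=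
  if h : p.2.1 = q.1 then ofPath k (p.2.2.comp (q.2.2.cast h.symm rfl)) else 0

/-- The multiplication of the path algebra, the bilinear extension of `pathMul`. -/
noncomputable def mulBilin (k : Type w) (V : Type u) [Field k] [Quiver.{v} V] :
    PathAlgebra k V →ₗ[k] PathAlgebra k V →ₗ[k] PathAlgebra k V :=
  (basis k V).constr k fun p => (basis k V).constr k fun q => pathMul k p q

noncomputable instance : Mul (PathAlgebra k V) := ⟨fun x y => mulBilin k V x y⟩

/-- The unit is the sum of the trivial paths. -/
noncomputable instance [Fintype V] : One (PathAlgebra k V) :=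
  ⟨∑ a : V, ofPath k (Quiver.Path.nil : Quiver.Path a a)⟩

theorem mul_def (x y : PathAlgebra k V) : x * y = mulBilin k V x y := rfl

theorem one_def [Fintype V] :
    (1 : PathAlgebra k V) = ∑ a : V, ofPath k (Quiver.Path.nil : Quiver.Path a a) := rfl

theorem basis_mul_basis (p q : QuiverPath V) : basis k V p * basis k V q = pathMul k p q := by
  simp [mul_def, mulBilin, Module.Basis.constr_basis]

theorem ofPath_mul_ofPath {a b c : V} (p : Quiver.Path a b) (q : Quiver.Path b c) :
    ofPath k p * ofPath k q = ofPath k (p.comp q) := by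
  rw [ofPath, ofPath, basis_mul_basis, pathMul, dif_pos rfl]
  rfl

theorem ofPath_mul_ofPath_of_ne {a b c d : V} (p : Quiver.Path a b) (q : Quiver.Path c d)
    (h : b ≠ c) : ofPath k p * ofPath k q = 0 := by
  rw [ofPath, ofPath, basis_mul_basis, pathMul, dif_neg h]

theorem induction_path {P : PathAlgebra k V → Prop} (x : PathAlgebra k V)
    (zero : P 0) (add : ∀ x y, P x → P y → P (x + y)) (smul : ∀ (c : k) x, P x → P (c • x))
    (path : ∀ (a b : V) (p : Quiver.Path a b), P (ofPath k p)) : P x := by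
  have hx : x ∈ Submodule.span k (Set.range (basis k V)) := (basis k V).mem_span x
  induction hx using Submodule.span_induction with
  | mem x h =>
    obtain ⟨⟨a, b, p⟩, rfl⟩ := h
    exact path a b p
  | zero => exact zero
  | add x y _ _ hx hy => exact add x y hx hy
  | smul c x _ hx => exact smul c x hx

protected theorem add_mul' (x y z : PathAlgebra k V) : (x + y) * z = x * z + y * z := by
  simp [mul_def]

protected theorem mul_add' (x y z : PathAlgebra k V) : x * (y + z) = x * y + x * z := by
  simp [mul_def]

protected theorem zero_mul' (x : PathAlgebra k V) : 0 * x = 0 := by simp [mul_def]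

protected theorem mul_zero' (x : PathAlgebra k V) : x * 0 = 0 := by simp [mul_def]

protected theorem smul_mul' (c : k) (x y : PathAlgebra k V) : c • x * y = c • (x * y) := by
  simp [mul_def]

protected theorem mul_smul' (c : k) (x y : PathAlgebra k V) : x * c • y = c • (x * y) := by
  simp [mul_def]

protected theorem mul_assoc' (x y z : PathAlgebra k V) : x * y * z = x * (y * z) := by
  induction x using induction_path with
  | zero => simp only [PathAlgebra.zero_mul']
  | add _ _ h1 h2 => simp only [PathAlgebra.add_mul', h1, h2]
  | smul _ _ h => simp only [PathAlgebra.smul_mul', h]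
  | path a b p =>
    induction y using induction_path with
    | zero => simp only [PathAlgebra.zero_mul', PathAlgebra.mul_zero']
    | add _ _ h1 h2 => simp only [PathAlgebra.add_mul', PathAlgebra.mul_add', h1, h2]
    | smul _ _ h => simp only [PathAlgebra.smul_mul', PathAlgebra.mul_smul', h]
    | path c d q =>
      induction z using induction_path with
      | zero => simp only [PathAlgebra.mul_zero']
      | add _ _ h1 h2 => simp only [PathAlgebra.mul_add', h1, h2]
      | smul _ _ h => simp only [PathAlgebra.mul_smul', h]
      | path e f r =>
        by_cases h1 : b = c
        · subst h1
          by_cases h2 : d = e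
          · subst h2
            simp only [ofPath_mul_ofPath, Quiver.Path.comp_assoc]
          · simp only [ofPath_mul_ofPath, ofPath_mul_ofPath_of_ne _ _ h2, PathAlgebra.mul_zero']
        · by_cases h2 : d = e
          · subst h2
            simp only [ofPath_mul_ofPath, ofPath_mul_ofPath_of_ne _ _ h1, PathAlgebra.zero_mul']
          · simp only [ofPath_mul_ofPath_of_ne _ _ h1, ofPath_mul_ofPath_of_ne _ _ h2,
              PathAlgebra.zero_mul', PathAlgebra.mul_zero']

protected theorem one_mul' [Fintype V] (x : PathAlgebra k V) : 1 * x = x := by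
  induction x using induction_path with
  | zero => simp only [PathAlgebra.mul_zero']
  | add _ _ h1 h2 => simp only [PathAlgebra.mul_add', h1, h2]
  | smul _ _ h => simp only [PathAlgebra.mul_smul', h]
  | path a b p =>
    rw [one_def, mul_def, map_sum, LinearMap.sum_apply, Finset.sum_eq_single a]
    · rw [← mul_def, ofPath_mul_ofPath, Quiver.Path.nil_comp]
    · intro c _ hc
      rw [← mul_def, ofPath_mul_ofPath_of_ne _ _ hc]
    · intro h
      exact absurd (Finset.mem_univ a) h

protected theorem mul_one' [Fintype V] (x : PathAlgebra k V) : x * 1 = x := by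
  induction x using induction_path with
  | zero => simp only [PathAlgebra.zero_mul']
  | add _ _ h1 h2 => simp only [PathAlgebra.add_mul', h1, h2]
  | smul _ _ h => simp only [PathAlgebra.smul_mul', h]
  | path a b p =>
    rw [one_def, mul_def, map_sum, Finset.sum_eq_single b]
    · rw [← mul_def, ofPath_mul_ofPath, Quiver.Path.comp_nil]
    · intro c _ hc
      rw [← mul_def, ofPath_mul_ofPath_of_ne _ _ hc.symm]
    · intro h
      exact absurd (Finset.mem_univ b) h

noncomputable instance [Fintype V] : Ring (PathAlgebra k V) :=
  { (inferInstance : AddCommGroup (PathAlgebra k V)),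
    (inferInstance : Mul (PathAlgebra k V)),
    (inferInstance : One (PathAlgebra k V)) with
    left_distrib := PathAlgebra.mul_add'
    right_distrib := PathAlgebra.add_mul'
    zero_mul := PathAlgebra.zero_mul'
    mul_zero := PathAlgebra.mul_zero'
    mul_assoc := PathAlgebra.mul_assoc'
    one_mul := PathAlgebra.one_mul'
    mul_one := PathAlgebra.mul_one' }

noncomputable instance [Fintype V] : Algebra k (PathAlgebra k V) :=
  Algebra.ofModule PathAlgebra.smul_mul' PathAlgebra.mul_smul'

/-- An arrow as an element of the path algebra. -/
noncomputable def arrow (k : Type w) {V : Type u} [Field k] [Quiver.{v} V] {a b : V}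
    (e : a ⟶ b) : PathAlgebra k V :=
  ofPath k e.toPath

/-- The linear map `kQ → kQ'` induced by a morphism of quivers, sending paths to paths. -/
noncomputable def map (k : Type w) [Field k] {V V' : Type u} [Quiver.{v} V] [Quiver.{v} V']
    (F : V ⥤q V') : PathAlgebra k V →ₗ[k] PathAlgebra k V' :=
  (basis k V).constr k fun p => ofPath k (F.mapPath p.2.2)

theorem map_ofPath {V V' : Type u} [Quiver.{v} V] [Quiver.{v} V'] (F : V ⥤q V') {a b : V}
    (p : Quiver.Path a b) : map k F (ofPath k p) = ofPath k (F.mapPath p) := by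
  simp [map, ofPath, Module.Basis.constr_basis]

/-- The arrow ideal `J_Q`. -/
noncomputable def arrowIdeal (k : Type w) (V : Type u) [Field k] [Quiver.{v} V] [Fintype V] :
    TwoSidedIdeal (PathAlgebra k V) :=
  TwoSidedIdeal.span {x | ∃ (a b : V) (e : a ⟶ b), x = arrow k e}

/-- Admissible ideals: `J_Q ^ m ⊆ I ⊆ J_Q ^ 2` for some `m ≥ 2`. -/
def IsAdmissible [Fintype V] (I : TwoSidedIdeal (PathAlgebra k V)) : Prop :=
  I.asIdeal ≤ (arrowIdeal k V).asIdeal ^ 2 ∧ ∃ m ≥ 2, (arrowIdeal k V).asIdeal ^ m ≤ I.asIdeal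

end PathAlgebra

/-- The quotient algebra `kQ / I`. -/
abbrev BoundQuiverAlgebra {k : Type w} {V : Type u} [Field k] [Quiver.{v} V] [Fintype V]
    (I : TwoSidedIdeal (PathAlgebra k V)) : Type (max u v w) :=
  I.ringCon.Quotient

/-! ### The quiver and the ideal of `C` -/

section Glue

variable {VA VB : Type u} [Quiver.{v} VA] [Quiver.{v} VB]

/-- The vertices of the quiver `Q_C`: the disjoint union of those of `Q_A` and those of `Q_B`. The
parameters are the families of the additional arrows `α_j : a → b` and `β_k : b → a`. -/
inductive GluedQuiver (X : VA → VB → Type v) (Y : VB → VA → Type v) : Type u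
  | inA (a : VA) : GluedQuiver X Y
  | inB (b : VB) : GluedQuiver X Y

namespace GluedQuiver

variable (X : VA → VB → Type v) (Y : VB → VA → Type v)

/-- The arrows of `Q_C`: those of `Q_A` and `Q_B`, together with the arrows `X a b` from `a ∈ Q_A`
to `b ∈ Q_B` and the arrows `Y b a` from `b ∈ Q_B` to `a ∈ Q_A`. -/
instance : Quiver.{v} (GluedQuiver X Y) where
  Hom
    | inA a, inA a' => a ⟶ a'
    | inA a, inB b => X a b
    | inB b, inA a => Y b a
    | inB b, inB b' => b ⟶ b'

/-- The vertices of `Q_C` are those of `Q_A` and those of `Q_B`. -/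
def equivSum : VA ⊕ VB ≃ GluedQuiver X Y where
  toFun := Sum.elim inA inB
  invFun
    | inA a => Sum.inl a
    | inB b => Sum.inr b
  left_inv := by rintro (a | b) <;> rfl
  right_inv := by rintro (a | b) <;> rfl

instance [Fintype VA] [Fintype VB] : Fintype (GluedQuiver X Y) :=
  Fintype.ofEquiv (VA ⊕ VB) (equivSum X Y)

/-- The inclusion of `Q_A` in `Q_C`. -/
def inclA : VA ⥤q GluedQuiver X Y where
  obj := inA
  map e := e

/-- The inclusion of `Q_B` in `Q_C`. -/
def inclB : VB ⥤q GluedQuiver X Y where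
  obj := inB
  map e := e

variable {X Y}

/-- The arrow `α_j : a → b` of `Q_C`. -/
def arrowAB {a : VA} {b : VB} (x : X a b) : (inA a : GluedQuiver X Y) ⟶ inB b := x

/-- The arrow `β_k : b → a` of `Q_C`. -/
def arrowBA {b : VB} {a : VA} (y : Y b a) : (inB b : GluedQuiver X Y) ⟶ inA a := y

variable {k : Type w} [Field k] [Fintype VA] [Fintype VB]

open PathAlgebra

variable (X Y) in
/-- The ideal `I_C` of `kQ_C` generated by `I_A`, `I_B` and all products `α α_j`, `β β_k`, `α_j β_k`
and `β_k α_j`, where `α`, `β` are arrows of `Q_A`, `Q_B`. -/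
noncomputable def gluedIdeal (IA : TwoSidedIdeal (PathAlgebra k VA))
    (IB : TwoSidedIdeal (PathAlgebra k VB)) : TwoSidedIdeal (PathAlgebra k (GluedQuiver X Y)) :=
  TwoSidedIdeal.span
    (PathAlgebra.map k (inclA X Y) '' (IA : Set (PathAlgebra k VA)) ∪
     PathAlgebra.map k (inclB X Y) '' (IB : Set (PathAlgebra k VB)) ∪
     {z | ∃ (a a' : VA) (b : VB) (e : a ⟶ a') (x : X a' b),
       z = arrow k ((inclA X Y).map e) * arrow k (arrowAB x)} ∪
     {z | ∃ (b b' : VB) (a : VA) (e : b ⟶ b') (y : Y b' a),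
       z = arrow k ((inclB X Y).map e) * arrow k (arrowBA y)} ∪
     {z | ∃ (a : VA) (b : VB) (a' : VA) (x : X a b) (y : Y b a'),
       z = arrow k (arrowAB x) * arrow k (arrowBA y)} ∪
     {z | ∃ (b : VB) (a : VA) (b' : VB) (y : Y b a) (x : X a b'),
       z = arrow k (arrowBA y) * arrow k (arrowAB x)})

/-! #### `C` is finite dimensional when `A` and `B` are -/

section Finite

variable (IA : TwoSidedIdeal (PathAlgebra k VA)) (IB : TwoSidedIdeal (PathAlgebra k VB))

/-- The projection `kQ_C → C`. -/
noncomputable def toC : PathAlgebra k (GluedQuiver X Y) →ₐ[k]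
    BoundQuiverAlgebra (gluedIdeal X Y IA IB) :=
  (gluedIdeal X Y IA IB).ringCon.mkₐ k

theorem toC_eq_zero {z : PathAlgebra k (GluedQuiver X Y)} (hz : z ∈ gluedIdeal X Y IA IB) :
    toC IA IB z = 0 := by
  rw [TwoSidedIdeal.mem_iff] at hz
  exact ((gluedIdeal X Y IA IB).ringCon.eq).2 hz

theorem toC_map_inclA {z : PathAlgebra k VA} (hz : z ∈ IA) :
    toC IA IB (PathAlgebra.map k (inclA X Y) z) = 0 :=
  toC_eq_zero IA IB (TwoSidedIdeal.subset_span
    (Or.inl <| Or.inl <| Or.inl <| Or.inl <| Or.inl ⟨z, hz, rfl⟩))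

theorem toC_map_inclB {z : PathAlgebra k VB} (hz : z ∈ IB) :
    toC IA IB (PathAlgebra.map k (inclB X Y) z) = 0 :=
  toC_eq_zero IA IB (TwoSidedIdeal.subset_span
    (Or.inl <| Or.inl <| Or.inl <| Or.inl <| Or.inr ⟨z, hz, rfl⟩))

theorem toC_arrow_mul_AB {a a' : VA} {b : VB} (e : a ⟶ a') (x : X a' b) :
    toC IA IB (arrow k ((inclA X Y).map e)) * toC IA IB (arrow k (arrowAB x)) = 0 := by
  rw [← map_mul]
  exact toC_eq_zero IA IB (TwoSidedIdeal.subset_span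
    (Or.inl <| Or.inl <| Or.inl <| Or.inr ⟨a, a', b, e, x, rfl⟩))

theorem toC_arrow_mul_BA {b b' : VB} {a : VA} (e : b ⟶ b') (y : Y b' a) :
    toC IA IB (arrow k ((inclB X Y).map e)) * toC IA IB (arrow k (arrowBA y)) = 0 := by
  rw [← map_mul]
  exact toC_eq_zero IA IB (TwoSidedIdeal.subset_span
    (Or.inl <| Or.inl <| Or.inr ⟨b, b', a, e, y, rfl⟩))

theorem toC_AB_mul_BA {a a' : VA} {b : VB} (x : X a b) (y : Y b a') :
    toC IA IB (arrow k (arrowAB x)) * toC IA IB (arrow k (arrowBA y)) = 0 := by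
  rw [← map_mul]
  exact toC_eq_zero IA IB (TwoSidedIdeal.subset_span
    (Or.inl <| Or.inr ⟨a, b, a', x, y, rfl⟩))

theorem toC_BA_mul_AB {b b' : VB} {a : VA} (y : Y b a) (x : X a b') :
    toC IA IB (arrow k (arrowBA y)) * toC IA IB (arrow k (arrowAB x)) = 0 := by
  rw [← map_mul]
  exact toC_eq_zero IA IB (TwoSidedIdeal.subset_span (Or.inr ⟨b, a, b', y, x, rfl⟩))

/-- The class in `C` of a path of `Q_A`. -/
noncomputable def pathA {a a' : VA} (q : Quiver.Path a a') :
    BoundQuiverAlgebra (gluedIdeal X Y IA IB) :=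
  toC IA IB (ofPath k ((inclA X Y).mapPath q))

/-- The class in `C` of a path of `Q_B`. -/
noncomputable def pathB {b b' : VB} (q : Quiver.Path b b') :
    BoundQuiverAlgebra (gluedIdeal X Y IA IB) :=
  toC IA IB (ofPath k ((inclB X Y).mapPath q))

theorem ofPath_cons {V : Type u} [Quiver.{v} V] {a b c : V} (q : Quiver.Path a b) (e : b ⟶ c) :
    ofPath k (q.cons e) = ofPath k q * arrow k e := by
  rw [arrow, ofPath_mul_ofPath]
  rfl

theorem pathA_cons {a a' a'' : VA} (q : Quiver.Path a a') (e : a' ⟶ a'') :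
    pathA (X := X) (Y := Y) IA IB (q.cons e) =
      pathA IA IB q * toC IA IB (arrow k ((inclA X Y).map e)) := by
  rw [pathA, Prefunctor.mapPath_cons, ofPath_cons, map_mul, pathA]

theorem pathB_cons {b b' b'' : VB} (q : Quiver.Path b b') (e : b' ⟶ b'') :
    pathB (X := X) (Y := Y) IA IB (q.cons e) =
      pathB IA IB q * toC IA IB (arrow k ((inclB X Y).map e)) := by
  rw [pathB, Prefunctor.mapPath_cons, ofPath_cons, map_mul, pathB]

theorem pathA_nil_mul (a : VA) {b : VB} (x : X a b) :
    pathA IA IB (Quiver.Path.nil : Quiver.Path a a) * toC IA IB (arrow k (arrowAB x)) =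
      toC (X := X) (Y := Y) IA IB (arrow k (arrowAB x)) := by
  rw [pathA, ← map_mul, arrow]
  congr 1
  exact (ofPath_mul_ofPath _ _).trans (by rw [Prefunctor.mapPath_nil]; exact congrArg _ (Quiver.Path.nil_comp _))

theorem pathB_nil_mul (b : VB) {a : VA} (y : Y b a) :
    pathB IA IB (Quiver.Path.nil : Quiver.Path b b) * toC IA IB (arrow k (arrowBA y)) =
      toC (X := X) (Y := Y) IA IB (arrow k (arrowBA y)) := by
  rw [pathB, ← map_mul, arrow]
  congr 1
  exact (ofPath_mul_ofPath _ _).trans (by rw [Prefunctor.mapPath_nil]; exact congrArg _ (Quiver.Path.nil_comp _))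

theorem AB_mul_pathB_nil {a : VA} {b : VB} (x : X a b) :
    toC IA IB (arrow k (arrowAB x)) * pathB IA IB (Quiver.Path.nil : Quiver.Path b b) =
      toC (X := X) (Y := Y) IA IB (arrow k (arrowAB x)) := by
  rw [pathB, ← map_mul, arrow]
  congr 1
  exact (ofPath_mul_ofPath _ _).trans rfl

theorem BA_mul_pathA_nil {b : VB} {a : VA} (y : Y b a) :
    toC IA IB (arrow k (arrowBA y)) * pathA IA IB (Quiver.Path.nil : Quiver.Path a a) =
      toC (X := X) (Y := Y) IA IB (arrow k (arrowBA y)) := by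
  rw [pathA, ← map_mul, arrow]
  congr 1
  exact (ofPath_mul_ofPath _ _).trans rfl

/-- The nonzero classes of paths of `Q_C` ending at a given vertex. -/
def NormalForm : GluedQuiver X Y → BoundQuiverAlgebra (gluedIdeal X Y IA IB) → Prop
  | inA a, z => z = 0 ∨ (∃ (a₀ : VA) (q : Quiver.Path a₀ a), z = pathA IA IB q) ∨
      ∃ (b : VB) (a₀ : VA) (y : Y b a₀) (q : Quiver.Path a₀ a),
        z = toC IA IB (arrow k (arrowBA y)) * pathA IA IB q
  | inB b, z => z = 0 ∨ (∃ (b₀ : VB) (q : Quiver.Path b₀ b), z = pathB IA IB q) ∨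
      ∃ (a : VA) (b₀ : VB) (x : X a b₀) (q : Quiver.Path b₀ b),
        z = toC IA IB (arrow k (arrowAB x)) * pathB IA IB q

theorem NormalForm.mul_arrow : ∀ {w w' : GluedQuiver X Y} (e : w ⟶ w')
    {z : BoundQuiverAlgebra (gluedIdeal X Y IA IB)}, NormalForm IA IB w z →
    NormalForm IA IB w' (z * toC IA IB (arrow k e))
  | inA a, inA a', e, z, h => by
    rcases h with rfl | ⟨a₀, q, rfl⟩ | ⟨b, a₀, y, q, rfl⟩
    · exact Or.inl (zero_mul _)
    · exact Or.inr (Or.inl ⟨a₀, q.cons e, (pathA_cons IA IB q e).symm⟩)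
    · refine Or.inr (Or.inr ⟨b, a₀, y, q.cons e, ?_⟩)
      rw [pathA_cons, ← mul_assoc]
      rfl
  | inB b, inB b', e, z, h => by
    rcases h with rfl | ⟨b₀, q, rfl⟩ | ⟨a, b₀, x, q, rfl⟩
    · exact Or.inl (zero_mul _)
    · exact Or.inr (Or.inl ⟨b₀, q.cons e, (pathB_cons IA IB q e).symm⟩)
    · refine Or.inr (Or.inr ⟨a, b₀, x, q.cons e, ?_⟩)
      rw [pathB_cons, ← mul_assoc]
      rfl
  | inA a, inB b', x, z, h => by
    change NormalForm IA IB (inB b') (z * toC IA IB (arrow k (arrowAB x)))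
    rcases h with rfl | ⟨a₀, q, rfl⟩ | ⟨b, a₀, y, q, rfl⟩
    · exact Or.inl (zero_mul _)
    · cases q with
      | nil =>
        refine Or.inr (Or.inr ⟨a, b', x, Quiver.Path.nil, ?_⟩)
        rw [pathA_nil_mul, AB_mul_pathB_nil]
      | cons q e =>
        refine Or.inl ?_
        rw [pathA_cons, mul_assoc, toC_arrow_mul_AB, mul_zero]
    · refine Or.inl ?_
      cases q with
      | nil => rw [BA_mul_pathA_nil, toC_BA_mul_AB]
      | cons q e => rw [pathA_cons, mul_assoc, mul_assoc, toC_arrow_mul_AB, mul_zero, mul_zero]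
  | inB b, inA a', y, z, h => by
    change NormalForm IA IB (inA a') (z * toC IA IB (arrow k (arrowBA y)))
    rcases h with rfl | ⟨b₀, q, rfl⟩ | ⟨a, b₀, x, q, rfl⟩
    · exact Or.inl (zero_mul _)
    · cases q with
      | nil =>
        refine Or.inr (Or.inr ⟨b, a', y, Quiver.Path.nil, ?_⟩)
        rw [pathB_nil_mul, BA_mul_pathA_nil]
      | cons q e =>
        refine Or.inl ?_
        rw [pathB_cons, mul_assoc, toC_arrow_mul_BA, mul_zero]
    · refine Or.inl ?_
      cases q with
      | nil => rw [AB_mul_pathB_nil, toC_AB_mul_BA]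
      | cons q e => rw [pathB_cons, mul_assoc, mul_assoc, toC_arrow_mul_BA, mul_zero, mul_zero]

theorem normalForm_ofPath {v w : GluedQuiver X Y} (p : Quiver.Path v w) :
    NormalForm IA IB w (toC IA IB (ofPath k p)) := by
  induction p with
  | nil =>
    cases v with
    | inA a => exact Or.inr (Or.inl ⟨a, Quiver.Path.nil, rfl⟩)
    | inB b => exact Or.inr (Or.inl ⟨b, Quiver.Path.nil, rfl⟩)
  | cons p e ih =>
    rw [ofPath_cons, map_mul]
    exact ih.mul_arrow IA IB e

theorem fg_range_of_ker_le {M M' N : Type*} [AddCommGroup M] [Module k M] [AddCommGroup M']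
    [Module k M'] [AddCommGroup N] [Module k N] [Module.Finite k M'] (f : M →ₗ[k] N)
    (g : M →ₗ[k] M') (hg : Function.Surjective g) (h : LinearMap.ker g ≤ LinearMap.ker f) :
    (LinearMap.range f).FG := by
  let t : M' →ₗ[k] N :=
    ((LinearMap.ker g).liftQ f h).comp (g.quotKerEquivOfSurjective hg).symm.toLinearMap
  have ht : t.comp g = f := by
    ext x
    have : (g.quotKerEquivOfSurjective hg).symm (g x) = Submodule.Quotient.mk x := by
      rw [LinearEquiv.symm_apply_eq]
      rfl
    simp [t, this]
  rw [← ht, LinearMap.range_comp, LinearMap.range_eq_top.2 hg, Submodule.map_top]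
  exact Module.Finite.fg_top.map t |> fun h => by rwa [Submodule.map_top] at h

theorem mk_eq_zero_iff {V : Type u} [Quiver.{v} V] [Fintype V] (I : TwoSidedIdeal (PathAlgebra k V))
    (z : PathAlgebra k V) : I.ringCon.mkₐ k z = 0 ↔ z ∈ I := by
  rw [TwoSidedIdeal.mem_iff]
  exact I.ringCon.eq

instance finite_glued [∀ a b, Finite (X a b)] [∀ b a, Finite (Y b a)]
    [Module.Finite k (BoundQuiverAlgebra IA)] [Module.Finite k (BoundQuiverAlgebra IB)] :
    Module.Finite k (BoundQuiverAlgebra (gluedIdeal X Y IA IB)) := by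
  let fA := (toC (X := X) (Y := Y) IA IB).toLinearMap.comp (PathAlgebra.map k (inclA X Y))
  let fB := (toC (X := X) (Y := Y) IA IB).toLinearMap.comp (PathAlgebra.map k (inclB X Y))
  have hA : (LinearMap.range fA).FG :=
    fg_range_of_ker_le fA (IA.ringCon.mkₐ k).toLinearMap IA.ringCon.mk'_surjective
      fun z hz => toC_map_inclA IA IB ((mk_eq_zero_iff IA z).1 hz)
  have hB : (LinearMap.range fB).FG :=
    fg_range_of_ker_le fB (IB.ringCon.mkₐ k).toLinearMap IB.ringCon.mk'_surjective
      fun z hz => toC_map_inclB IA IB ((mk_eq_zero_iff IB z).1 hz)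
  have hpA : ∀ {a a' : VA} (q : Quiver.Path a a'), pathA IA IB q ∈ LinearMap.range fA :=
    fun q => ⟨ofPath k q, by simp [fA, map_ofPath, pathA]⟩
  have hpB : ∀ {b b' : VB} (q : Quiver.Path b b'), pathB IA IB q ∈ LinearMap.range fB :=
    fun q => ⟨ofPath k q, by simp [fB, map_ofPath, pathB]⟩
  let WX : Submodule k (BoundQuiverAlgebra (gluedIdeal X Y IA IB)) :=
    ⨆ i : Σ (a : VA) (b : VB), X a b, (LinearMap.range fB).map
      (LinearMap.mulLeft k (toC IA IB (arrow k (arrowAB i.2.2))))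
  let WY : Submodule k (BoundQuiverAlgebra (gluedIdeal X Y IA IB)) :=
    ⨆ i : Σ (b : VB) (a : VA), Y b a, (LinearMap.range fA).map
      (LinearMap.mulLeft k (toC IA IB (arrow k (arrowBA i.2.2))))
  have hX : WX.FG := Submodule.fg_iSup _ fun i => hB.map _
  have hY : WY.FG := Submodule.fg_iSup _ fun i => hA.map _
  refine ⟨?_⟩
  have htop : (⊤ : Submodule k (BoundQuiverAlgebra (gluedIdeal X Y IA IB))) =
      (LinearMap.range fA ⊔ LinearMap.range fB) ⊔ (WX ⊔ WY) := by
    refine le_antisymm ?_ le_top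
    rintro z -
    obtain ⟨z, rfl⟩ := (gluedIdeal X Y IA IB).ringCon.mk'_surjective z
    change toC IA IB z ∈ _
    induction z using induction_path with
    | zero => rw [map_zero]; exact Submodule.zero_mem _
    | add _ _ h1 h2 => rw [map_add]; exact Submodule.add_mem _ h1 h2
    | smul c _ h => rw [map_smul]; exact Submodule.smul_mem _ c h
    | path v w p =>
      have hp := normalForm_ofPath (k := k) IA IB p
      cases w with
      | inA a =>
        rcases hp with h | ⟨a₀, q, h⟩ | ⟨b, a₀, y, q, h⟩ <;> rw [h]
        · exact Submodule.zero_mem _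
        · exact Submodule.mem_sup_left (Submodule.mem_sup_left (hpA q))
        · exact Submodule.mem_sup_right (Submodule.mem_sup_right
            (Submodule.mem_iSup_of_mem ⟨b, a₀, y⟩ ⟨_, hpA q, rfl⟩))
      | inB b =>
        rcases hp with h | ⟨b₀, q, h⟩ | ⟨a, b₀, x, q, h⟩ <;> rw [h]
        · exact Submodule.zero_mem _
        · exact Submodule.mem_sup_left (Submodule.mem_sup_right (hpB q))
        · exact Submodule.mem_sup_right (Submodule.mem_sup_left
            (Submodule.mem_iSup_of_mem ⟨a, b₀, x⟩ ⟨_, hpB q, rfl⟩))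
  rw [htop]
  exact (hA.sup hB).sup (hX.sup hY)

end Finite

end GluedQuiver

end Glue

/-! Every element of `K0 R` is a difference [M] - [N], hence lies in ⟨add (M ⊕ N)⟩. So φdim R ≤ d
exactly when the kernels of the powers of Ω̄ on the whole of `K0 R` stop growing at d
(`leftPhiDim_le_iff_kerStable`), and the question becomes linear algebra for endomorphisms of groups
that are torsion-free (`K0.eq_zero_of_zsmul_eq_zero`).

Put Γ = A × B, whose φ-dimension is the maximum of those of A and B (`leftPhiDim_eq_max`). The
relations forbid any arrow before an additional arrow x_j. Hence C = Γ ⊕ ⨁ x_j Γ, where x_j Γ ≅ e_j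
Γ for the idempotent e_j at the target of x_j, and C acts on x_j from the left through the character
at its source (`GlueData`). The kernel I of C → Γ therefore satisfies rad C · I = 0 and is
projective as a right Γ-module. On either side the syzygy operators of C and Γ agree up to a
subgroup with n = |Q_A| + |Q_B| generators (counting vertices). On an invariant subgroup with n
generators, kernels of powers are stationary after n steps (`iterate_card_eq_zero`); one further
step is spent on passing to a first syzygy.

Right modules: a syzygy lies in P · rad C, so I annihilates it and it is a Γ-module. For a Γ-module
N, the C-syzygy is the Γ-syzygy plus a Γ-projective summand, up to Γ-projectives
(`exists_mk_syzygy_inflation`). On the subgroup of `K0 C` generated by Γ-modules, reduction to `K0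
Γ` is onto, commutes with Ω̄, and has kernel generated by the indecomposable projective Γ-modules.
`KerStable.of_ker_fg` gives the upper bound and `KerStable.of_surjOn` the lower one.

Left modules: induction C ⊗ - from Γ is exact, preserves projectives, commutes with Ω̄ and is a
section of reduction, so it embeds `K0 Γ` and gives the lower bound. Since rad C kills IM, the
syzygy of M is the module induced from the syzygy of M / IM plus a semisimple summand
(`GlueData.exists_mk_syzygy_eq_add`). So Ω̄ differs from the operator induced from Γ by combinations
of simple modules, and `KerStable.of_section` gives the upper bound. -/

namespace IgusaTodorov

/-! ### Additive functions on modules and the group K₀ -/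

section Additive

variable {R : Type u} [Ring R] {G : Type*} [AddCommGroup G]

/-- Functions on finitely generated modules that are additive on direct sums. -/
def IsAdditive (f : FGModuleCat.{u} R → G) : Prop :=
  ∀ M M' M'' : FGModuleCat.{u} R, (M ≃ₗ[R] (M' × M'')) → f M = f M' + f M''

/-- A zero module satisfies M ≅ M ⊕ M, so its value equals its own double. -/
theorem IsAdditive.of_subsingleton {f : FGModuleCat.{u} R → G} (hf : IsAdditive f)
    (M : FGModuleCat.{u} R) [Subsingleton M] : f M = 0 := by
  have h := hf M M M
    { toFun := fun x => (x, x), invFun := fun x => x.1, map_add' := fun _ _ => rfl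
      map_smul' := fun _ _ => rfl, left_inv := fun _ => rfl
      right_inv := fun z => Prod.ext rfl (Subsingleton.elim (α := M) _ _) }
  simpa using h

theorem IsAdditive.congr {f : FGModuleCat.{u} R → G} (hf : IsAdditive f)
    {M N : FGModuleCat.{u} R} (e : M ≃ₗ[R] N) : f M = f N := by
  have h := hf M N (FGModuleCat.of R PUnit.{u + 1})
    (e.trans (LinearEquiv.prodUnique (R := R) (M := N) (M₂ := PUnit.{u + 1})).symm)
  have : Subsingleton (FGModuleCat.of R PUnit.{u + 1}) :=
    inferInstanceAs (Subsingleton PUnit.{u + 1})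
  rwa [hf.of_subsingleton (FGModuleCat.of R PUnit.{u + 1}), add_zero] at h

theorem isAdditive_mk : IsAdditive (K0.mk : FGModuleCat.{u} R → K0 R) :=
  fun _ _ _ e => K0.mk_eq_add e

/-- `N` is isomorphic to a direct summand of `M`. -/
def IsSummand (N M : FGModuleCat.{u} R) : Prop :=
  ∃ N' : FGModuleCat.{u} R, Nonempty (M ≃ₗ[R] (N × N'))

theorem IsSummand.trans {N M L : FGModuleCat.{u} R} (h : IsSummand N M) (h' : IsSummand M L) :
    IsSummand N L := by
  obtain ⟨N', ⟨e⟩⟩ := h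
  obtain ⟨M', ⟨e'⟩⟩ := h'
  exact ⟨FGModuleCat.of R (N' × M'), ⟨e'.trans ((e.prodCongr (LinearEquiv.refl R M')).trans
    (LinearEquiv.prodAssoc R N N' M'))⟩⟩

theorem isSummand_left (N N' : FGModuleCat.{u} R) : IsSummand N (FGModuleCat.of R (N × N')) :=
  ⟨N', ⟨LinearEquiv.refl R _⟩⟩

theorem isSummand_right (N N' : FGModuleCat.{u} R) : IsSummand N' (FGModuleCat.of R (N × N')) :=
  ⟨N, ⟨LinearEquiv.prodComm R _ _⟩⟩

theorem IsSummand.of_equiv_left {M M' M'' : FGModuleCat.{u} R} (e : M ≃ₗ[R] (M' × M'')) :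
    IsSummand M' M := ⟨M'', ⟨e⟩⟩

theorem IsSummand.of_equiv_right {M M' M'' : FGModuleCat.{u} R} (e : M ≃ₗ[R] (M' × M'')) :
    IsSummand M'' M := ⟨M', ⟨e.trans (LinearEquiv.prodComm R _ _)⟩⟩

theorem IsSummand.of_retraction [IsNoetherianRing R] {N M : FGModuleCat.{u} R} (i : N →ₗ[R] M)
    (p : M →ₗ[R] N) (h : ∀ x, p (i x) = x) : IsSummand N M := by
  let e : M ≃ₗ[R] (N × LinearMap.ker p) :=
    { toFun := fun x => (p x, ⟨x - i (p x), by simp [h]⟩)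
      invFun := fun z => i z.1 + z.2
      map_add' := fun x y => by
        ext
        · simp
        · simp only [map_add, Prod.snd_add, Submodule.coe_add]; abel
      map_smul' := fun c x => by
        ext
        · simp
        · simp [smul_sub]
      left_inv := fun x => by simp
      right_inv := fun z => by
        have : p (z.2 : M) = 0 := z.2.2
        ext <;> simp [h, this] }
  exact ⟨FGModuleCat.of R (LinearMap.ker p), ⟨e⟩⟩

theorem IsSummand.projective {N M : FGModuleCat.{u} R} (h : IsSummand N M)
    (hM : Module.Projective R M) : Module.Projective R N := by
  obtain ⟨N', ⟨e⟩⟩ := h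
  exact Module.Projective.of_split (e.symm.toLinearMap.comp (LinearMap.inl R N N'))
    ((LinearMap.fst R N N').comp e.toLinearMap) (by ext x; simp)

theorem IsSummand.exists_retraction {N M : FGModuleCat.{u} R} (h : IsSummand N M) :
    ∃ (i : N →ₗ[R] M) (p : M →ₗ[R] N), ∀ x, p (i x) = x := by
  obtain ⟨N', ⟨e⟩⟩ := h
  exact ⟨e.symm.toLinearMap.comp (LinearMap.inl R N N'),
    (LinearMap.fst R N N').comp e.toLinearMap, fun x => by simp⟩

/-- The value of an additive function at `M` lies in the subgroup generated by its values at the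
indecomposable direct summands of `M`. -/
theorem IsAdditive.mem_closure [IsArtinianRing R] {f : FGModuleCat.{u} R → G} (hf : IsAdditive f)
    (M : FGModuleCat.{u} R) : f M ∈ AddSubgroup.closure
      {x | ∃ N : FGModuleCat.{u} R, IsSummand N M ∧ IsIndecomposable (R := R) N ∧ x = f N} := by
  -- Induction on the length, which is finite over an artinian ring and drops strictly in a proper
  -- decomposition.
  obtain ⟨n, hn⟩ := ENat.ne_top_iff_exists.1 (Module.length_ne_top (R := R) (M := M))
  induction n using Nat.strong_induction_on generalizing M with
  | _ n ih =>
  rcases subsingleton_or_nontrivial M with h | h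
  · rw [hf.of_subsingleton]
    exact zero_mem _
  by_cases hM : IsIndecomposable (R := R) M
  · exact AddSubgroup.subset_closure ⟨M, ⟨FGModuleCat.of R PUnit.{u + 1},
      ⟨(LinearEquiv.prodUnique (R := R) (M := M) (M₂ := PUnit.{u + 1})).symm⟩⟩, hM, rfl⟩
  · have : ∃ p q : Submodule R M, IsCompl p q ∧ p ≠ ⊥ ∧ q ≠ ⊥ := by
      by_contra hcon
      refine hM ⟨h, fun p q hpq => ?_⟩
      by_contra h2
      exact hcon ⟨p, q, hpq, fun h3 => h2 (Or.inl h3), fun h3 => h2 (Or.inr h3)⟩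
    obtain ⟨p, q, hpq, hp, hq⟩ := this
    have e : M ≃ₗ[R] (FGModuleCat.of R p × FGModuleCat.of R q) :=
      (Submodule.prodEquivOfIsCompl p q hpq).symm
    have hp' : p ≠ ⊤ := fun h3 => hq (by simpa [h3] using hpq.inf_eq_bot)
    have hq' : q ≠ ⊤ := fun h3 => hp (by simpa [h3] using hpq.inf_eq_bot)
    have key : ∀ s : Submodule R M, s ≠ ⊤ → ∃ m < n, (m : ℕ∞) = Module.length R s := by
      intro s hs
      have h1 := Submodule.length_lt hs
      rw [← hn] at h1
      obtain ⟨m, hm⟩ := ENat.ne_top_iff_exists.1 h1.ne_top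
      refine ⟨m, ?_, hm⟩
      rw [← hm] at h1
      exact_mod_cast h1
    rw [hf M _ _ e]
    refine add_mem ?_ ?_
    · obtain ⟨m, hm, hl⟩ := key p hp'
      refine AddSubgroup.closure_mono ?_ (ih m hm (FGModuleCat.of R p) hl)
      rintro x ⟨N, h1, h2, rfl⟩
      exact ⟨N, h1.trans (IsSummand.of_equiv_left e), h2, rfl⟩
    · obtain ⟨m, hm, hl⟩ := key q hq'
      refine AddSubgroup.closure_mono ?_ (ih m hm (FGModuleCat.of R q) hl)
      rintro x ⟨N, h1, h2, rfl⟩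
      exact ⟨N, h1.trans (IsSummand.of_equiv_right e), h2, rfl⟩

/-- An additive function vanishing on projective modules induces a homomorphism on `K₀(R)`. -/
def K0.lift (f : FGModuleCat.{u} R → G) (hf : IsAdditive f)
    (hP : ∀ P : FGModuleCat.{u} R, Module.Projective R P → f P = 0) : K0 R →+ G :=
  QuotientAddGroup.lift (AddSubgroup.closure (K0Relations R)) (FreeAbelianGroup.lift f) <| by
    rw [AddSubgroup.closure_le]
    rintro x (⟨M, M', M'', ⟨e⟩, rfl⟩ | ⟨P, hP', rfl⟩)
    · simp [hf M M' M'' e]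
    · simp [hP P hP']

theorem K0.lift_mk (f : FGModuleCat.{u} R → G) (hf : IsAdditive f)
    (hP : ∀ P : FGModuleCat.{u} R, Module.Projective R P → f P = 0) (M : FGModuleCat.{u} R) :
    K0.lift f hf hP (K0.mk M) = f M :=
  FreeAbelianGroup.lift_apply_of _ _

/-- Direct sums realise addition of symbols, so the positive and the negative terms can each be
collected into one module. -/
theorem K0.exists_eq_sub (x : K0 R) :
    ∃ M N : FGModuleCat.{u} R, x = K0.mk M - K0.mk N := by
  obtain ⟨x, rfl⟩ := QuotientAddGroup.mk_surjective x
  induction x using FreeAbelianGroup.induction_on with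
  | zero =>
    exact ⟨FGModuleCat.of R PUnit.{u + 1}, FGModuleCat.of R PUnit.{u + 1}, by
      rw [sub_self]; rfl⟩
  | of M =>
    refine ⟨M, FGModuleCat.of R PUnit.{u + 1}, ?_⟩
    rw [K0.mk_projective (P := FGModuleCat.of R PUnit.{u + 1})
      (inferInstanceAs (Module.Projective R PUnit.{u + 1})), sub_zero]
    rfl
  | neg M ih =>
    refine ⟨FGModuleCat.of R PUnit.{u + 1}, M, ?_⟩
    rw [K0.mk_projective (P := FGModuleCat.of R PUnit.{u + 1})
      (inferInstanceAs (Module.Projective R PUnit.{u + 1})), zero_sub]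
    rfl
  | add x y hx hy =>
    obtain ⟨M, N, h⟩ := hx
    obtain ⟨M', N', h'⟩ := hy
    refine ⟨FGModuleCat.of R (M × M'), FGModuleCat.of R (N × N'), ?_⟩
    rw [K0.mk_eq_add (M := FGModuleCat.of R (M × M')) (M' := M) (M'' := M')
      (LinearEquiv.refl R _), K0.mk_eq_add (M := FGModuleCat.of R (N × N')) (M' := N) (M'' := N')
      (LinearEquiv.refl R _)]
    refine (congrArg₂ (· + ·) h h').trans ?_
    abel

theorem K0.hom_ext {f g : K0 R →+ G} (h : ∀ M, f (K0.mk M) = g (K0.mk M)) : f = g := by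
  ext x
  obtain ⟨M, N, rfl⟩ := K0.exists_eq_sub x
  simp [h]

end Additive

/-! ### The φ-dimension through kernels of powers of Ω̄ -/

section PhiDim

/-- Injectivity of `f` on the subgroup f^m(X) is tested on its kernel. The condition on the
threshold is upward closed, so the infimum may be replaced by `d` itself. -/
theorem eta_le_iff {G : Type*} [AddCommGroup G] (f : G →+ G) (X : AddSubgroup G) (d : ℕ) :
    eta f X ≤ d ↔ ∀ m ≥ d, ∀ x ∈ X, f^[m + 1] x = 0 → f^[m] x = 0 := by
  have hinj : ∀ m, Set.InjOn f (f^[m] '' (X : Set G)) ↔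
      ∀ x ∈ X, f^[m + 1] x = 0 → f^[m] x = 0 := by
    intro m
    constructor
    · intro h x hx h0
      refine h ⟨x, hx, rfl⟩ ⟨0, X.zero_mem, iterate_map_zero f m⟩ ?_
      rw [← Function.iterate_succ_apply' f, h0, map_zero]
    · rintro h _ ⟨x, hx, rfl⟩ _ ⟨y, hy, rfl⟩ hxy
      have := h (x - y) (X.sub_mem hx hy) (by
        rw [iterate_map_sub, Function.iterate_succ_apply', Function.iterate_succ_apply', hxy,
          sub_self])
      rwa [iterate_map_sub, sub_eq_zero] at this
  unfold eta
  simp only [hinj]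
  constructor
  · intro h
    by_contra hcon
    have : ((d + 1 : ℕ) : ℕ∞) ≤ ⨅ (k : ℕ) (_ : ∀ m ≥ k, ∀ x ∈ X, f^[m + 1] x = 0 →
        f^[m] x = 0), (k : ℕ∞) := by
      refine le_iInf₂ fun k hk => ?_
      by_contra hlt
      have hkd : k ≤ d := by
        by_contra h3
        exact hlt (by exact_mod_cast Nat.succ_le_of_lt (not_le.1 h3))
      exact hcon fun m hm => hk m (hkd.trans hm)
    have := this.trans h
    have h4 : d + 1 ≤ d := by exact_mod_cast this
    omega
  · intro h
    exact iInf₂_le d h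

variable {R : Type u} [Ring R] [IsArtinianRing R]

/-- `addClosure` is generated by indecomposable summands; additivity brings in all the other
summands. -/
theorem mk_mem_addClosure {N M : FGModuleCat.{u} R} (h : IsSummand N M) :
    K0.mk N ∈ addClosure M := by
  refine AddSubgroup.closure_mono ?_ (isAdditive_mk.mem_closure N)
  rintro x ⟨L, hL, hi, rfl⟩
  obtain ⟨L', hL'⟩ := hL.trans h
  exact ⟨L, L', hL', hi, rfl⟩

/-- The `φ`-dimension is at most `d` if and only if the kernels of the powers of `Ω̄` are
stationary from `d` on. -/
theorem leftPhiDim_le_iff (d : ℕ) : leftPhiDim R ≤ d ↔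
    ∀ x : K0 R, (syzygyHom R)^[d + 1] x = 0 → (syzygyHom R)^[d] x = 0 := by
  unfold leftPhiDim leftPhi
  simp only [iSup_le_iff, eta_le_iff]
  constructor
  · intro h x hx
    obtain ⟨M, N, rfl⟩ := K0.exists_eq_sub x
    -- One module M ⊕ N suffices for the given element: both classes lie in its ⟨add⟩.
    exact h (FGModuleCat.of R (M × N)) d le_rfl _ (AddSubgroup.sub_mem _
      (mk_mem_addClosure (isSummand_left M N)) (mk_mem_addClosure (isSummand_right M N))) hx
  · intro h M m hm x _ hx
    obtain ⟨j, rfl⟩ := Nat.exists_eq_add_of_le hm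
    rw [Function.iterate_add_apply]
    refine h _ ?_
    rw [← Function.iterate_add_apply, add_right_comm]
    exact hx

/-- The one-step statement at `d`, applied to iterates of `x`, lowers the exponent `n` one at a time
until it reaches `d`. -/
theorem iterate_syzygyHom_eq_zero {d : ℕ} (h : leftPhiDim R ≤ d) {n : ℕ} {x : K0 R}
    (hx : (syzygyHom R)^[n] x = 0) : (syzygyHom R)^[d] x = 0 := by
  rcases le_total n d with hn | hn
  · obtain ⟨j, rfl⟩ := Nat.exists_eq_add_of_le hn
    rw [add_comm, Function.iterate_add_apply, hx, iterate_map_zero]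
  · induction n, hn using Nat.le_induction with
    | base => exact hx
    | succ n hn ih =>
      refine ih ?_
      obtain ⟨j, rfl⟩ := Nat.exists_eq_add_of_le hn
      rw [Function.iterate_add_apply]
      refine (leftPhiDim_le_iff d).1 h _ ?_
      rw [← Function.iterate_add_apply, add_right_comm]
      exact hx

end PhiDim

/-! ### Endomorphisms of indecomposable modules -/

section Fitting

variable {R : Type u} [Ring R] [IsArtinianRing R]

/-- Fitting's lemma for indecomposable modules. -/
theorem IsIndecomposable.isNilpotent_or_isUnit {N : Type u} [AddCommGroup N] [Module R N]
    [Module.Finite R N] (hN : IsIndecomposable (R := R) N) (f : Module.End R N) :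
    IsNilpotent f ∨ IsUnit f := by
  obtain ⟨n, hn0, hn⟩ :=
    ((Filter.eventually_ge_atTop 1).and f.eventually_isCompl_ker_pow_range_pow).exists
  rcases hN.2 _ _ hn with h | h
  · right
    have hr : LinearMap.range (f ^ n) = ⊤ := by simpa [h] using hn.sup_eq_top
    have : IsUnit (f ^ n) := (Module.End.isUnit_iff _).2
      ⟨LinearMap.ker_eq_bot.1 h, LinearMap.range_eq_top.1 hr⟩
    exact (isUnit_pow_iff (by omega)).1 this
  · exact Or.inl ⟨n, LinearMap.range_eq_bot.1 h⟩

/-- If no multiple y f is a unit, then by Fitting every y f is nilpotent and every y f + 1 is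
invertible, which is the criterion for `f` to lie in the radical. -/
theorem IsIndecomposable.isUnit_of_not_mem_jacobson {N : Type u} [AddCommGroup N] [Module R N]
    [Module.Finite R N] (hN : IsIndecomposable (R := R) N) {f : Module.End R N}
    (hf : f ∉ Ring.jacobson (Module.End R N)) : ∃ h : Module.End R N, IsUnit (h * f) := by
  by_contra hcon
  refine hf ?_
  rw [← Ideal.jacobson_bot, Ideal.mem_jacobson_iff]
  intro y
  rcases hN.isNilpotent_or_isUnit (y * f) with h | h
  · obtain ⟨z, hz⟩ := h.isUnit_add_one.exists_left_inv
    refine ⟨z, ?_⟩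
    rw [Ideal.mem_bot, ← hz]
    noncomm_ring
  · exact absurd ⟨y, h⟩ hcon

/-- The idempotent i ∘ p of `M` is nonzero, hence not nilpotent, hence invertible by Fitting; this
makes `p` bijective. -/
theorem IsIndecomposable.nonempty_equiv {N M : FGModuleCat.{u} R}
    (hN : IsIndecomposable (R := R) N) (hM : IsIndecomposable (R := R) M) (h : IsSummand N M) :
    Nonempty (N ≃ₗ[R] M) := by
  obtain ⟨i, p, hip⟩ := h.exists_retraction
  rcases hM.isNilpotent_or_isUnit (i.comp p) with ⟨n, h⟩ | h
  · exfalso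
    have := hN.1
    obtain ⟨x, hx⟩ := exists_ne (0 : N)
    have key : ∀ n : ℕ, ((i.comp p) ^ n) (i x) = i x := fun n => by
      induction n with
      | zero => rfl
      | succ n ih => rw [pow_succ, Module.End.mul_apply, LinearMap.comp_apply, hip, ih]
    have h2 := key n
    rw [h, LinearMap.zero_apply] at h2
    exact hx (by rw [← hip x, ← h2, map_zero])
  · have hb := (Module.End.isUnit_iff _).1 h
    have hp : Function.Bijective p :=
      ⟨fun x y hxy => hb.1 (congrArg i hxy), fun y => ⟨i y, hip y⟩⟩
    exact ⟨(LinearEquiv.ofBijective p hp).symm⟩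

end Fitting

/-! ### Multiplicities of indecomposable summands and torsion-freeness of K₀ -/

section Multiplicity

variable (k : Type w) [Field k] {R : Type u} [Ring R] [Algebra k R]

/-- The morphisms `N → M` all of whose composites with morphisms `M → N` are in the radical of
`End(N)`. -/
def radHom (N M : Type u) [AddCommGroup N] [AddCommGroup M] [Module R N] [Module R M]
    [Module k N] [Module k M] [IsScalarTower k R N] [IsScalarTower k R M] :
    Submodule k (N →ₗ[R] M) where
  carrier := {f | ∀ g : M →ₗ[R] N, (g.comp f : Module.End R N) ∈ Ring.jacobson (Module.End R N)}
  add_mem' hf hf' g := by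
    rw [LinearMap.comp_add]
    exact add_mem (hf g) (hf' g)
  zero_mem' g := by
    rw [LinearMap.comp_zero]
    exact zero_mem _
  smul_mem' c f hf g := by
    have : (g.comp (c • f) : Module.End R N) = (c • (1 : Module.End R N)) * g.comp f := by
      ext x
      simp
    rw [this]
    exact Ideal.mul_mem_left _ _ (hf g)

section

variable (N M M' M'' : Type u) [AddCommGroup N] [AddCommGroup M] [AddCommGroup M']
  [AddCommGroup M''] [Module R N] [Module R M] [Module R M'] [Module R M'']
  [Module k N] [Module k M] [Module k M'] [Module k M''] [IsScalarTower k R N]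
  [IsScalarTower k R M] [IsScalarTower k R M'] [IsScalarTower k R M'']

theorem finite_linearMap [Module.Finite k N] [Module.Finite k M] :
    Module.Finite k (N →ₗ[R] M) :=
  Module.Finite.of_injective (LinearMap.restrictScalarsₗ k R N M k)
    (LinearMap.restrictScalars_injective k)

variable {N M M'} in
theorem comp_mem_radHom {f : N →ₗ[R] M} (hf : f ∈ radHom k (R := R) N M)
    (h : M →ₗ[R] M') : h.comp f ∈ radHom k (R := R) N M' := fun g => by
  rw [← LinearMap.comp_assoc]
  exact hf _

variable (R) in
/-- The multiplicity of an indecomposable module `N` in `M`, up to a factor depending on `N`. -/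
noncomputable def summandMultiplicity : ℤ :=
  (Module.finrank k (N →ₗ[R] M) : ℤ) - Module.finrank k (radHom k (R := R) N M)

variable {M M' M''} in
theorem summandMultiplicity_eq_add [Module.Finite k N] [Module.Finite k M'] [Module.Finite k M'']
    (e : M ≃ₗ[R] (M' × M'')) : summandMultiplicity k R N M =
      summandMultiplicity k R N M' + summandMultiplicity k R N M'' := by
  have := finite_linearMap k (R := R) N M'
  have := finite_linearMap k (R := R) N M''
  let E : (N →ₗ[R] M) ≃ₗ[k] ((N →ₗ[R] M') × (N →ₗ[R] M'')) :=
    { toFun := fun f => ((LinearMap.fst R M' M'').comp (e.toLinearMap.comp f),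
        (LinearMap.snd R M' M'').comp (e.toLinearMap.comp f))
      invFun := fun z => e.symm.toLinearMap.comp (z.1.prod z.2)
      map_add' := fun f g => by ext <;> simp
      map_smul' := fun c f => by
        ext x
        · exact congrArg Prod.fst (LinearMap.map_smul_of_tower e.toLinearMap c (f x))
        · exact congrArg Prod.snd (LinearMap.map_smul_of_tower e.toLinearMap c (f x))
      left_inv := fun f => by ext x; simp
      right_inv := fun z => by ext x <;> simp }
  have hE : (radHom k (R := R) N M).map E.toLinearMap =
      (radHom k (R := R) N M').prod (radHom k (R := R) N M'') := by
    ext ⟨f, g⟩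
    constructor
    · rintro ⟨h, hh, heq⟩
      obtain ⟨rfl, rfl⟩ := Prod.mk.inj heq
      exact ⟨comp_mem_radHom k (comp_mem_radHom k hh _) _,
        comp_mem_radHom k (comp_mem_radHom k hh _) _⟩
    · rintro ⟨h1, h2⟩
      refine ⟨E.symm (f, g), fun h => ?_, E.apply_symm_apply _⟩
      have : h.comp (E.symm (f, g)) =
          (h.comp (e.symm.toLinearMap.comp (LinearMap.inl R M' M''))).comp f +
          (h.comp (e.symm.toLinearMap.comp (LinearMap.inr R M' M''))).comp g := by
        ext x
        simp only [E, LinearEquiv.coe_symm_mk', LinearMap.comp_apply, LinearEquiv.coe_coe,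
          LinearMap.prod_apply, LinearMap.add_apply, LinearMap.inl_apply, LinearMap.inr_apply]
        rw [← map_add, ← map_add]
        simp
      rw [this]
      exact add_mem (h1 _) (h2 _)
  have hr : Module.finrank k (radHom k (R := R) N M) =
      Module.finrank k (radHom k (R := R) N M') + Module.finrank k (radHom k (R := R) N M'') := by
    rw [← Module.finrank_prod, (E.submoduleMap (radHom k (R := R) N M)).finrank_eq]
    refine LinearEquiv.finrank_eq ?_
    exact (LinearEquiv.ofEq _ _ hE).trans 
      { toFun := fun z => (⟨z.1.1, z.2.1⟩, ⟨z.1.2, z.2.2⟩)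
        invFun := fun w => ⟨(w.1.1, w.2.1), w.1.2, w.2.2⟩
        map_add' := fun _ _ => rfl
        map_smul' := fun _ _ => rfl
        left_inv := fun _ => rfl
        right_inv := fun _ => rfl }
  unfold summandMultiplicity
  rw [E.finrank_eq, Module.finrank_prod, hr]
  push_cast
  ring

/-- The identity of `N` is a morphism outside the radical part. -/
theorem summandMultiplicity_self_pos [Module.Finite k N] [Nontrivial N] :
    0 < summandMultiplicity k R N N := by
  have := finite_linearMap k (R := R) N N
  have hne : radHom k (R := R) N N ≠ ⊤ := by
    intro h
    have h1 : (LinearMap.id : N →ₗ[R] N) ∈ radHom k (R := R) N N := h ▸ Submodule.mem_top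
    have h2 := h1 LinearMap.id
    have h3 : (1 : Module.End R N) ∈ Ring.jacobson (Module.End R N) := h2
    exact (Ring.jacobson_lt_top (Module.End R N)).ne ((Ideal.eq_top_iff_one _).2 h3)
  have := Submodule.finrank_lt hne
  unfold summandMultiplicity
  omega

end

/-- If g ∘ f is outside the radical of End(N), some multiple of it is a unit, and this splits `f`.
When `N` is not a summand, the radical part is therefore everything. -/
theorem summandMultiplicity_eq_zero [IsArtinianRing R] {N M : FGModuleCat.{u} R}
    [Module k N] [Module k M] [IsScalarTower k R N] [IsScalarTower k R M]
    (hN : IsIndecomposable (R := R) N) (h : ¬ IsSummand N M) :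
    summandMultiplicity k R N M = 0 := by
  have : radHom k (R := R) N M = ⊤ := by
    rw [eq_top_iff]
    intro f _ g
    by_contra hcon
    obtain ⟨t, ht⟩ := hN.isUnit_of_not_mem_jacobson hcon
    obtain ⟨s, hs⟩ := ht.exists_left_inv
    refine h (IsSummand.of_retraction f ((s * t).comp g) fun x => ?_)
    exact LinearMap.congr_fun hs x
  unfold summandMultiplicity
  rw [this, finrank_top, sub_self]

/-- The `k`-vector space underlying a module over a `k`-algebra. -/
@[reducible] def scalarModule (M : FGModuleCat.{u} R) : Module k M :=
  Module.compHom M (algebraMap k R)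

attribute [local instance] scalarModule

theorem isScalarTower_scalarModule (M : FGModuleCat.{u} R) : IsScalarTower k R M :=
  ⟨fun c r m => by
    change (c • r) • m = algebraMap k R c • r • m
    rw [Algebra.smul_def, mul_smul]⟩

attribute [local instance] isScalarTower_scalarModule

theorem finite_scalarModule [Module.Finite k R] (M : FGModuleCat.{u} R) : Module.Finite k M :=
  Module.Finite.trans R M

attribute [local instance] finite_scalarModule

variable [IsArtinianRing R]

/-- The multiplicity of a non-projective indecomposable module, as a homomorphism on `K₀(R)`. -/
noncomputable def multiplicityHom [Module.Finite k R] (N : FGModuleCat.{u} R)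
    (hN : IsIndecomposable (R := R) N) (hN' : ¬ Module.Projective R N) : K0 R →+ ℤ :=
  K0.lift (fun M => summandMultiplicity k R N M)
    (fun _ _ _ e => summandMultiplicity_eq_add k N e)
    (fun _ hP => summandMultiplicity_eq_zero k hN fun h => hN' (h.projective hP))

/-- `K₀(R)` is torsion-free when `R` is a finite dimensional algebra. -/
theorem K0.eq_zero_of_zsmul_eq_zero [Module.Finite k R] {n : ℤ} (hn : n ≠ 0) {x : K0 R}
    (hx : n • x = 0) : x = 0 := by
  -- The classes of non-projective indecomposables, one for each isomorphism class, span `K0 R`.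
  -- They are also independent, without appeal to Krull–Schmidt: the multiplicity homomorphism of N
  -- is positive at N and zero at all the others.
  let T := {N : FGModuleCat.{u} R // IsIndecomposable (R := R) N ∧ ¬ Module.Projective R N}
  let s : Setoid T :=
    { r := fun N M => Nonempty (N.1 ≃ₗ[R] M.1)
      iseqv := ⟨fun N => ⟨LinearEquiv.refl R _⟩, fun ⟨e⟩ => ⟨e.symm⟩,
        fun ⟨e⟩ ⟨e'⟩ => ⟨e.trans e'⟩⟩ }
  let v : Quotient s → K0 R := fun q => K0.mk q.out.1
  have hspan : x ∈ Submodule.span ℤ (Set.range v) := by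
    have hmk : ∀ M : FGModuleCat.{u} R, K0.mk M ∈ Submodule.span ℤ (Set.range v) := by
      intro M
      have h := isAdditive_mk.mem_closure M
      rw [← Submodule.mem_toAddSubgroup]
      refine (AddSubgroup.closure_le _).2 ?_ h
      rintro _ ⟨N, -, hN, rfl⟩
      by_cases hP : Module.Projective R N
      · rw [K0.mk_projective hP]
        exact zero_mem _
      · let q : Quotient s := Quotient.mk s ⟨N, hN, hP⟩
        obtain ⟨e⟩ := Quotient.mk_out (s := s) ⟨N, hN, hP⟩
        rw [← K0.mk_congr e]
        exact Submodule.subset_span ⟨q, rfl⟩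
    obtain ⟨M, N, rfl⟩ := K0.exists_eq_sub x
    exact sub_mem (hmk M) (hmk N)
  obtain ⟨c, rfl⟩ := Finsupp.mem_span_range_iff_exists_finsupp.1 hspan
  have hc : c = 0 := by
    ext q
    let D := multiplicityHom k q.out.1 q.out.2.1 q.out.2.2
    have hD : ∀ q' : Quotient s, q' ≠ q → D (v q') = 0 := by
      intro q' hq'
      refine (K0.lift_mk _ _ _ _).trans (summandMultiplicity_eq_zero k q.out.2.1 fun h => hq' ?_)
      obtain ⟨e⟩ := q.out.2.1.nonempty_equiv q'.out.2.1 h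
      rw [← Quotient.out_eq q, ← Quotient.out_eq q']
      exact Quotient.sound ⟨e.symm⟩
    have hDq : 0 < D (v q) := by
      have := q.out.2.1.1
      have h : D (v q) = summandMultiplicity k R q.out.1 q.out.1 := K0.lift_mk _ _ _ _
      rw [h]
      exact summandMultiplicity_self_pos k q.out.1
    have h := congrArg D hx
    rw [map_zsmul, Finsupp.sum, map_sum, map_zero, Finset.sum_eq_single q] at h
    · rw [map_zsmul, smul_eq_mul, smul_eq_mul] at h
      rcases mul_eq_zero.1 h with h | h
      · exact absurd h hn
      · rcases mul_eq_zero.1 h with h | h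
        · exact h
        · exact absurd h hDq.ne'
    · intro q' _ hq'
      rw [map_zsmul, hD q' hq', smul_zero]
    · intro hq
      rw [Finsupp.notMem_support_iff.1 hq, zero_smul, map_zero]
  rw [hc, Finsupp.sum_zero_index]

end Multiplicity
-- Linear algebra of stationary kernels
section KerStable

variable {G : Type*} [AddCommGroup G]

/-- The kernels of the powers of `f` are stationary from `d` on. -/
def KerStable (f : G →+ G) (d : ℕ) : Prop :=
  ∀ (n : ℕ) (x : G), f^[n] x = 0 → f^[d] x = 0

theorem leftPhiDim_le_iff_kerStable {R : Type u} [Ring R] [IsArtinianRing R] (d : ℕ) :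
    leftPhiDim R ≤ d ↔ KerStable (syzygyHom R) d :=
  ⟨fun h _ _ hx => iterate_syzygyHom_eq_zero h hx, fun h => (leftPhiDim_le_iff d).2 fun x => h _ x⟩

theorem iterate_map_finset_sum {ι : Type*} (f : G →+ G) (n : ℕ) (s : Finset ι) (g : ι → G) :
    f^[n] (∑ i ∈ s, g i) = ∑ i ∈ s, f^[n] (g i) := by
  induction n with
  | zero => rfl
  | succ n ih => simp_rw [Function.iterate_succ_apply', ih, map_sum]

/-- A substitute for Cayley–Hamilton. With n generators, the n + 1 elements t, ..., f^n t satisfy a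
nontrivial integral relation. Applying the power of `f` that moves its lowest term to f^n t leaves
every other term divisible by f^(n+1). -/
theorem exists_zsmul_iterate_eq {V : Type*} [Fintype V] (f : G →+ G) (g : V → G)
    (hf : ∀ v, f (g v) ∈ AddSubgroup.closure (Set.range g)) {t : G}
    (ht : t ∈ AddSubgroup.closure (Set.range g)) :
    ∃ c : ℤ, c ≠ 0 ∧ ∃ t' ∈ AddSubgroup.closure (Set.range fun i : ℕ => f^[i] t),
      c • f^[Fintype.card V] t = f^[Fintype.card V + 1] t' := by
  set n := Fintype.card V
  have hmem : ∀ i : ℕ, f^[i] t ∈ AddSubgroup.closure (Set.range g) := by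
    intro i
    induction i with
    | zero => exact ht
    | succ i ih =>
      rw [Function.iterate_succ_apply']
      have : AddSubgroup.closure (Set.range g) ≤ (AddSubgroup.closure (Set.range g)).comap f := by
        rw [AddSubgroup.closure_le]
        rintro _ ⟨v, rfl⟩
        exact hf v
      exact this ih
  -- The dependence is found among coefficient vectors in ℤ^V, since the generators themselves need
  -- not be independent.
  have hex : ∀ i : ℕ, ∃ a : V → ℤ, ∑ v, a v • g v = f^[i] t := by
    intro i
    have h := hmem i
    rw [← Submodule.span_int_eq_addSubgroupClosure, Submodule.mem_toAddSubgroup] at h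
    exact (Submodule.mem_span_range_iff_exists_fun ℤ).1 h
  choose a ha using hex
  have hdep : ¬ LinearIndependent ℤ (fun i : Fin (n + 1) => a i) := by
    intro h
    have := h.fintype_card_le_finrank
    simp [n] at this
  rw [Fintype.not_linearIndependent_iff] at hdep
  obtain ⟨c, hc, i₁, hi₁⟩ := hdep
  have hsum : ∑ i : Fin (n + 1), c i • f^[i] t = 0 := by
    simp_rw [← ha, Finset.smul_sum]
    rw [Finset.sum_comm]
    refine Finset.sum_eq_zero fun v _ => ?_
    have := congrFun hc v
    simp only [Finset.sum_apply, Pi.smul_apply, Pi.zero_apply] at this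
    simp_rw [← smul_assoc]
    rw [← Finset.sum_smul, this, zero_smul]
  obtain ⟨i₀, hi₀, hmin⟩ := WellFounded.has_min (wellFounded_lt (α := Fin (n + 1)))
    {i | c i ≠ 0} ⟨i₁, hi₁⟩
  refine ⟨c i₀, hi₀, -∑ i : Fin (n + 1), if i₀ < i then c i • f^[(i : ℕ) - i₀ - 1] t else 0,
    ?_, ?_⟩
  · refine neg_mem (sum_mem fun i _ => ?_)
    split_ifs
    · exact zsmul_mem (AddSubgroup.subset_closure (Set.mem_range_self _)) _
    · exact zero_mem _
  · have h := congrArg (f^[n - i₀]) hsum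
    rw [iterate_map_zero, iterate_map_finset_sum, ← Finset.add_sum_erase _ _
      (Finset.mem_univ i₀), add_eq_zero_iff_eq_neg] at h
    have hle : (i₀ : ℕ) ≤ n := Nat.lt_succ_iff.1 i₀.2
    rw [iterate_map_zsmul, ← Function.iterate_add_apply,
      Nat.sub_add_cancel hle] at h
    rw [h, iterate_map_neg]
    congr 1
    rw [iterate_map_finset_sum, ← Finset.add_sum_erase _ _
      (Finset.mem_univ i₀), if_neg (lt_irrefl _), iterate_map_zero, zero_add]
    refine Finset.sum_congr rfl fun i hi => ?_
    split_ifs with hlt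
    · rw [iterate_map_zsmul, iterate_map_zsmul, ← Function.iterate_add_apply,
        ← Function.iterate_add_apply]
      have hlt' : (i₀ : ℕ) < i := hlt
      have : n - i₀ + i = n + 1 + (i - i₀ - 1) := by omega
      rw [this]
    · have hlt' : i < i₀ := lt_of_le_of_ne (not_lt.1 hlt) (Finset.ne_of_mem_erase hi)
      have : c i = 0 := by
        by_contra h0
        exact hmin i h0 hlt'
      rw [this, zero_smul, iterate_map_zero, iterate_map_zero]

/-- If f^(N+1) t = 0 with N at least the number of generators, then c f^N t equals f^(N+1) of a
combination of iterates of `t`, which is zero. Torsion-freeness removes `c`, and the exponent drops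
by one. -/
theorem iterate_card_eq_zero {V : Type*} [Fintype V] (f : G →+ G) (g : V → G)
    (hG : ∀ (c : ℤ) (x : G), c ≠ 0 → c • x = 0 → x = 0)
    (hf : ∀ v, f (g v) ∈ AddSubgroup.closure (Set.range g)) {t : G}
    (ht : t ∈ AddSubgroup.closure (Set.range g)) {N : ℕ} (hN : f^[N] t = 0) :
    f^[Fintype.card V] t = 0 := by
  obtain ⟨c, hc, t', ht', h⟩ := exists_zsmul_iterate_eq f g hf ht
  rcases le_total N (Fintype.card V) with hle | hle
  · obtain ⟨j, hj⟩ := Nat.exists_eq_add_of_le' hle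
    rw [hj, Function.iterate_add_apply, hN, iterate_map_zero]
  · induction N, hle using Nat.le_induction with
    | base => exact hN
    | succ N hle ih =>
      refine ih (hG c _ hc ?_)
      obtain ⟨j, rfl⟩ := Nat.exists_eq_add_of_le' hle
      have h0 : ∀ y ∈ AddSubgroup.closure (Set.range fun i : ℕ => f^[i] t),
          f^[j + Fintype.card V + 1] y = 0 := by
        intro y hy
        induction hy using AddSubgroup.closure_induction with
        | mem y hy =>
          obtain ⟨i, rfl⟩ := hy
          simp only
          rw [← Function.iterate_add_apply, add_comm, Function.iterate_add_apply, hN,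
            iterate_map_zero]
        | zero => exact iterate_map_zero _ _
        | add y z _ _ hy hz => rw [iterate_map_add, hy, hz, add_zero]
        | neg y _ hy => rw [iterate_map_neg, hy, neg_zero]
      rw [Function.iterate_add_apply, ← iterate_map_zsmul, h, ← Function.iterate_add_apply,
        ← add_assoc]
      exact h0 t' ht'

/-- Iteration of `exists_zsmul_iterate_eq`: up to a nonzero multiple, the iterate f^|V| t is
divisible by arbitrarily high powers of `f` inside the subgroup. This supplies the correction term
in `KerStable.of_surjOn`. -/
theorem exists_zsmul_iterate_eq_add {V : Type*} [Fintype V] (f : G →+ G) (g : V → G)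
    (hf : ∀ v, f (g v) ∈ AddSubgroup.closure (Set.range g)) (j : ℕ) {t : G}
    (ht : t ∈ AddSubgroup.closure (Set.range g)) :
    ∃ c : ℤ, c ≠ 0 ∧ ∃ t' ∈ AddSubgroup.closure (Set.range g),
      c • f^[Fintype.card V] t = f^[j + Fintype.card V] t' := by
  induction j generalizing t with
  | zero => exact ⟨1, one_ne_zero, t, ht, by rw [one_smul, zero_add]⟩
  | succ j ih =>
    obtain ⟨c, hc, t', ht', h⟩ := exists_zsmul_iterate_eq f g hf ht
    have hle : AddSubgroup.closure (Set.range g) ≤ (AddSubgroup.closure (Set.range g)).comap f := by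
      rw [AddSubgroup.closure_le]
      rintro _ ⟨v, rfl⟩
      exact hf v
    have hmem : t' ∈ AddSubgroup.closure (Set.range g) := by
      refine (AddSubgroup.closure_le _).2 ?_ ht'
      rintro _ ⟨i, rfl⟩
      simp only [SetLike.mem_coe]
      induction i with
      | zero => exact ht
      | succ i ih =>
        rw [Function.iterate_succ_apply']
        exact hle ih
    obtain ⟨c', hc', s, hs, h'⟩ := ih hmem
    refine ⟨c' * c, mul_ne_zero hc' hc, s, hs, ?_⟩
    rw [mul_smul, h, Function.iterate_succ_apply', ← map_zsmul, h', add_right_comm,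
      Function.iterate_succ_apply']

variable {G' : Type*} [AddCommGroup G']

theorem iterate_apply_eq_of_comm (f : G →+ G) (f' : G' →+ G') (r : G →+ G') (L : AddSubgroup G)
    (hL : ∀ x, f x ∈ L) (hr : ∀ x ∈ L, r (f x) = f' (r x)) {x : G} (hx : x ∈ L) (n : ℕ) :
    f^[n] x ∈ L ∧ r (f^[n] x) = f'^[n] (r x) := by
  induction n with
  | zero => exact ⟨hx, rfl⟩
  | succ n ih =>
    rw [Function.iterate_succ_apply', Function.iterate_succ_apply', hr _ ih.1, ih.2]
    exact ⟨hL _, rfl⟩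

/-- If `f` maps into `L`, `r` intertwines `f` and `f'` on `L` and the kernel of `r` on `L` has
`n` generators, then kernels of powers of `f` are stationary from `d + n + 1` on whenever those of
`f'` are so from `d` on. -/
theorem KerStable.of_ker_fg {V : Type*} [Fintype V] (f : G →+ G) (f' : G' →+ G') (r : G →+ G')
    (L : AddSubgroup G) (hL : ∀ x, f x ∈ L) (hr : ∀ x ∈ L, r (f x) = f' (r x))
    (hG : ∀ (c : ℤ) (x : G), c ≠ 0 → c • x = 0 → x = 0) (g : V → G)
    (hg : ∀ v, g v ∈ L ∧ r (g v) = 0)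
    (hker : ∀ x ∈ L, r x = 0 → x ∈ AddSubgroup.closure (Set.range g)) {d : ℕ}
    (h : KerStable f' d) : KerStable f (d + Fintype.card V + 1) := by
  intro n x hx
  have hf : ∀ v, f (g v) ∈ AddSubgroup.closure (Set.range g) := fun v =>
    hker _ (hL _) (by rw [hr _ (hg v).1, (hg v).2, map_zero])
  have h1 := iterate_apply_eq_of_comm f f' r L hL hr (hL x)
  have hn : f^[n] (f x) = 0 := by
    rw [← Function.iterate_succ_apply, Function.iterate_succ_apply', hx, map_zero]
  have h2 : f'^[d] (r (f x)) = 0 := h n _ (by rw [← (h1 n).2, hn, map_zero])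
  -- One step has moved `x` into `L`, the next `d` steps move it into the kernel of `r`, and there
  -- |V| steps suffice.
  have h3 := hker _ (h1 d).1 ((h1 d).2.trans h2)
  have h4 : f^[n] (f^[d] (f x)) = 0 := by
    rw [← Function.iterate_add_apply, add_comm, Function.iterate_add_apply, hn, iterate_map_zero]
  have h5 := iterate_card_eq_zero f g hG hf h3 h4
  rw [add_comm d, Function.iterate_succ_apply, Function.iterate_add_apply]
  exact h5

/-- A lift x of y need not be killed by a power of `f`: the hypothesis on y only puts f^n x in the
kernel of `r`. Some multiple c x can be corrected by an element s of that kernel so that f^(n+|V|)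
kills c x - s. Then f^d kills it too, and applying `r` gives c f'^d y = 0. -/
theorem KerStable.of_surjOn {V : Type*} [Fintype V] (f : G →+ G) (f' : G' →+ G') (r : G →+ G')
    (L : AddSubgroup G) (hL : ∀ x, f x ∈ L) (hr : ∀ x ∈ L, r (f x) = f' (r x))
    (hG' : ∀ (c : ℤ) (x : G'), c ≠ 0 → c • x = 0 → x = 0) (g : V → G)
    (hg : ∀ v, g v ∈ L ∧ r (g v) = 0)
    (hker : ∀ x ∈ L, r x = 0 → x ∈ AddSubgroup.closure (Set.range g))
    (hsurj : ∀ y, ∃ x ∈ L, r x = y) {d : ℕ} (h : KerStable f d) : KerStable f' d := by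
  intro n y hy
  obtain ⟨x, hx, rfl⟩ := hsurj y
  have hf : ∀ v, f (g v) ∈ AddSubgroup.closure (Set.range g) := fun v =>
    hker _ (hL _) (by rw [hr _ (hg v).1, (hg v).2, map_zero])
  have hcl : AddSubgroup.closure (Set.range g) ≤ L ⊓ r.ker := by
    rw [AddSubgroup.closure_le]
    rintro _ ⟨v, rfl⟩
    exact hg v
  have h1 := @iterate_apply_eq_of_comm _ _ _ _ f f' r L hL hr
  have ht := hker _ (h1 hx n).1 ((h1 hx n).2.trans hy)
  obtain ⟨c, hc, s, hs, hcs⟩ := exists_zsmul_iterate_eq_add f g hf n ht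
  have h2 : f^[n + Fintype.card V] (c • x - s) = 0 := by
    rw [iterate_map_sub, iterate_map_zsmul, ← hcs, ← Function.iterate_add_apply, add_comm,
      sub_self]
  have h3 := h _ _ h2
  have h4 := (h1 (L.sub_mem (L.zsmul_mem hx c) (hcl hs).1) d).2
  rw [h3, map_zero, map_sub, map_zsmul, (hcl hs).2, sub_zero, iterate_map_zsmul] at h4
  exact hG' c _ hc h4.symm

/-- If `j` is a section of `r` with `f j = j f'`, and `f - j f' r` takes values in a subgroup with
`n` generators, then kernels of powers of `f` are stationary from `d + n + 1` on whenever those of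
`f'` are so from `d` on. -/
theorem KerStable.of_section {V : Type*} [Fintype V] (f : G →+ G) (f' : G' →+ G') (r : G →+ G')
    (j : G' →+ G) (hj : ∀ y, f (j y) = j (f' y)) (hrj : ∀ y, r (j y) = y)
    (hG : ∀ (c : ℤ) (x : G), c ≠ 0 → c • x = 0 → x = 0) (g : V → G)
    (hg : ∀ x, f x - j (f' (r x)) ∈ AddSubgroup.closure (Set.range g)) {d : ℕ}
    (h : KerStable f' d) : KerStable f (d + Fintype.card V + 1) := by
  -- Projection along the image of `j`, which is stable under `f`. Hence e f e = e f, so the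
  -- iterates of e f compute e f^n, while e f takes values in a group with |V| generators.
  let e : G →+ G := AddMonoidHom.id G - j.comp r
  have he : ∀ x, e x = x - j (r x) := fun _ => rfl
  have hej : ∀ y, e (j y) = 0 := fun y => by rw [he, hrj, sub_self]
  have hef : ∀ x, e (f (e x)) = e (f x) := fun x => by
    rw [he x, map_sub, map_sub, hj, hej, sub_zero]
  have hit : ∀ (n : ℕ) (x : G), (e.comp f)^[n] (e x) = e (f^[n] x) := by
    intro n x
    induction n with
    | zero => rfl
    | succ n ih =>
      rw [Function.iterate_succ_apply', ih, Function.iterate_succ_apply', AddMonoidHom.comp_apply,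
        hef]
  have hmem : ∀ x, e (f x) ∈ AddSubgroup.closure (Set.range fun v => e (g v)) := by
    intro x
    have : AddSubgroup.closure (Set.range g) ≤
        (AddSubgroup.closure (Set.range fun v => e (g v))).comap e := by
      rw [AddSubgroup.closure_le]
      rintro _ ⟨v, rfl⟩
      exact AddSubgroup.subset_closure ⟨v, rfl⟩
    have h2 : e (f x - j (f' (r x))) ∈ AddSubgroup.closure (Set.range fun v => e (g v)) :=
      this (hg x)
    rwa [map_sub, hej, sub_zero] at h2
  intro n x hx
  have h1 : (e.comp f)^[n] (e (f x)) = 0 := by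
    rw [hit, ← Function.iterate_succ_apply, Function.iterate_succ_apply', hx, map_zero, map_zero]
  have h2 := iterate_card_eq_zero (e.comp f) (fun v => e (g v)) hG (fun v => hmem _) (hmem x) h1
  -- Thus f^(|V|+1) x lies in the image of `j`, where `f` acts as `f'`.
  rw [hit, he, sub_eq_zero] at h2
  have hjn : ∀ (m : ℕ) y, f^[m] (j y) = j (f'^[m] y) := by
    intro m y
    induction m with
    | zero => rfl
    | succ m ih => rw [Function.iterate_succ_apply', ih, hj, Function.iterate_succ_apply']
  rw [add_assoc, Function.iterate_add_apply, Function.iterate_succ_apply, h2, hjn]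
  rw [h n, map_zero]
  have h3 : f^[n] (f^[Fintype.card V] (f x)) = 0 := by
    rw [← Function.iterate_succ_apply, ← Function.iterate_add_apply, add_comm,
      Function.iterate_add_apply, hx, iterate_map_zero]
  rw [h2, hjn] at h3
  have := congrArg r h3
  rwa [hrj, map_zero] at this

theorem KerStable.of_injective (f : G →+ G) (f' : G' →+ G') (j : G' →+ G)
    (hj : ∀ y, f (j y) = j (f' y)) (hinj : ∀ y, j y = 0 → y = 0) {d : ℕ}
    (h : KerStable f d) : KerStable f' d := by
  have hjn : ∀ (m : ℕ) y, f^[m] (j y) = j (f'^[m] y) := by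
    intro m y
    induction m with
    | zero => rfl
    | succ m ih => rw [Function.iterate_succ_apply', ih, hj, Function.iterate_succ_apply']
  intro n y hy
  refine hinj _ ?_
  rw [← hjn]
  exact h n _ (by rw [hjn, hy, map_zero])

end KerStable
-- Reduction and inflation along a ring surjection
section Semilinear

variable {S R : Type u} [Ring S] [Ring R] {p : S →+* R}

/-- A surjective semilinear map with kernel `(ker p) M`: it presents its target as the reduction
of `M` along `p`. -/
structure IsReduction {M N : Type u} [AddCommGroup M] [Module S M] [AddCommGroup N] [Module R N]
    (q : M →ₛₗ[p] N) : Prop where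
  surjective : Function.Surjective q
  mem_of_apply_eq_zero : ∀ m, q m = 0 → m ∈ RingHom.ker p • (⊤ : Submodule S M)

section

variable {M N X : Type u} [AddCommGroup M] [Module S M] [AddCommGroup N] [Module R N]
  [AddCommGroup X] [Module R X]

theorem apply_eq_zero_of_mem_ker_smul (f : M →ₛₗ[p] X) {m : M}
    (hm : m ∈ RingHom.ker p • (⊤ : Submodule S M)) : f m = 0 := by
  induction hm using Submodule.smul_induction_on' with
  | smul r hr n _ => rw [map_smulₛₗ, (RingHom.mem_ker).1 hr, zero_smul]
  | add x _ y _ hx hy => rw [map_add, hx, hy, add_zero]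

theorem exists_linearMap_comp_eq (hp : Function.Surjective p) (q : M →ₛₗ[p] N)
    (hq : Function.Surjective q) (f : M →ₛₗ[p] X) (h : ∀ m, q m = 0 → f m = 0) :
    ∃ g : N →ₗ[R] X, ∀ m, g (q m) = f m := by
  have key : ∀ m, f (Function.surjInv hq (q m)) = f m := fun m => by
    rw [← sub_eq_zero, ← map_sub]
    exact h _ (by rw [map_sub, Function.surjInv_eq hq, sub_self])
  refine ⟨{ toFun := fun n => f (Function.surjInv hq n), map_add' := ?_, map_smul' := ?_ }, key⟩
  · intro a b
    obtain ⟨a, rfl⟩ := hq a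
    obtain ⟨b, rfl⟩ := hq b
    rw [← map_add, key, key, key, map_add]
  · intro r a
    obtain ⟨a, rfl⟩ := hq a
    obtain ⟨r, rfl⟩ := hp r
    rw [← map_smulₛₗ, key, key, map_smulₛₗ, RingHom.id_apply]

theorem IsReduction.exists_lift (hp : Function.Surjective p) {q : M →ₛₗ[p] N} (hq : IsReduction q)
    (f : M →ₛₗ[p] X) : ∃ g : N →ₗ[R] X, ∀ m, g (q m) = f m :=
  exists_linearMap_comp_eq hp q hq.surjective f fun _ hm =>
    apply_eq_zero_of_mem_ker_smul f (hq.mem_of_apply_eq_zero _ hm)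

theorem IsReduction.nonempty_equiv (hp : Function.Surjective p) {q : M →ₛₗ[p] N}
    (hq : IsReduction q) {q' : M →ₛₗ[p] X} (hq' : IsReduction q') : Nonempty (N ≃ₗ[R] X) := by
  obtain ⟨g, hg⟩ := hq.exists_lift hp q'
  obtain ⟨g', hg'⟩ := hq'.exists_lift hp q
  refine ⟨LinearEquiv.ofLinearMap g g' (LinearMap.ext fun x => ?_) (LinearMap.ext fun x => ?_)⟩
  · obtain ⟨m, rfl⟩ := hq'.surjective x
    simp [hg, hg']
  · obtain ⟨m, rfl⟩ := hq.surjective x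
    simp [hg, hg']

/-- Restriction of scalars along `p` turns this into an ordinary lifting problem over `S`.
Surjectivity of `p` is not needed, which allows the use with an inclusion of rings. -/
theorem exists_semilinear_lift {P : Type u} [AddCommGroup P] [Module S P] [Module.Projective S P]
    (f : X →ₗ[R] N) (hf : Function.Surjective f) (g : P →ₛₗ[p] N) :
    ∃ h : P →ₛₗ[p] X, ∀ x, f (h x) = g x := by
  let : Module S X := Module.compHom X p
  let : Module S N := Module.compHom N p
  let f' : X →ₗ[S] N := { f with map_smul' := fun s x => f.map_smul (p s) x }
  let g' : P →ₗ[S] N := { g with map_smul' := fun s x => g.map_smulₛₗ s x }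
  obtain ⟨h, hh⟩ := Module.projective_lifting_property f' g' hf
  exact ⟨{ h with map_smul' := fun s x => h.map_smul s x }, fun x => LinearMap.congr_fun hh x⟩

/-- A surjection onto `N` is split by lifting `q` semilinearly from the projective module `M` and
factoring the lift through the reduction. -/
theorem IsReduction.projective (hp : Function.Surjective p) {q : M →ₛₗ[p] N} (hq : IsReduction q)
    (hM : Module.Projective S M) : Module.Projective R N := by
  refine Module.Projective.of_lifting_property'' fun f hf => ?_
  obtain ⟨h, hh⟩ := exists_semilinear_lift f hf q
  obtain ⟨g, hg⟩ := hq.exists_lift hp h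
  refine ⟨g, LinearMap.ext fun x => ?_⟩
  obtain ⟨m, rfl⟩ := hq.surjective x
  simp [hg, hh]

theorem isReduction_of_bijective {q : M →ₛₗ[p] N} (hq : Function.Bijective q) : IsReduction q :=
  ⟨hq.2, fun m hm => by
    rw [hq.1 (hm.trans (map_zero q).symm)]
    exact zero_mem _⟩

theorem map_mem_ker_smul {M M' : Type u} [AddCommGroup M] [Module S M] [AddCommGroup M']
    [Module S M'] (f : M →ₗ[S] M') {m : M} (hm : m ∈ RingHom.ker p • (⊤ : Submodule S M)) :
    f m ∈ RingHom.ker p • (⊤ : Submodule S M') := by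
  induction hm using Submodule.smul_induction_on' with
  | smul r hr n _ =>
    rw [map_smul]
    exact Submodule.smul_mem_smul hr Submodule.mem_top
  | add x _ y _ hx hy =>
    rw [map_add]
    exact add_mem hx hy

theorem IsReduction.prod {M' N' L : Type u} [AddCommGroup M'] [Module S M'] [AddCommGroup N']
    [Module R N'] [AddCommGroup L] [Module S L] {q : M →ₛₗ[p] N} {q' : M' →ₛₗ[p] N'}
    (hq : IsReduction q) (hq' : IsReduction q') (e : L ≃ₗ[S] (M × M')) :
    ∃ q'' : L →ₛₗ[p] (N × N'), IsReduction q'' := by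
  refine ⟨{ toFun := fun x => (q (e x).1, q' (e x).2)
            map_add' := fun x y => by simp
            map_smul' := fun s x => by simp }, ?_, ?_⟩
  · rintro ⟨a, b⟩
    obtain ⟨a, rfl⟩ := hq.surjective a
    obtain ⟨b, rfl⟩ := hq'.surjective b
    exact ⟨e.symm (a, b), by simp⟩
  · intro m hm
    obtain ⟨h1, h2⟩ := Prod.mk.inj hm
    have h3 := map_mem_ker_smul (p := p) (e.symm.toLinearMap.comp (LinearMap.inl S M M'))
      (hq.mem_of_apply_eq_zero _ h1)
    have h4 := map_mem_ker_smul (p := p) (e.symm.toLinearMap.comp (LinearMap.inr S M M'))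
      (hq'.mem_of_apply_eq_zero _ h2)
    have := add_mem h3 h4
    simp only [LinearMap.comp_apply, LinearMap.inl_apply, LinearMap.inr_apply, ← map_add,
      Prod.mk_add_mk, add_zero, zero_add, Prod.mk.eta, LinearEquiv.coe_coe,
      LinearEquiv.symm_apply_apply] at this
    exact this

theorem nonempty_equiv_of_bijective {M M' : Type u} [AddCommGroup M] [Module S M]
    [AddCommGroup M'] [Module S M'] {q : M →ₛₗ[p] N} {q' : M' →ₛₗ[p] X}
    (hq : Function.Bijective q) (hq' : Function.Bijective q') (e : N ≃ₗ[R] X) :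
    Nonempty (M ≃ₗ[S] M') := by
  let a := Equiv.ofBijective q hq
  let b := Equiv.ofBijective q' hq'
  have hb : ∀ x, q' (b.symm x) = x := fun x => b.apply_symm_apply x
  refine ⟨{ (a.trans e.toEquiv).trans b.symm with map_add' := ?_, map_smul' := ?_ }⟩
  · intro x y
    apply hq'.1
    change q' (b.symm (e (q (x + y)))) = q' (b.symm (e (q x)) + b.symm (e (q y)))
    simp [hb]
  · intro s x
    apply hq'.1
    change q' (b.symm (e (q (s • x)))) = q' (s • b.symm (e (q x)))
    simp [hb]

end

/-- The inflation of an `R`-module along `p : S → R`. -/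
noncomputable def inflation (hp : Function.Surjective p) (N : FGModuleCat.{u} R) :
    FGModuleCat.{u} S :=
  letI : Module S N := Module.compHom N p
  haveI : Module.Finite S N := by
    have : RingHomSurjective p := ⟨hp⟩
    let q : N →ₛₗ[p] N :=
      { toFun := fun x => x, map_add' := fun _ _ => rfl, map_smul' := fun _ _ => rfl }
    exact (q.finite_iff_of_bijective Function.bijective_id).2 inferInstance
  FGModuleCat.of S N

/-- The identity, as a semilinear bijection from the inflation of `N` to `N`. -/
noncomputable def inflationMap (hp : Function.Surjective p) (N : FGModuleCat.{u} R) :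
    inflation hp N →ₛₗ[p] N where
  toFun x := x
  map_add' _ _ := rfl
  map_smul' _ _ := rfl

theorem inflationMap_bijective (hp : Function.Surjective p) (N : FGModuleCat.{u} R) :
    Function.Bijective (inflationMap hp N) := Function.bijective_id

theorem exists_isReduction (hp : Function.Surjective p) (M : FGModuleCat.{u} S) :
    ∃ (N : FGModuleCat.{u} R) (q : M →ₛₗ[p] N), IsReduction q := by
  let I : Submodule S M := RingHom.ker p • ⊤
  -- The action through arbitrary lifts of scalars is legitimate because ker p annihilates the
  -- quotient.
  let : SMul R (M ⧸ I) := ⟨fun r x => Function.surjInv hp r • x⟩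
  have h : ∀ (s : S) (x : M ⧸ I), p s • x = s • x := by
    intro s x
    obtain ⟨x, rfl⟩ := Submodule.Quotient.mk_surjective _ x
    change Function.surjInv hp (p s) • (Submodule.Quotient.mk x : M ⧸ I) = _
    rw [← sub_eq_zero, ← sub_smul, ← Submodule.Quotient.mk_smul, Submodule.Quotient.mk_eq_zero]
    refine Submodule.smul_mem_smul ?_ Submodule.mem_top
    rw [RingHom.mem_ker, map_sub, Function.surjInv_eq hp, sub_self]
  let : Module R (M ⧸ I) := Function.Surjective.moduleLeft p hp h
  let q : M →ₛₗ[p] (M ⧸ I) :=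
    { toFun := fun x => I.mkQ x
      map_add' := fun x y => map_add _ _ _
      map_smul' := fun s x => by rw [map_smul, h] }
  have hq : Function.Surjective q := Submodule.mkQ_surjective _
  have : RingHomSurjective p := ⟨hp⟩
  have : Module.Finite R (M ⧸ I) := Module.Finite.of_surjective q hq
  exact ⟨FGModuleCat.of R (M ⧸ I), q, hq, fun m hm => (Submodule.Quotient.mk_eq_zero _).1 hm⟩

/-- The reduction of an `S`-module along `p : S → R`. -/
noncomputable def reduction (hp : Function.Surjective p) (M : FGModuleCat.{u} S) :
    FGModuleCat.{u} R :=
  (exists_isReduction hp M).choose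

/-- The projection to the reduction. -/
noncomputable def reductionMap (hp : Function.Surjective p) (M : FGModuleCat.{u} S) :
    M →ₛₗ[p] reduction hp M :=
  (exists_isReduction hp M).choose_spec.choose

theorem isReduction_reductionMap (hp : Function.Surjective p) (M : FGModuleCat.{u} S) :
    IsReduction (reductionMap hp M) :=
  (exists_isReduction hp M).choose_spec.choose_spec

/-- The homomorphism `K₀(S) → K₀(R)` induced by reduction along `p : S → R`. -/
noncomputable def reductionHom (hp : Function.Surjective p) : K0 S →+ K0 R :=
  K0.lift (fun M => K0.mk (reduction hp M))
    (fun M M' M'' e => by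
      obtain ⟨q, hq⟩ := (isReduction_reductionMap hp M').prod (isReduction_reductionMap hp M'') e
      obtain ⟨e'⟩ := (isReduction_reductionMap hp M).nonempty_equiv hp hq
      exact K0.mk_eq_add e')
    (fun P hP => K0.mk_projective ((isReduction_reductionMap hp P).projective hp hP))

theorem reductionHom_mk (hp : Function.Surjective p) {M : FGModuleCat.{u} S}
    {N : FGModuleCat.{u} R} {q : M →ₛₗ[p] N} (hq : IsReduction q) :
    reductionHom hp (K0.mk M) = K0.mk N := by
  obtain ⟨e⟩ := (isReduction_reductionMap hp M).nonempty_equiv hp hq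
  exact (K0.lift_mk _ _ _ _).trans (K0.mk_congr e)

theorem reductionHom_inflation (hp : Function.Surjective p) (N : FGModuleCat.{u} R) :
    reductionHom hp (K0.mk (inflation hp N)) = K0.mk N :=
  reductionHom_mk hp (isReduction_of_bijective (inflationMap_bijective hp N))

/-- Only additivity is available for a general `p`: inflation need not preserve projectives, so it
need not descend to `K0 R`. -/
theorem isAdditive_inflation (hp : Function.Surjective p) :
    IsAdditive fun N : FGModuleCat.{u} R => K0.mk (inflation hp N) := by
  intro M M' M'' e
  let q : (inflation hp M' × inflation hp M'') →ₛₗ[p] (M' × M'') :=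
    { toFun := fun x => (inflationMap hp M' x.1, inflationMap hp M'' x.2)
      map_add' := fun x y => by simp
      map_smul' := fun s x => by simp }
  have hq : Function.Bijective q :=
    (inflationMap_bijective hp M').prodMap (inflationMap_bijective hp M'')
  obtain ⟨e'⟩ := nonempty_equiv_of_bijective (inflationMap_bijective hp M) hq e
  exact K0.mk_eq_add e'

end Semilinear

/-! ### Products of rings -/

section Splitting

theorem le_of_forall_natCast_le {a b : ℕ∞} (h : ∀ d : ℕ, b ≤ d → a ≤ d) : a ≤ b := by
  induction b using ENat.recTopCoe with
  | top => exact le_top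
  | coe d => exact h d le_rfl

variable {S R : Type u} [Ring S] [Ring R] {p : S →+* R}

/-- The kernel of `p` is annihilated by `ε`, and `p ε = 1`: then `ε` is a central idempotent and
`p` identifies `R` with `ε S`. -/
structure IsSplitBy (p : S →+* R) (ε : S) : Prop where
  map_eq_one : p ε = 1
  mul_eq_zero : ∀ s, p s = 0 → ε * s = 0
  eq_zero_mul : ∀ s, p s = 0 → s * ε = 0

section

variable {M N : Type u} [AddCommGroup M] [Module S M] [AddCommGroup N] [Module R N] {ε : S}

theorem IsSplitBy.smul_eq_zero (h : IsSplitBy p ε) {m : M}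
    (hm : m ∈ RingHom.ker p • (⊤ : Submodule S M)) : ε • m = 0 := by
  induction hm using Submodule.smul_induction_on' with
  | smul r hr n _ => rw [← mul_smul, h.mul_eq_zero _ hr, zero_smul]
  | add x _ y _ hx hy => rw [smul_add, hx, hy, add_zero]

theorem IsSplitBy.apply_smul (h : IsSplitBy p ε) (q : M →ₛₗ[p] N) (m : M) :
    q (ε • m) = q m := by rw [map_smulₛₗ, h.map_eq_one, one_smul]

theorem IsSplitBy.apply_eq_zero_iff (h : IsSplitBy p ε) {q : M →ₛₗ[p] N}
    (hq : IsReduction q) (m : M) : q m = 0 ↔ ε • m = 0 :=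
  ⟨fun hm => h.smul_eq_zero (hq.mem_of_apply_eq_zero m hm), fun hm => by
    rw [← h.apply_smul, hm, map_zero]⟩

theorem IsSplitBy.isReduction (h : IsSplitBy p ε) {q : M →ₛₗ[p] N}
    (hq : Function.Surjective q) (hker : ∀ m, q m = 0 → ε • m = 0) : IsReduction q :=
  ⟨hq, fun m hm => by
    have : m = (1 - ε) • m := by rw [sub_smul, hker m hm, one_smul, sub_zero]
    rw [this]
    exact Submodule.smul_mem_smul
      (by rw [RingHom.mem_ker, map_sub, map_one, h.map_eq_one, sub_self]) Submodule.mem_top⟩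

/-- As a left `S`-module, `R` is the summand S ε of `S`: sending r to (any lift of r) ε is well
defined because (ker p) ε = 0. Applying this map to the coordinates of a splitting of `N` off a free
`R`-module splits `M` off a free `S`-module. -/
theorem IsSplitBy.projective_of_bijective (h : IsSplitBy p ε)
    (hp : Function.Surjective p) {q : M →ₛₗ[p] N} (hq : Function.Bijective q)
    (hN : Module.Projective R N) : Module.Projective S M := by
  obtain ⟨i, hi⟩ := Module.projective_def'.1 hN
  have ht : ∀ s, Function.surjInv hp (p s) * ε = s * ε := fun s => by
    rw [← sub_eq_zero, ← sub_mul]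
    exact h.eq_zero_mul _ (by rw [map_sub, Function.surjInv_eq hp, sub_self])
  let t : R →+ S :=
    { toFun := fun r => Function.surjInv hp r * ε
      map_zero' := by rw [← map_zero p, ht, zero_mul]
      map_add' := fun a b => by
        obtain ⟨a, rfl⟩ := hp a
        obtain ⟨b, rfl⟩ := hp b
        rw [← map_add, ht, ht, ht, add_mul] }
  have htm : ∀ s r, t (p s * r) = s * t r := fun s r => by
    obtain ⟨r, rfl⟩ := hp r
    change Function.surjInv hp (p s * p r) * ε = s * (Function.surjInv hp (p r) * ε)
    rw [← map_mul, ht, ht, mul_assoc]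
  have hpt : ∀ r, p (t r) = r := fun r => by
    change p (Function.surjInv hp r * ε) = r
    rw [map_mul, Function.surjInv_eq hp, h.map_eq_one, mul_one]
  have hqs : ∀ n, q (Function.surjInv hq.surjective n) = n := Function.surjInv_eq hq.surjective
  let j : M →ₗ[S] (N →₀ S) :=
    { toFun := fun m => (i (q m)).mapRange t t.map_zero
      map_add' := fun a b => by ext n; simp
      map_smul' := fun s a => by ext n; simp [htm] }
  refine Module.Projective.of_split j
    (Finsupp.linearCombination S (Function.surjInv hq.surjective)) (LinearMap.ext fun m => hq.1 ?_)
  have hm := LinearMap.congr_fun hi (q m)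
  rw [LinearMap.comp_apply, LinearMap.id_apply, Finsupp.linearCombination_apply] at hm
  rw [LinearMap.comp_apply, LinearMap.id_apply, Finsupp.linearCombination_apply]
  have h2 : ((i (q m)).mapRange t t.map_zero).sum
      (fun n a => a • Function.surjInv hq.surjective n) =
      (i (q m)).sum fun n r => t r • Function.surjInv hq.surjective n :=
    Finsupp.sum_mapRange_index fun _ => zero_smul _ _
  refine (congrArg q h2).trans (Eq.trans ?_ hm)
  rw [Finsupp.sum, map_sum]
  refine Finset.sum_congr rfl fun n _ => ?_
  rw [map_smulₛₗ, hpt, hqs]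
  rfl

end

/-- The homomorphism `K₀(R) → K₀(S)` induced by inflation along a projection `p`. -/
noncomputable def IsSplitBy.inflationHom {ε : S} (h : IsSplitBy p ε)
    (hp : Function.Surjective p) : K0 R →+ K0 S :=
  K0.lift (fun N => K0.mk (inflation hp N)) (isAdditive_inflation hp)
    (fun _ hP => K0.mk_projective (h.projective_of_bijective hp (inflationMap_bijective hp _) hP))

theorem IsSplitBy.inflationHom_mk {ε : S} (h : IsSplitBy p ε) (hp : Function.Surjective p)
    (N : FGModuleCat.{u} R) : h.inflationHom hp (K0.mk N) = K0.mk (inflation hp N) :=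
  K0.lift_mk _ _ _ _

theorem IsSplitBy.reductionHom_inflationHom {ε : S} (h : IsSplitBy p ε)
    (hp : Function.Surjective p) (y : K0 R) : reductionHom hp (h.inflationHom hp y) = y := by
  revert y
  refine DFunLike.congr_fun (f := (reductionHom hp).comp (h.inflationHom hp))
    (g := AddMonoidHom.id _) (K0.hom_ext fun N => ?_)
  rw [AddMonoidHom.comp_apply, h.inflationHom_mk, reductionHom_inflation, AddMonoidHom.id_apply]

variable [IsArtinianRing S] [IsArtinianRing R]

/-- Reduction amounts to M ↦ ε M, which is exact, so it carries a projective presentation over `S`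
together with its kernel to one over `R`. -/
theorem IsSplitBy.reductionHom_syzygyHom {ε : S} (h : IsSplitBy p ε)
    (hp : Function.Surjective p) (x : K0 S) :
    reductionHom hp (syzygyHom S x) = syzygyHom R (reductionHom hp x) := by
  revert x
  refine DFunLike.congr_fun (f := (reductionHom hp).comp (syzygyHom S))
    (g := (syzygyHom R).comp (reductionHom hp)) (K0.hom_ext fun M => ?_)
  rw [AddMonoidHom.comp_apply, AddMonoidHom.comp_apply, syzygyHom_mk,
    reductionHom_mk hp (isReduction_reductionMap hp M), syzygyHom_mk]
  let f := projectiveCoverMap M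
  have hf : Function.Surjective f := (isProjectiveCover_map M).surjective
  have hq := isReduction_reductionMap hp M
  have hq' := isReduction_reductionMap hp (projectiveCover M)
  obtain ⟨g, hg⟩ := hq'.exists_lift hp ((reductionMap hp M).comp f)
  have hgs : Function.Surjective g := fun y => by
    obtain ⟨m, rfl⟩ := hq.surjective y
    obtain ⟨x, rfl⟩ := hf m
    exact ⟨_, hg x⟩
  rw [K0.mk_syzygy g hgs (hq'.projective hp (isProjectiveCover_map M).projective)]
  let q : LinearMap.ker f →ₛₗ[p] LinearMap.ker g :=
    { toFun := fun x => ⟨reductionMap hp (projectiveCover M) x, by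
        rw [LinearMap.mem_ker, hg, LinearMap.comp_apply, LinearMap.mem_ker.1 x.2, map_zero]⟩
      map_add' := fun x y => by ext; simp
      map_smul' := fun s x => by ext; simp }
  refine reductionHom_mk hp (M := syzygy M) (q := q) (h.isReduction ?_ ?_)
  · rintro ⟨y, hy⟩
    obtain ⟨x, rfl⟩ := hq'.surjective y
    rw [LinearMap.mem_ker, hg] at hy
    refine ⟨⟨ε • x, ?_⟩, Subtype.ext (h.apply_smul _ x)⟩
    rw [LinearMap.mem_ker, map_smul]
    exact (h.apply_eq_zero_iff hq _).1 hy
  · intro x hx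
    exact Subtype.ext ((h.apply_eq_zero_iff hq' _).1 (congrArg Subtype.val hx))

/-- If `S` is the product of `R` and `R'`, its `φ`-dimension is the maximum of theirs. -/
theorem leftPhiDim_eq_max {R' : Type u} [Ring R'] [IsArtinianRing R'] {p' : S →+* R'} {ε : S}
    (hp : Function.Surjective p) (hp' : Function.Surjective p') (h : IsSplitBy p ε)
    (h' : IsSplitBy p' (1 - ε)) : leftPhiDim S = max (leftPhiDim R) (leftPhiDim R') := by
  have hr : ∀ n x, reductionHom hp ((syzygyHom S)^[n] x) =
      (syzygyHom R)^[n] (reductionHom hp x) := fun n x =>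
    (Function.Semiconj.iterate_right (fun x => h.reductionHom_syzygyHom hp x) n) x
  have hr' : ∀ n x, reductionHom hp' ((syzygyHom S)^[n] x) =
      (syzygyHom R')^[n] (reductionHom hp' x) := fun n x =>
    (Function.Semiconj.iterate_right (fun x => h'.reductionHom_syzygyHom hp' x) n) x
  -- Every module is the direct sum of ε M and (1 - ε) M, so the two reductions and inflations
  -- decompose `K0 S`.
  have hsum : ∀ x : K0 S, h.inflationHom hp (reductionHom hp x) +
      h'.inflationHom hp' (reductionHom hp' x) = x := by
    refine DFunLike.congr_fun (f := (h.inflationHom hp).comp (reductionHom hp) +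
      (h'.inflationHom hp').comp (reductionHom hp')) (g := AddMonoidHom.id _)
      (K0.hom_ext fun M => ?_)
    have hq := isReduction_reductionMap hp M
    have hq' := isReduction_reductionMap hp' M
    rw [AddMonoidHom.add_apply, AddMonoidHom.comp_apply, AddMonoidHom.comp_apply,
      reductionHom_mk hp hq, reductionHom_mk hp' hq', AddMonoidHom.id_apply,
      h.inflationHom_mk, h'.inflationHom_mk]
    let f : M →ₗ[S] (inflation hp (reduction hp M) × inflation hp' (reduction hp' M)) :=
      { toFun := fun m => (reductionMap hp M m, reductionMap hp' M m)
        map_add' := fun a b => Prod.ext (map_add _ _ _) (map_add _ _ _)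
        map_smul' := fun s a => Prod.ext ((reductionMap hp M).map_smulₛₗ s a)
          ((reductionMap hp' M).map_smulₛₗ s a) }
    have hf : Function.Bijective f := by
      refine ⟨(injective_iff_map_eq_zero f).2 fun m hm => ?_, ?_⟩
      · have h1 := (h.apply_eq_zero_iff hq m).1 (congrArg Prod.fst hm)
        have h2 := (h'.apply_eq_zero_iff hq' m).1 (congrArg Prod.snd hm)
        rwa [sub_smul, one_smul, h1, sub_zero] at h2
      · rintro ⟨a, b⟩
        obtain ⟨a, rfl⟩ := hq.surjective a
        obtain ⟨b, rfl⟩ := hq'.surjective b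
        have e1 : p (1 - ε) = 0 := by rw [map_sub, map_one, h.map_eq_one, sub_self]
        have e2 : p' ε = 0 := by
          have := h'.map_eq_one
          rw [map_sub, map_one] at this
          simpa using this
        refine ⟨ε • a + (1 - ε) • b, Prod.ext ?_ ?_⟩
        · change reductionMap hp M (ε • a + (1 - ε) • b) = _
          rw [map_add, map_smulₛₗ, map_smulₛₗ, e1, h.map_eq_one, one_smul, zero_smul, add_zero]
        · change reductionMap hp' M (ε • a + (1 - ε) • b) = _
          rw [map_add, map_smulₛₗ, map_smulₛₗ, e2, h'.map_eq_one, one_smul, zero_smul, zero_add]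
    exact (K0.mk_eq_add (LinearEquiv.ofBijective f hf)).symm
  have hri := h.reductionHom_inflationHom hp
  have hri' := h'.reductionHom_inflationHom hp'
  have h0 : ∀ y, reductionHom hp' (h.inflationHom hp y) = 0 := fun y => by
    have := congrArg (reductionHom hp') (hsum (h.inflationHom hp y))
    rwa [hri, map_add, hri', add_eq_left] at this
  have h0' : ∀ y, reductionHom hp (h'.inflationHom hp' y) = 0 := fun y => by
    have := congrArg (reductionHom hp) (hsum (h'.inflationHom hp' y))
    rwa [hri', map_add, hri, add_eq_right] at this
  have hinj : ∀ x, reductionHom hp x = 0 → reductionHom hp' x = 0 → x = 0 := fun x h1 h2 => by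
    rw [← hsum x, h1, h2, map_zero, map_zero, add_zero]
  refine le_antisymm (le_of_forall_natCast_le fun d hd => ?_) (max_le
    (le_of_forall_natCast_le fun d hd => ?_) (le_of_forall_natCast_le fun d hd => ?_))
  · rw [max_le_iff, leftPhiDim_le_iff_kerStable, leftPhiDim_le_iff_kerStable] at hd
    rw [leftPhiDim_le_iff_kerStable]
    intro n x hx
    exact hinj _ (by rw [hr, hd.1 n _ (by rw [← hr, hx, map_zero])])
      (by rw [hr', hd.2 n _ (by rw [← hr', hx, map_zero])])
  · rw [leftPhiDim_le_iff_kerStable] at hd ⊢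
    intro n y hy
    rw [← hri y, ← hr, hd n _ (hinj _ (by rw [hr, hri, hy])
      (by rw [hr', h0, iterate_map_zero])), map_zero]
  · rw [leftPhiDim_le_iff_kerStable] at hd ⊢
    intro n y hy
    rw [← hri' y, ← hr', hd n _ (hinj _ (by rw [hr, h0', iterate_map_zero])
      (by rw [hr', hri', hy])), map_zero]

theorem leftPhiDim_punit : leftPhiDim PUnit.{u + 1} = 0 := by
  refine le_antisymm ((leftPhiDim_le_iff_kerStable 0).2 fun n x _ => ?_) bot_le
  obtain ⟨M, N, rfl⟩ := K0.exists_eq_sub x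
  have h : ∀ M : FGModuleCat.{u} PUnit.{u + 1}, Module.Projective PUnit.{u + 1} M := fun M => by
    have : Subsingleton M := Module.subsingleton PUnit.{u + 1} M
    infer_instance
  rw [K0.mk_projective (h M), K0.mk_projective (h N), sub_self]
  rfl

/-- An isomorphism is a product decomposition whose second factor is the zero ring, with ε = 1. -/
theorem leftPhiDim_congr (e : S ≃+* R) : leftPhiDim S = leftPhiDim R := by
  let p' : S →+* PUnit.{u + 1} :=
    { toFun := fun _ => PUnit.unit, map_one' := rfl, map_mul' := fun _ _ => rfl
      map_zero' := rfl, map_add' := fun _ _ => rfl }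
  have h : IsSplitBy (e : S →+* R) 1 := ⟨map_one _, fun s hs => by
    rw [(map_eq_zero_iff e e.injective).1 hs, mul_zero], fun s hs => by
    rw [(map_eq_zero_iff e e.injective).1 hs, zero_mul]⟩
  have h' : IsSplitBy p' (1 - 1) := ⟨rfl, fun s _ => by rw [sub_self, zero_mul], fun s _ => by
    rw [sub_self, mul_zero]⟩
  rw [leftPhiDim_eq_max (p := (e : S →+* R)) e.surjective (p' := p') (fun _ => ⟨0, rfl⟩) h h',
    leftPhiDim_punit]
  exact max_eq_left bot_le

end Splitting

/-! ### Radicals, simple modules and indecomposable projectives -/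

section Simples

variable {R : Type u} [Ring R]

/-- The simple modules are parametrized by `V`, possibly with repetitions. -/
def HasSimplesIndexedBy (R : Type u) [Ring R] (V : Type*) : Prop :=
  ∃ S : V → FGModuleCat.{u} R, ∀ M : FGModuleCat.{u} R, IsSimpleModule R M →
    ∃ v, Nonempty (M ≃ₗ[R] S v)

theorem isSemisimpleModule_of_jacobson_smul_eq_zero [IsArtinianRing R] {M : Type*}
    [AddCommGroup M] [Module R M] (h : ∀ r ∈ Ring.jacobson R, ∀ m : M, r • m = 0) :
    IsSemisimpleModule R M := by
  have h' : Module.IsTorsionBySet R M (Ring.jacobson R) := fun m r => h r r.2 m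
  let _ := h'.module
  exact h'.isSemisimpleModule_iff.1 inferInstance

/-- The quotient of M by (rad R) M is semisimple, so its radical vanishes. -/
theorem jacobson_le_jacobson_smul_top [IsArtinianRing R] {M : Type*} [AddCommGroup M]
    [Module R M] : Module.jacobson R M ≤ Ring.jacobson R • (⊤ : Submodule R M) := by
  refine Module.jacobson_le_of_eq_bot ?_
  have : IsSemisimpleModule R (M ⧸ (Ring.jacobson R • (⊤ : Submodule R M))) := by
    refine isSemisimpleModule_of_jacobson_smul_eq_zero fun r hr m => ?_
    obtain ⟨m, rfl⟩ := Submodule.Quotient.mk_surjective _ m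
    rw [← Submodule.Quotient.mk_smul, Submodule.Quotient.mk_eq_zero]
    exact Submodule.smul_mem_smul hr Submodule.mem_top
  exact IsSemisimpleModule.jacobson_eq_bot _ _

/-- A maximal submodule not containing the kernel would span `P` together with it, against
superfluity. -/
theorem IsProjectiveCover.ker_le_jacobson {P M : Type u} [AddCommGroup P] [Module R P]
    [AddCommGroup M] [Module R M] {f : P →ₗ[R] M} (hf : IsProjectiveCover f) :
    LinearMap.ker f ≤ Module.jacobson R P := by
  refine le_sInf fun N hN => ?_
  by_contra hcon
  have h1 : N < N ⊔ LinearMap.ker f := lt_of_le_of_ne le_sup_left fun h =>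
    hcon (h ▸ le_sup_right)
  exact hN.1 (hf.superfluous N (hN.2 _ h1))

theorem exists_simple_quotient (P : FGModuleCat.{u} R) [Nontrivial P] :
    ∃ (S : FGModuleCat.{u} R) (f : P →ₗ[R] S), IsSimpleModule R S ∧ Function.Surjective f := by
  obtain ⟨N, hN, -⟩ := (eq_top_or_exists_le_coatom (⊥ : Submodule R P)).resolve_left bot_ne_top
  exact ⟨FGModuleCat.of R (P ⧸ N), N.mkQ, isSimpleModule_iff_isCoatom.2 hN,
    Submodule.mkQ_surjective N⟩

variable [IsArtinianRing R]

/-- Indecomposable projective modules with a common nonzero quotient admitting lifts are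
isomorphic. -/
theorem IsIndecomposable.nonempty_equiv_of_projective {P P' S : FGModuleCat.{u} R}
    (hP : IsIndecomposable (R := R) P) (hP' : IsIndecomposable (R := R) P')
    [Module.Projective R P] [Module.Projective R P'] [Nontrivial S] (f : P →ₗ[R] S)
    (f' : P' →ₗ[R] S) (hf : Function.Surjective f) (hf' : Function.Surjective f') :
    Nonempty (P ≃ₗ[R] P') := by
  obtain ⟨a, ha⟩ := Module.projective_lifting_property f' f hf'
  obtain ⟨b, hb⟩ := Module.projective_lifting_property f f' hf
  -- An endomorphism compatible with a map onto a nonzero module cannot be nilpotent, so Fitting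
  -- makes it a unit.
  have key : ∀ {Q : FGModuleCat.{u} R} (_ : IsIndecomposable (R := R) Q) (g : Q →ₗ[R] S)
      (_ : Function.Surjective g) (c : Module.End R Q) (_ : ∀ x, g (c x) = g x), IsUnit c := by
    intro Q hQ g hg c hc
    refine (hQ.isNilpotent_or_isUnit c).resolve_left ?_
    rintro ⟨n, hn⟩
    obtain ⟨s, hs⟩ := exists_ne (0 : S)
    obtain ⟨x, rfl⟩ := hg s
    have hcn : ∀ m : ℕ, g ((c ^ m) x) = g x := fun m => by
      induction m with
      | zero => rfl
      | succ m ih => rw [pow_succ', Module.End.mul_apply, hc, ih]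
    have := hcn n
    rw [hn, LinearMap.zero_apply, map_zero] at this
    exact hs this.symm
  have ha' : ∀ x, f' (a x) = f x := fun x => LinearMap.congr_fun ha x
  have hb' : ∀ x, f (b x) = f' x := fun x => LinearMap.congr_fun hb x
  have h1 := (Module.End.isUnit_iff _).1 (key hP f hf (b.comp a) fun x => by simp [ha', hb'])
  have h2 := (Module.End.isUnit_iff _).1 (key hP' f' hf' (a.comp b) fun x => by simp [ha', hb'])
  exact ⟨LinearEquiv.ofBijective a ⟨fun x y hxy => h1.1 (congrArg b hxy), fun y =>
    let ⟨x, hx⟩ := h2.2 y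
    ⟨b x, hx⟩⟩⟩

/-- An indecomposable projective has a simple quotient, and two of them with a common simple
quotient are isomorphic; so one choice for each simple module exhausts them. -/
theorem HasSimplesIndexedBy.exists_projectives {V : Type*} (h : HasSimplesIndexedBy R V) :
    ∃ g : V → FGModuleCat.{u} R, (∀ v, Module.Projective R (g v)) ∧
      ∀ P : FGModuleCat.{u} R, IsIndecomposable (R := R) P → Module.Projective R P →
        ∃ v, Nonempty (P ≃ₗ[R] g v) := by
  classical
  obtain ⟨S, hS⟩ := h
  let C : V → FGModuleCat.{u} R → Prop := fun v P => IsIndecomposable (R := R) P ∧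
    Module.Projective R P ∧ IsSimpleModule R (S v) ∧
      ∃ f : P →ₗ[R] S v, Function.Surjective f
  let g : V → FGModuleCat.{u} R := fun v =>
    -- The zero module is a harmless default where no indecomposable projective maps onto a simple
    -- `S v`.
    if h : ∃ P, C v P then h.choose else FGModuleCat.of R PUnit.{u + 1}
  refine ⟨g, fun v => ?_, fun P hP hP' => ?_⟩
  · by_cases h : ∃ P, C v P
    · have : g v = h.choose := dif_pos h
      rw [this]
      exact h.choose_spec.2.1
    · have : g v = FGModuleCat.of R PUnit.{u + 1} := dif_neg h
      rw [this]
      exact inferInstanceAs (Module.Projective R PUnit.{u + 1})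
  · have := hP.1
    obtain ⟨T, f, hT, hf⟩ := exists_simple_quotient P
    obtain ⟨v, ⟨e⟩⟩ := hS T hT
    have hSv : IsSimpleModule R (S v) := IsSimpleModule.congr e.symm
    have h : ∃ P, C v P := ⟨P, hP, hP', hSv, e.toLinearMap.comp f, e.surjective.comp hf⟩
    have hg : g v = h.choose := dif_pos h
    refine ⟨v, ?_⟩
    rw [hg]
    obtain ⟨h1, h2, h3, f', hf'⟩ := h.choose_spec
    have := IsSimpleModule.nontrivial R (S v)
    exact hP.nonempty_equiv_of_projective h1 (e.toLinearMap.comp f) f' (e.surjective.comp hf) hf'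

end Simples

/-! ### Modules annihilated by the kernel, and restriction along a section -/

section Reduction

variable {S R : Type u} [Ring S] [Ring R] {p : S →+* R}

theorem reductionMap_bijective (hp : Function.Surjective p) {M : FGModuleCat.{u} S}
    (hM : ∀ i ∈ RingHom.ker p, ∀ m : M, i • m = 0) : Function.Bijective (reductionMap hp M) := by
  have hq := isReduction_reductionMap hp M
  refine ⟨(injective_iff_map_eq_zero _).2 fun m hm => ?_, hq.surjective⟩
  have h : RingHom.ker p • (⊤ : Submodule S M) = ⊥ :=
    eq_bot_iff.2 (Submodule.smul_le.2 fun r hr n _ => hM r hr n)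
  rw [← Submodule.mem_bot S, ← h]
  exact hq.mem_of_apply_eq_zero m hm

/-- A section `ι` of `p : S → R` makes projective `S`-modules projective over `R` if `S` is. -/
theorem projective_compHom (ι : R →+* S)
    (hS : @Module.Projective R _ S _ (Module.compHom S ι)) (P : Type u) [AddCommGroup P]
    [Module S P] [Module.Projective S P] :
    @Module.Projective R _ P _ (Module.compHom P ι) := by
  classical
  let _ : Module R S := Module.compHom S ι
  let _ : Module R P := Module.compHom P ι
  obtain ⟨s, hs⟩ := Module.projective_def'.1 (inferInstance : Module.Projective S P)
  let i : P →ₗ[R] (P →₀ S) :=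
    { toFun := s, map_add' := s.map_add, map_smul' := fun r x => s.map_smul (ι r) x }
  let t : (P →₀ S) →ₗ[R] P :=
    { toFun := Finsupp.linearCombination S id
      map_add' := map_add _
      map_smul' := fun r x => (Finsupp.linearCombination S id).map_smul (ι r) x }
  have : Module.Projective R (P →₀ S) :=
    Module.Projective.of_equiv' (finsuppLequivDFinsupp R).symm
  exact Module.Projective.of_split i t (LinearMap.ext fun x => LinearMap.congr_fun hs x)

end Reduction

/-! ### Kernels annihilated by the radical on the right -/

section SocleExtension

variable {S R : Type u} [Ring S] [Ring R] [IsArtinianRing S] {p : S →+* R}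

/-- The syzygy lies in the radical of the cover, which is contained in (rad S) P, and ker p · rad S
= 0. -/
theorem smul_eq_zero_of_mem_syzygy
    (hJ : ∀ i ∈ RingHom.ker p, ∀ j ∈ Ring.jacobson S, i * j = 0) (M : FGModuleCat.{u} S) :
    ∀ i ∈ RingHom.ker p, ∀ m : syzygy M, i • m = 0 := by
  intro i hi m
  have h1 := jacobson_le_jacobson_smul_top
    ((isProjectiveCover_map M).ker_le_jacobson m.2)
  have h2 : ∀ x ∈ Ring.jacobson S • (⊤ : Submodule S (projectiveCover M)), i • x = 0 := by
    intro x hx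
    induction hx using Submodule.smul_induction_on' with
    | smul r hr n _ => rw [← mul_smul, hJ i hi r hr, zero_smul]
    | add x _ y _ hx hy => rw [smul_add, hx, hy, add_zero]
  exact Subtype.ext (h2 _ h1)

variable [IsArtinianRing R]

/-- Let I = ker p, and let P be the `S`-cover of `N`. Since I kills `N`, the module P / IP maps onto
`N` over `R`, with kernel K say, and the `S`-syzygy maps onto K with kernel IP. An `R`-linear
section of P → P / IP restricts to K, so the syzygy is K ⊕ IP over `R`. Here Q = IP is an
`R`-summand of P, hence projective over `R`; it need not be projective over `S`, so its class is
retained. -/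
theorem exists_mk_syzygy_inflation (hp : Function.Surjective p) (ι : R →+* S)
    (hι : ∀ r, p (ι r) = r) (hS : @Module.Projective R _ S _ (Module.compHom S ι))
    (hJ : ∀ i ∈ RingHom.ker p, ∀ j ∈ Ring.jacobson S, i * j = 0) (N : FGModuleCat.{u} R) :
    ∃ K Q : FGModuleCat.{u} R, Module.Projective R Q ∧ K0.mk K = syzygyHom R (K0.mk N) ∧
      K0.mk (syzygy (inflation hp N)) = K0.mk (inflation hp K) + K0.mk (inflation hp Q) := by
  let P := projectiveCover (inflation hp N)
  let f : P →ₗ[S] inflation hp N := projectiveCoverMap (inflation hp N)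
  have hf : Function.Surjective f := (isProjectiveCover_map _).surjective
  have hP : Module.Projective S P := (isProjectiveCover_map _).projective
  let q : P →ₛₗ[p] reduction hp P := reductionMap hp P
  have hq : IsReduction q := isReduction_reductionMap hp P
  have hPR := hq.projective hp hP
  obtain ⟨g, hg⟩ := hq.exists_lift hp ((inflationMap hp N).comp f)
  have hg' : ∀ x, g (q x) = inflationMap hp N (f x) := hg
  have hgs : Function.Surjective g := fun y => by
    obtain ⟨m, rfl⟩ := (inflationMap_bijective hp N).2 y
    obtain ⟨x, rfl⟩ := hf m
    exact ⟨_, hg x⟩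
  let _ : Module R P := Module.compHom P ι
  have hsmul : ∀ (r : R) (x : P), r • x = ι r • x := fun _ _ => rfl
  have hPp : Module.Projective R P := projective_compHom ι hS P
  let qR : P →ₗ[R] reduction hp P :=
    { toFun := q, map_add' := q.map_add
      map_smul' := fun r x => by rw [hsmul, map_smulₛₗ, hι, RingHom.id_apply] }
  obtain ⟨s, hs⟩ := Module.projective_lifting_property qR LinearMap.id hq.surjective
  have hs' : ∀ y, q (s y) = y := fun y => LinearMap.congr_fun hs y
  have hmem : ∀ x : P, x ∈ LinearMap.ker f ↔ g (q x) = 0 := fun x => by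
    rw [hg', LinearMap.mem_ker]
    exact (map_eq_zero_iff _ (inflationMap_bijective hp N).1).symm
  -- E is the syzygy seen as an `R`-module, which is possible because ker p annihilates it.
  obtain ⟨E, r, hr⟩ : ∃ (E : FGModuleCat.{u} R) (r : LinearMap.ker f →ₛₗ[p] E),
      Function.Bijective r :=
    ⟨_, _, reductionMap_bijective hp (smul_eq_zero_of_mem_syzygy hJ (inflation hp N))⟩
  let q' : LinearMap.ker f →ₛₗ[p] LinearMap.ker g :=
    { toFun := fun x => ⟨q x, (hmem x).1 x.2⟩
      map_add' := fun x y => by ext; simp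
      map_smul' := fun s x => by ext; simp }
  obtain ⟨h, hh'⟩ := (isReduction_of_bijective hr).exists_lift hp q'
  -- The section `s` carries ker g into ker f, because membership in ker f is tested after applying
  -- `q`.
  let σ : LinearMap.ker g →ₗ[R] E :=
    { toFun := fun w => r ⟨s w, (hmem _).2 (by rw [hs']; exact LinearMap.mem_ker.1 w.2)⟩
      map_add' := fun a b => by
        rw [← map_add]
        congr 1
        exact Subtype.ext (map_add s _ _)
      map_smul' := fun c a => by
        have : (⟨s (c • a : LinearMap.ker g), (hmem _).2 (by rw [hs']; exact LinearMap.mem_ker.1 (c • a).2)⟩ :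
            LinearMap.ker f) = ι c • ⟨s a, (hmem _).2 (by rw [hs']; exact LinearMap.mem_ker.1 a.2)⟩ :=
          Subtype.ext (map_smul s c (a : reduction hp P))
        rw [this]
        refine (map_smulₛₗ r (ι c) _).trans ?_
        rw [hι, RingHom.id_apply] }
  have hhσ : ∀ w, h (σ w) = w := fun w => (hh' _).trans (Subtype.ext (hs' w))
  let e : E ≃ₗ[R] (LinearMap.ker g × LinearMap.ker h) :=
    { toFun := fun x => (h x, ⟨x - σ (h x), by simp [hhσ]⟩)
      invFun := fun z => σ z.1 + z.2
      map_add' := fun x y => by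
        refine Prod.ext (map_add h x y) (Subtype.ext ?_)
        simp only [map_add, Prod.snd_add, Submodule.coe_add]; abel
      map_smul' := fun c x => by
        refine Prod.ext (map_smul h c x) (Subtype.ext ?_)
        simp [smul_sub]
      left_inv := fun x => by simp
      right_inv := fun z => by
        have : h (z.2 : E) = 0 := z.2.2
        refine Prod.ext ?_ (Subtype.ext ?_) <;> simp [hhσ, this] }
  let K := FGModuleCat.of R (LinearMap.ker g)
  let Q := FGModuleCat.of R (LinearMap.ker h)
  have hQ : Module.Projective R (LinearMap.ker h) := by
    let rinv := (Equiv.ofBijective r hr).symm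
    have hrr : ∀ y, r (rinv y) = y := (Equiv.ofBijective r hr).apply_symm_apply
    -- The kernel of `h` is the copy in E of the kernel of `q`; it is an `R`-summand of P through x
    -- ↦ x - s (q x).
    let i : LinearMap.ker h →ₗ[R] P :=
      { toFun := fun y => ((rinv y : LinearMap.ker f) : P)
        map_add' := fun a b => by
          have : rinv (a + b : LinearMap.ker h) = rinv a + rinv b := hr.1 (by
            rw [map_add, hrr, hrr, hrr]; rfl)
          exact congrArg Subtype.val this
        map_smul' := fun c a => by
          have : rinv (c • a : LinearMap.ker h) = ι c • rinv a := hr.1 (by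
            rw [map_smulₛₗ, hrr, hrr, hι]; rfl)
          exact congrArg Subtype.val this }
    have hqs : ∀ x, x - s (q x) ∈ LinearMap.ker f := fun x => (hmem _).2 (by
      rw [map_sub, hs', sub_self, map_zero])
    let t : P →ₗ[R] LinearMap.ker h :=
      { toFun := fun x => ⟨r ⟨x - s (q x), hqs x⟩, (hh' _).trans (Subtype.ext (by
          change q (x - s (q x)) = 0
          rw [map_sub, hs', sub_self]))⟩
        map_add' := fun a b => Subtype.ext (by
          change r _ = r _ + r _
          rw [← map_add]
          congr 1
          refine Subtype.ext ?_
          change a + b - s (q (a + b)) = (a - s (q a)) + (b - s (q b))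
          rw [map_add, map_add]
          abel)
        map_smul' := fun c a => Subtype.ext (by
          change r _ = c • r _
          have : c • r ⟨a - s (q a), hqs a⟩ = r (ι c • ⟨a - s (q a), hqs a⟩) := by
            rw [map_smulₛₗ, hι]
          rw [this]
          congr 1
          refine Subtype.ext ?_
          change c • a - s (q (c • a)) = ι c • (a - s (q a))
          have h2 : q (c • a) = c • q a := qR.map_smul c a
          rw [h2, map_smul, ← smul_sub]
          rfl) }
    refine Module.Projective.of_split i t (LinearMap.ext fun y => Subtype.ext ?_)
    change r ⟨((rinv y : LinearMap.ker f) : P) - s (q (rinv y : LinearMap.ker f)), _⟩ = y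
    have h3 : q ((rinv y : LinearMap.ker f) : P) = 0 := by
      have := hh' (rinv y)
      rw [hrr, LinearMap.mem_ker.1 y.2] at this
      exact (congrArg Subtype.val this).symm
    refine Eq.trans (congrArg r (Subtype.ext ?_)) (hrr y)
    change ((rinv y : LinearMap.ker f) : P) - s (q (rinv y : LinearMap.ker f)) = _
    rw [h3, map_zero, sub_zero]
  refine ⟨K, Q, hQ, ?_, ?_⟩
  · rw [syzygyHom_mk]
    exact (K0.mk_syzygy (P := reduction hp P) g hgs hPR).symm
  · obtain ⟨e'⟩ := nonempty_equiv_of_bijective hr (inflationMap_bijective hp E)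
      (LinearEquiv.refl R E)
    exact (K0.mk_congr (M := syzygy (inflation hp N)) e').trans (isAdditive_inflation hp E K Q e)

/-- The case of an ideal annihilated on the right by the radical. -/
theorem leftPhiDim_le_of_ker_mul_jacobson (k : Type w) [Field k] [Algebra k S] [Algebra k R]
    [Module.Finite k S] [Module.Finite k R] (hp : Function.Surjective p) (ι : R →+* S)
    (hι : ∀ r, p (ι r) = r) (hS : @Module.Projective R _ S _ (Module.compHom S ι))
    (hJ : ∀ i ∈ RingHom.ker p, ∀ j ∈ Ring.jacobson S, i * j = 0)
    {V : Type*} [Fintype V] (hV : HasSimplesIndexedBy R V) :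
    leftPhiDim R ≤ leftPhiDim S ∧ leftPhiDim S ≤ leftPhiDim R + Fintype.card V + 1 := by
  obtain ⟨P, hP, hP'⟩ := hV.exists_projectives
  let g : V → K0 S := fun v => K0.mk (inflation hp (P v))
  -- The subgroup of classes of `R`-modules contains the image of Ω̄, and on it reduction commutes
  -- with syzygies.
  let L : AddSubgroup (K0 S) := AddSubgroup.closure
    (Set.range fun N : FGModuleCat.{u} R => K0.mk (inflation hp N))
  have hinf : ∀ N : FGModuleCat.{u} R, K0.mk (inflation hp N) ∈ L := fun N =>
    AddSubgroup.subset_closure ⟨N, rfl⟩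
  have hL : ∀ x, syzygyHom S x ∈ L := by
    have : ∀ M : FGModuleCat.{u} S, syzygyHom S (K0.mk M) ∈ L := fun M => by
      rw [syzygyHom_mk]
      obtain ⟨e⟩ := nonempty_equiv_of_bijective
        (reductionMap_bijective hp (smul_eq_zero_of_mem_syzygy hJ M))
        (inflationMap_bijective hp _) (LinearEquiv.refl R _)
      rw [K0.mk_congr e]
      exact hinf _
    intro x
    obtain ⟨M, N, rfl⟩ := K0.exists_eq_sub x
    rw [map_sub]
    exact sub_mem (this M) (this N)
  have hr : ∀ x ∈ L, reductionHom hp (syzygyHom S x) = syzygyHom R (reductionHom hp x) := by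
    intro x hx
    induction hx using AddSubgroup.closure_induction with
    | mem x hx =>
      obtain ⟨N, rfl⟩ := hx
      obtain ⟨K, Q, hQ, hK, h⟩ := exists_mk_syzygy_inflation hp ι hι hS hJ N
      simp only
      rw [syzygyHom_mk, h, map_add, reductionHom_inflation, reductionHom_inflation,
        reductionHom_inflation, hK, K0.mk_projective hQ, add_zero]
    | zero => simp
    | add x y _ _ hx hy => rw [map_add, map_add, hx, hy, map_add, map_add]
    | neg x _ hx => rw [map_neg, map_neg, hx, map_neg, map_neg]
  have hg : ∀ v, g v ∈ L ∧ reductionHom hp (g v) = 0 := fun v =>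
    ⟨hinf _, (reductionHom_inflation hp _).trans (K0.mk_projective (hP v))⟩
  have hker : ∀ x ∈ L, reductionHom hp x = 0 → x ∈ AddSubgroup.closure (Set.range g) := by
    let T := AddSubgroup.closure (Set.range g)
    -- Modulo the inflated projectives inflation does descend to `K0 R`. Composed with reduction it
    -- is the quotient map on `L`, so an element of `L` with zero reduction lies in `T`.
    let σ : K0 R →+ K0 S ⧸ T := K0.lift
      (fun N => QuotientAddGroup.mk' T (K0.mk (inflation hp N)))
      (fun M M' M'' e => by rw [← map_add]; exact congrArg _ (isAdditive_inflation hp M M' M'' e))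
      (fun Q hQ => (QuotientAddGroup.eq_zero_iff _).2 (by
        refine (AddSubgroup.closure_le _).2 ?_ ((isAdditive_inflation hp).mem_closure Q)
        rintro _ ⟨N, hN, hN', rfl⟩
        obtain ⟨v, ⟨e⟩⟩ := hP' N hN' (hN.projective hQ)
        exact AddSubgroup.subset_closure ⟨v, ((isAdditive_inflation hp).congr e).symm⟩))
    have hσ : ∀ x ∈ L, σ (reductionHom hp x) = QuotientAddGroup.mk' T x := by
      intro x hx
      induction hx using AddSubgroup.closure_induction with
      | mem x hx =>
        obtain ⟨N, rfl⟩ := hx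
        simp only
        rw [reductionHom_inflation]
        exact K0.lift_mk _ _ _ _
      | zero => simp
      | add x y _ _ hx hy => rw [map_add, map_add, hx, hy, map_add]
      | neg x _ hx => rw [map_neg, map_neg, hx, map_neg]
    intro x hx h0
    have := hσ x hx
    rw [h0, map_zero] at this
    exact (QuotientAddGroup.eq_zero_iff _).1 this.symm
  have hsurj : ∀ y, ∃ x ∈ L, reductionHom hp x = y := fun y => by
    obtain ⟨M, N, rfl⟩ := K0.exists_eq_sub y
    exact ⟨_, sub_mem (hinf M) (hinf N), by
      rw [map_sub, reductionHom_inflation, reductionHom_inflation]⟩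
  constructor
  · refine le_of_forall_natCast_le fun d hd => ?_
    rw [leftPhiDim_le_iff_kerStable] at hd ⊢
    exact KerStable.of_surjOn _ _ _ L hL hr
      (fun c x hc hx => K0.eq_zero_of_zsmul_eq_zero k hc hx) g hg hker hsurj hd
  · generalize hd : leftPhiDim R = d
    induction d using ENat.recTopCoe with
    | top => simp
    | coe d =>
      have h := (leftPhiDim_le_iff_kerStable d).1 hd.le
      have := (leftPhiDim_le_iff_kerStable (d + Fintype.card V + 1)).2
        (KerStable.of_ker_fg (syzygyHom S) _ _ L hL hr
          (fun c x hc hx => K0.eq_zero_of_zsmul_eq_zero k hc hx) g hg hker h)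
      exact_mod_cast this

end SocleExtension

/-! ### Extensions by a kernel free on elements with scalar left action -/

/-- An algebra `Λ` with a retraction `Λ → Γ` whose kernel is freely spanned, as a right module, by
elements `x j` on which `Γ` acts on the left through characters `χ j`: the kernel is the direct sum
of the `x j * Γ ≃ e j * Γ`, and `c j` reads off the coordinates. -/
structure GlueData (k : Type w) (Γ Λ : Type u) [Field k] [Ring Γ] [Algebra k Γ] [Ring Λ]
    (J : Type) [Fintype J] where
  proj : Λ →+* Γ
  incl : Γ →+* Λ
  x : J → Λ
  e : J → Γ
  χ : J → Γ →+* k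
  c : J → Λ →+ Γ
  proj_incl : ∀ g, proj (incl g) = g
  expand : ∀ a, a = incl (proj a) + ∑ j, x j * incl (c j a)
  c_incl : ∀ j g, c j (incl g) = 0
  proj_x : ∀ j, proj (x j) = 0
  c_x_self : ∀ j, c j (x j) = e j
  c_x_of_ne : ∀ i j, i ≠ j → c i (x j) = 0
  c_mul : ∀ j a b, c j (a * b) = algebraMap k Γ (χ j (proj a)) * c j b + c j a * proj b

namespace GlueData

variable {k : Type w} {Γ Λ : Type u} [Field k] [Ring Γ] [Algebra k Γ] [Ring Λ] {J : Type}
  [Fintype J] (D : GlueData k Γ Λ J)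

theorem proj_surjective : Function.Surjective D.proj := fun g => ⟨_, D.proj_incl g⟩

theorem c_mul_incl (j : J) (a : Λ) (g : Γ) : D.c j (a * D.incl g) = D.c j a * g := by
  rw [D.c_mul, D.c_incl, mul_zero, zero_add, D.proj_incl]

theorem c_x_mul (j : J) (a : Λ) : D.c j (D.x j * a) = D.e j * D.proj a := by
  rw [D.c_mul, D.proj_x, map_zero, map_zero, zero_mul, zero_add, D.c_x_self]

theorem c_x_mul_of_ne {i j : J} (h : i ≠ j) (a : Λ) : D.c i (D.x j * a) = 0 := by
  rw [D.c_mul, D.proj_x, map_zero, map_zero, zero_mul, zero_add, D.c_x_of_ne i j h, zero_mul]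

theorem c_sum (i : J) (a : J → Λ) : D.c i (∑ j, D.x j * a j) = D.e i * D.proj (a i) := by
  rw [map_sum, Finset.sum_eq_single i (fun j _ h => D.c_x_mul_of_ne h.symm _)
    (fun h => absurd (Finset.mem_univ _) h), D.c_x_mul]

/-- Reading the j-th coordinate of the expansion of `a` gives back e_j times that coordinate. -/
theorem e_mul_c (j : J) (a : Λ) : D.e j * D.c j a = D.c j a := by
  conv_rhs => rw [D.expand a, map_add, D.c_incl, zero_add, D.c_sum, D.proj_incl]

/-- Both sides lie in the kernel of `proj` and have no coordinate other than the j-th. The two j-th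
coordinates agree because scalars commute with e_j. -/
theorem mul_x (a : Λ) (j : J) :
    a * D.x j = D.x j * D.incl (algebraMap k Γ (D.χ j (D.proj a))) := by
  have h : ∀ (b : Λ), D.proj b = 0 → (∀ i, i ≠ j → D.c i b = 0) →
      b = D.x j * D.incl (D.c j b) := by
    intro b hb hi
    conv_lhs => rw [D.expand b, hb, map_zero, zero_add]
    refine Finset.sum_eq_single j (fun i _ hij => ?_) (fun h => absurd (Finset.mem_univ _) h)
    rw [hi i hij, map_zero, mul_zero]
  rw [h (a * D.x j) (by rw [map_mul, D.proj_x, mul_zero]) fun i hij => by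
      rw [D.c_mul, D.proj_x, mul_zero, D.c_x_of_ne i j hij, mul_zero, add_zero],
    h (D.x j * D.incl (algebraMap k Γ (D.χ j (D.proj a)))) (by
      rw [map_mul, D.proj_x, zero_mul]) fun i hij => D.c_x_mul_of_ne hij _]
  rw [D.c_mul, D.proj_x, mul_zero, add_zero, D.c_x_mul, D.proj_incl, D.c_x_self,
    Algebra.commutes]

/-! ### Induced modules -/

section Induced

/-- The submodule of families `n` with `e j • n j = n j`. -/
def fixedFamilies (N : Type u) [AddCommGroup N] [Module Γ N] : AddSubgroup (J → N) where
  carrier := {n | ∀ j, D.e j • n j = n j}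
  zero_mem' := fun _ => smul_zero _
  add_mem' := fun ha hb j => by rw [Pi.add_apply, smul_add, ha, hb]
  neg_mem' := fun ha j => by rw [Pi.neg_apply, smul_neg, ha]

/-- The `Λ`-module `Λ ⊗ N` induced from a `Γ`-module `N`. -/
def Induced (N : Type u) [AddCommGroup N] [Module Γ N] : Type u := N × D.fixedFamilies N

variable (N : Type u) [AddCommGroup N] [Module Γ N]

instance : AddCommGroup (D.Induced N) := inferInstanceAs (AddCommGroup (N × D.fixedFamilies N))

variable {N}

@[ext] theorem Induced.ext {a b : D.Induced N} (h : a.1 = b.1) (h' : ∀ j, a.2.1 j = b.2.1 j) :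
    a = b :=
  Prod.ext h (Subtype.ext (funext h'))

@[simp] theorem Induced.add_fst (a b : D.Induced N) : (a + b).1 = a.1 + b.1 := rfl
@[simp] theorem Induced.add_snd (a b : D.Induced N) (j : J) :
    (a + b).2.1 j = a.2.1 j + b.2.1 j := rfl
@[simp] theorem Induced.zero_fst : (0 : D.Induced N).1 = 0 := rfl
@[simp] theorem Induced.zero_snd (j : J) : (0 : D.Induced N).2.1 j = 0 := rfl

@[simp] theorem Induced.sum_fst {I : Type*} (s : Finset I) (a : I → D.Induced N) :
    (∑ i ∈ s, a i).1 = ∑ i ∈ s, (a i).1 :=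
  map_sum (AddMonoidHom.mk' (fun n : D.Induced N => n.1) fun _ _ => rfl) a s

theorem Induced.sum_snd {I : Type*} (s : Finset I) (a : I → D.Induced N) (j : J) :
    (∑ i ∈ s, a i).2.1 j = ∑ i ∈ s, (a i).2.1 j :=
  map_sum (AddMonoidHom.mk' (fun n : D.Induced N => n.2.1 j) fun _ _ => rfl) a s

theorem Induced.e_smul (a : D.Induced N) (j : J) : D.e j • a.2.1 j = a.2.1 j := a.2.2 j

/-- The pair (n, (n_j)) stands for 1 ⊗ n + ∑ x_j ⊗ n_j, and the formula is what `expand` and `mul_x`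
then force. -/
instance : SMul Λ (D.Induced N) where
  smul a n := (D.proj a • n.1, ⟨fun j => algebraMap k Γ (D.χ j (D.proj a)) • n.2.1 j + D.c j a • n.1,
    fun j => by
      rw [smul_add, smul_smul, ← Algebra.commutes, mul_smul, Induced.e_smul, smul_smul, e_mul_c]⟩)

@[simp] theorem Induced.smul_fst (a : Λ) (n : D.Induced N) : (a • n).1 = D.proj a • n.1 := rfl
@[simp] theorem Induced.smul_snd (a : Λ) (n : D.Induced N) (j : J) : (a • n).2.1 j =
    algebraMap k Γ (D.χ j (D.proj a)) • n.2.1 j + D.c j a • n.1 := rfl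

theorem c_one (j : J) : D.c j 1 = 0 := by rw [← map_one D.incl, D.c_incl]

instance : Module Λ (D.Induced N) where
  one_smul n := by ext <;> simp [D.c_one]
  mul_smul a b n := by
    ext j
    · simp [mul_smul]
    · simp only [Induced.smul_snd, Induced.smul_fst, D.c_mul, map_mul, mul_smul, add_smul,
        smul_add]
      abel
  smul_zero a := by ext <;> simp
  smul_add a m n := by
    ext j
    · simp
    · simp only [Induced.smul_snd, Induced.add_fst, Induced.add_snd, smul_add]
      abel
  add_smul a b n := by
    ext j
    · simp [add_smul]
    · simp only [Induced.smul_snd, Induced.add_snd, map_add, add_smul]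
      abel
  zero_smul n := by ext <;> simp

variable (N) in
/-- The canonical map from a `Γ`-module to the induced `Λ`-module. -/
def toInduced : N →ₛₗ[D.incl] D.Induced N where
  toFun n := (n, 0)
  map_add' a b := by
    ext
    · rfl
    · exact (add_zero _).symm
  map_smul' g n := by
    ext j
    · exact (congrArg (· • n) (D.proj_incl g)).symm
    · refine Eq.trans ?_ (Induced.smul_snd D _ _ _).symm
      rw [D.c_incl, zero_smul, add_zero]
      exact (smul_zero _).symm

variable (N) in
/-- The projection of the induced module to the given module. -/
def ofInduced : D.Induced N →ₛₗ[D.proj] N where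
  toFun n := n.1
  map_add' _ _ := rfl
  map_smul' _ _ := rfl

@[simp] theorem toInduced_fst (n : N) : (D.toInduced N n).1 = n := rfl
@[simp] theorem toInduced_snd (n : N) (j : J) : (D.toInduced N n).2.1 j = 0 := rfl
@[simp] theorem ofInduced_apply (n : D.Induced N) : D.ofInduced N n = n.1 := rfl

theorem induced_eq (n : D.Induced N) :
    n = D.toInduced N n.1 + ∑ j, D.x j • D.toInduced N (n.2.1 j) := by
  ext i
  · simp [D.proj_x]
  · rw [Induced.add_snd, Induced.sum_snd,
      Finset.sum_eq_single i _ (fun h => absurd (Finset.mem_univ _) h)]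
    · simp [D.proj_x, D.c_x_self, Induced.e_smul]
    · intro j _ hj
      simp [D.proj_x, D.c_x_of_ne i j hj.symm]

theorem isReduction_ofInduced : IsReduction (D.ofInduced N) where
  surjective n := ⟨D.toInduced N n, rfl⟩
  mem_of_apply_eq_zero n hn := by
    have hn' : n.1 = 0 := hn
    rw [D.induced_eq n, hn', map_zero, zero_add]
    exact sum_mem fun j _ => Submodule.smul_mem_smul (D.proj_x j) Submodule.mem_top

/-- The universal property of the induced module. -/
def inducedLift {X : Type*} [AddCommGroup X] [Module Λ X] (φ : N →ₛₗ[D.incl] X) :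
    D.Induced N →ₗ[Λ] X where
  toFun n := φ n.1 + ∑ j, D.x j • φ (n.2.1 j)
  map_add' a b := by
    simp only [Induced.add_fst, Induced.add_snd, map_add, smul_add, Finset.sum_add_distrib]
    abel
  map_smul' a n := by
    simp only [Induced.smul_fst, Induced.smul_snd, map_add, map_smulₛₗ, smul_add,
      Finset.sum_add_distrib, RingHom.id_apply, Finset.smul_sum]
    conv_rhs => rw [D.expand a, add_smul, Finset.sum_smul]
    simp_rw [← mul_smul, ← D.expand a, D.mul_x]
    abel

theorem inducedLift_apply {X : Type*} [AddCommGroup X] [Module Λ X] (φ : N →ₛₗ[D.incl] X)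
    (n : D.Induced N) : D.inducedLift φ n = φ n.1 + ∑ j, D.x j • φ (n.2.1 j) := rfl

theorem inducedLift_toInduced {X : Type*} [AddCommGroup X] [Module Λ X] (φ : N →ₛₗ[D.incl] X)
    (n : N) : D.inducedLift φ (D.toInduced N n) = φ n := by
  simp [inducedLift_apply]

theorem induced_hom_ext {X : Type*} [AddCommGroup X] [Module Λ X] {f g : D.Induced N →ₗ[Λ] X}
    (h : ∀ n, f (D.toInduced N n) = g (D.toInduced N n)) : f = g := by
  ext n
  rw [D.induced_eq n]
  simp [h]

instance [Module.Finite Γ N] : Module.Finite Λ (D.Induced N) := by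
  obtain ⟨s, hs⟩ := Module.Finite.fg_top (R := Γ) (M := N)
  classical
  refine ⟨⟨s.image (D.toInduced N), eq_top_iff.2 ?_⟩⟩
  rw [Finset.coe_image]
  set T := Submodule.span Λ (D.toInduced N '' (s : Set N))
  have hT : ∀ n, D.toInduced N n ∈ T := by
    intro n
    have hn : n ∈ Submodule.span Γ (s : Set N) := hs ▸ Submodule.mem_top
    induction hn using Submodule.span_induction with
    | mem n hn => exact Submodule.subset_span ⟨n, hn, rfl⟩
    | zero => rw [map_zero]; exact T.zero_mem
    | add a b _ _ ha hb => rw [map_add]; exact T.add_mem ha hb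
    | smul g a _ ha => rw [map_smulₛₗ]; exact T.smul_mem _ ha
  rintro n -
  rw [D.induced_eq n]
  exact T.add_mem (hT _) (sum_mem fun j _ => T.smul_mem _ (hT _))

/-- Λ-linear maps out of the induced module are Γ-linear maps out of `N`, so a lifting problem over
Λ becomes one over Γ. -/
theorem induced_projective [Module.Projective Γ N] : Module.Projective Λ (D.Induced N) := by
  refine Module.Projective.of_lifting_property'' fun f hf => ?_
  obtain ⟨h, hh⟩ := exists_semilinear_lift f hf (D.toInduced N)
  exact ⟨D.inducedLift h, D.induced_hom_ext fun n => by
    rw [LinearMap.comp_apply, D.inducedLift_toInduced, hh, LinearMap.id_apply]⟩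

variable {N' : Type u} [AddCommGroup N'] [Module Γ N']

/-- Functoriality of the induced module. -/
def inducedMap (f : N →ₗ[Γ] N') : D.Induced N →ₗ[Λ] D.Induced N' where
  toFun n := (f n.1, ⟨fun j => f (n.2.1 j), fun j => by
    change D.e j • f (n.2.1 j) = f (n.2.1 j)
    rw [← map_smul, Induced.e_smul]⟩)
  map_add' a b := Induced.ext D (map_add f _ _) fun j => map_add f _ _
  map_smul' a n := Induced.ext D (map_smul f _ _) fun j => by
    refine (map_add f _ _).trans ?_
    rw [map_smul, map_smul]
    rfl

@[simp] theorem inducedMap_fst (f : N →ₗ[Γ] N') (n : D.Induced N) :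
    (D.inducedMap f n).1 = f n.1 := rfl
@[simp] theorem inducedMap_snd (f : N →ₗ[Γ] N') (n : D.Induced N) (j : J) :
    (D.inducedMap f n).2.1 j = f (n.2.1 j) := rfl

theorem inducedMap_surjective {f : N →ₗ[Γ] N'} (hf : Function.Surjective f) :
    Function.Surjective (D.inducedMap f) := fun n => by
  choose g hg using hf
  refine ⟨D.toInduced N (g n.1) + ∑ j, D.x j • D.toInduced N (g (n.2.1 j)), ?_⟩
  have h : ∀ a, D.inducedMap f (D.toInduced N a) = D.toInduced N' (f a) := fun a =>
    Induced.ext D rfl fun j => map_zero f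
  conv_rhs => rw [D.induced_eq n]
  simp [h, hg]

/-- Induction commutes with kernels. -/
def kerInducedMapEquiv (f : N →ₗ[Γ] N') :
    LinearMap.ker (D.inducedMap f) ≃ₗ[Λ] D.Induced (LinearMap.ker f) where
  toFun n := (⟨n.1.1, congrArg Prod.fst n.2⟩, ⟨fun j => ⟨n.1.2.1 j,
    congrArg (fun m : D.Induced N' => m.2.1 j) n.2⟩, fun j => Subtype.ext (n.1.2.2 j)⟩)
  invFun n := ⟨(n.1.1, ⟨fun j => n.2.1 j, fun j => congrArg Subtype.val (n.2.2 j)⟩),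
    Induced.ext D n.1.2 fun j => (n.2.1 j).2⟩
  map_add' _ _ := rfl
  map_smul' _ _ := rfl
  left_inv _ := rfl
  right_inv _ := rfl

/-- Induction commutes with direct sums. -/
def inducedProdEquiv : D.Induced (N × N') ≃ₗ[Λ] (D.Induced N × D.Induced N') where
  toFun n := ((n.1.1, ⟨fun j => (n.2.1 j).1, fun j => congrArg Prod.fst (n.2.2 j)⟩),
    (n.1.2, ⟨fun j => (n.2.1 j).2, fun j => congrArg Prod.snd (n.2.2 j)⟩))
  invFun n := ((n.1.1, n.2.1), ⟨fun j => (n.1.2.1 j, n.2.2.1 j), fun j =>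
    Prod.ext (n.1.2.2 j) (n.2.2.2 j)⟩)
  map_add' _ _ := rfl
  map_smul' _ _ := rfl
  left_inv _ := rfl
  right_inv _ := rfl

/-- Isomorphic modules induce isomorphic modules. -/
def inducedCongr (f : N ≃ₗ[Γ] N') : D.Induced N ≃ₗ[Λ] D.Induced N' :=
  LinearEquiv.ofLinearMap (D.inducedMap f.toLinearMap) (D.inducedMap f.symm.toLinearMap)
    (LinearMap.ext fun _ => Induced.ext D (f.apply_symm_apply _) fun _ => f.apply_symm_apply _)
    (LinearMap.ext fun _ => Induced.ext D (f.symm_apply_apply _) fun _ => f.symm_apply_apply _)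

end Induced

/-! ### Induction on K₀ -/

section K0

/-- The homomorphism `K₀(Γ) → K₀(Λ)` given by induction. -/
noncomputable def inducedHom : K0 Γ →+ K0 Λ :=
  K0.lift (fun N => K0.mk (FGModuleCat.of Λ (D.Induced N)))
    (fun _ _ _ e => K0.mk_eq_add (M := FGModuleCat.of Λ (D.Induced _))
      ((D.inducedCongr e).trans D.inducedProdEquiv))
    (fun _ _ => K0.mk_projective D.induced_projective)

theorem inducedHom_mk (N : FGModuleCat.{u} Γ) :
    D.inducedHom (K0.mk N) = K0.mk (FGModuleCat.of Λ (D.Induced N)) :=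
  K0.lift_mk _ _ _ _

theorem reductionHom_inducedHom (y : K0 Γ) :
    reductionHom D.proj_surjective (D.inducedHom y) = y := by
  have h : (reductionHom D.proj_surjective).comp D.inducedHom = AddMonoidHom.id _ :=
    K0.hom_ext fun N => by
      rw [AddMonoidHom.comp_apply, inducedHom_mk]
      exact reductionHom_mk D.proj_surjective
        (M := FGModuleCat.of Λ (D.Induced N)) D.isReduction_ofInduced
  exact DFunLike.congr_fun h y

variable [IsArtinianRing Γ] [IsArtinianRing Λ]

/-- Induction preserves surjections, projectives and kernels, so it carries a projective
presentation of N to one of the induced module. -/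
theorem syzygyHom_inducedHom (y : K0 Γ) :
    syzygyHom Λ (D.inducedHom y) = D.inducedHom (syzygyHom Γ y) := by
  have h : (syzygyHom Λ).comp D.inducedHom = D.inducedHom.comp (syzygyHom Γ) :=
    K0.hom_ext fun N => by
      have := (isProjectiveCover_map N).projective
      simp only [AddMonoidHom.comp_apply, inducedHom_mk, syzygyHom_mk]
      rw [K0.mk_syzygy (P := FGModuleCat.of Λ (D.Induced (projectiveCover N)))
        (M := FGModuleCat.of Λ (D.Induced N)) (D.inducedMap (projectiveCoverMap N))
        (D.inducedMap_surjective (isProjectiveCover_map N).surjective) D.induced_projective]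
      exact K0.mk_congr
        (M := FGModuleCat.of Λ (LinearMap.ker (D.inducedMap (projectiveCoverMap N))))
        (N := FGModuleCat.of Λ (D.Induced (syzygy N))) (D.kerInducedMapEquiv _)
  exact DFunLike.congr_fun h y

end K0

end GlueData

/-! ### Classes of semisimple modules -/

section Semisimple

variable {R : Type u} [Ring R]

theorem IsIndecomposable.isSimpleModule {N : Type u} [AddCommGroup N] [Module R N]
    [IsSemisimpleModule R N] (h : IsIndecomposable (R := R) N) : IsSimpleModule R N := by
  have := h.1
  have : IsSimpleOrder (Submodule R N) :=
    { eq_bot_or_eq_top := fun p => by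
        obtain ⟨q, hq⟩ := exists_isCompl p
        refine (h.2 p q hq).imp_right ?_
        rintro rfl
        simpa using hq.sup_eq_top }
  exact ⟨⟩

theorem mk_mem_closure_of_isSemisimpleModule [IsArtinianRing R] {V : Type*}
    {S : V → FGModuleCat.{u} R}
    (hS : ∀ M : FGModuleCat.{u} R, IsSimpleModule R M → ∃ v, Nonempty (M ≃ₗ[R] S v))
    (M : FGModuleCat.{u} R) [IsSemisimpleModule R M] :
    K0.mk M ∈ AddSubgroup.closure (Set.range fun v => K0.mk (S v)) := by
  refine (AddSubgroup.closure_le _).2 ?_ (isAdditive_mk.mem_closure M)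
  rintro _ ⟨N, hN, hi, rfl⟩
  obtain ⟨i, p, hip⟩ := hN.exists_retraction
  have : IsSemisimpleModule R N := IsSemisimpleModule.of_injective i
    (Function.LeftInverse.injective hip)
  obtain ⟨v, ⟨e⟩⟩ := hS N hi.isSimpleModule
  exact AddSubgroup.subset_closure ⟨v, (K0.mk_congr e).symm⟩

end Semisimple

/-! ### Kernels annihilated by the radical on the left -/

namespace GlueData

variable {k : Type w} {Γ Λ : Type u} [Field k] [Ring Γ] [Algebra k Γ] [Ring Λ] {J : Type}
  [Fintype J] (D : GlueData k Γ Λ J)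

/-- Independence of the x_j modulo ker proj. In a free module containing `P` as a summand, each
coordinate satisfies the same equation, and `c i` of that equation says that `proj` kills the
coordinate of e_i p_i = p_i. -/
theorem mem_ker_smul_of_sum_eq_zero {P : Type u} [AddCommGroup P] [Module Λ P]
    [Module.Projective Λ P] (p : J → P) (hp : ∀ j, D.incl (D.e j) • p j = p j)
    (h : ∑ j, D.x j • p j = 0) (i : J) :
    p i ∈ RingHom.ker D.proj • (⊤ : Submodule Λ P) := by
  obtain ⟨s, hs⟩ := Module.projective_def'.1 (inferInstance : Module.Projective Λ P)
  have hs' : ∀ y, Finsupp.linearCombination Λ id (s y) = y := fun y => LinearMap.congr_fun hs y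
  rw [← hs' (p i), Finsupp.linearCombination_apply]
  refine sum_mem fun b _ => Submodule.smul_mem_smul ?_ Submodule.mem_top
  have h1 : ∑ j, D.x j * s (p j) b = 0 := by
    have := congrArg (fun y => s y b) h
    simpa [Finsupp.finsetSum_apply] using this
  have h2 := congrArg (D.c i) h1
  rw [D.c_sum, map_zero] at h2
  rw [RingHom.mem_ker]
  have h3 : s (p i) b = D.incl (D.e i) * s (p i) b := by
    conv_lhs => rw [← hp i, map_smul]
    rfl
  rw [h3, map_mul, D.proj_incl, h2]

variable [IsArtinianRing Λ]

theorem isSemisimpleModule_ker_smul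
    (hJ : ∀ j ∈ Ring.jacobson Λ, ∀ i ∈ RingHom.ker D.proj, j * i = 0) (M : Type u)
    [AddCommGroup M] [Module Λ M] :
    IsSemisimpleModule Λ (RingHom.ker D.proj • (⊤ : Submodule Λ M) : Submodule Λ M) := by
  refine isSemisimpleModule_of_jacobson_smul_eq_zero fun r hr m => Subtype.ext ?_
  have : ∀ m ∈ RingHom.ker D.proj • (⊤ : Submodule Λ M), r • m = 0 := by
    intro m hm
    induction hm using Submodule.smul_induction_on' with
    | smul s hs n _ => rw [← mul_smul, hJ r hr s hs, zero_smul]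
    | add x _ y _ hx hy => rw [smul_add, hx, hy, add_zero]
  exact this m m.2

variable [IsArtinianRing Γ]

/-- The syzygy of a `Λ`-module is, up to a semisimple direct summand, induced from the syzygy of its
reduction. -/
theorem exists_mk_syzygy_eq_add
    (hJ : ∀ j ∈ Ring.jacobson Λ, ∀ i ∈ RingHom.ker D.proj, j * i = 0) (M : FGModuleCat.{u} Λ) :
    ∃ S : FGModuleCat.{u} Λ, IsSemisimpleModule Λ S ∧ syzygyHom Λ (K0.mk M) =
      D.inducedHom (syzygyHom Γ (reductionHom D.proj_surjective (K0.mk M))) + K0.mk S := by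
  let hp := D.proj_surjective
  let P := projectiveCover M
  let f : P →ₗ[Λ] M := projectiveCoverMap M
  have hf : Function.Surjective f := (isProjectiveCover_map _).surjective
  have hP : Module.Projective Λ P := (isProjectiveCover_map _).projective
  let q : P →ₛₗ[D.proj] reduction hp P := reductionMap hp P
  have hq : IsReduction q := isReduction_reductionMap hp P
  let qM : M →ₛₗ[D.proj] reduction hp M := reductionMap hp M
  have hqM : IsReduction qM := isReduction_reductionMap hp M
  have hPR := hq.projective hp hP
  obtain ⟨g, hg⟩ := hq.exists_lift hp (qM.comp f)
  have hg' : ∀ x, g (q x) = qM (f x) := hg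
  have hgs : Function.Surjective g := fun y => by
    obtain ⟨m, rfl⟩ := hqM.surjective y
    obtain ⟨x, rfl⟩ := hf m
    exact ⟨_, hg x⟩
  -- A Γ-linear section of the reduction of P exists because that reduction is Γ-projective.
  obtain ⟨s, hs⟩ : ∃ s : reduction hp P →ₛₗ[D.incl] P, ∀ y, q (s y) = y := by
    let _ : Module Γ P := Module.compHom P D.incl
    have hsmul : ∀ (r : Γ) (x : P), r • x = D.incl r • x := fun _ _ => rfl
    let qR : P →ₗ[Γ] reduction hp P :=
      { toFun := q, map_add' := q.map_add
        map_smul' := fun r x => by rw [hsmul, map_smulₛₗ, D.proj_incl, RingHom.id_apply] }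
    obtain ⟨s, hs⟩ := Module.projective_lifting_property qR LinearMap.id hq.surjective
    exact ⟨{ toFun := s, map_add' := s.map_add, map_smul' := fun r x => s.map_smul r x },
      fun y => LinearMap.congr_fun hs y⟩
  let IP : Submodule Λ P := RingHom.ker D.proj • ⊤
  let IM : Submodule Λ M := RingHom.ker D.proj • ⊤
  have hIP : IsSemisimpleModule Λ IP := D.isSemisimpleModule_ker_smul hJ P
  let fI : IP →ₗ[Λ] IM := f.restrict fun x hx => map_mem_ker_smul f hx
  have hfI : Function.Surjective fI := by
    rintro ⟨m, hm⟩
    have : m ∈ Submodule.map f IP := by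
      rw [Submodule.map_smul'', Submodule.map_top, LinearMap.range_eq_top.2 hf]
      exact hm
    obtain ⟨x, hx, rfl⟩ := this
    exact ⟨⟨x, hx⟩, rfl⟩
  -- For w in ker g the element s w need not lie in ker f, but f (s w) lies in IM, where I is ker
  -- proj. A splitting of IP → IM, available because IP is semisimple, removes this error without
  -- changing the reduction of s w.
  obtain ⟨r, hr⟩ := IsSemisimpleModule.lifting_property fI hfI LinearMap.id
  have hr' : ∀ y, f (r y : P) = y := fun y => congrArg Subtype.val (LinearMap.congr_fun hr y)
  have hqr : ∀ y, q (r y : P) = 0 := fun y => apply_eq_zero_of_mem_ker_smul q (r y).2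
  have hfs : ∀ w : LinearMap.ker g, f (s w) ∈ IM := fun w =>
    hqM.mem_of_apply_eq_zero _ (by rw [← hg', hs]; exact w.2)
  let m : LinearMap.ker g →ₛₗ[D.incl] IM :=
    { toFun := fun w => ⟨f (s w), hfs w⟩
      map_add' := fun a b => Subtype.ext (by simp)
      map_smul' := fun c a => Subtype.ext (by simp) }
  let t : LinearMap.ker g →ₛₗ[D.incl] LinearMap.ker f :=
    { toFun := fun w => ⟨s w - r (m w), by
        rw [LinearMap.mem_ker, map_sub, hr']
        exact sub_self _⟩
      map_add' := fun a b => Subtype.ext (by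
        simp only [map_add, Submodule.coe_add]
        abel)
      map_smul' := fun c a => Subtype.ext (by
        simp only [map_smul, Submodule.coe_smul, smul_sub, map_smulₛₗ]) }
  have hqt : ∀ w, q (t w : P) = w := fun w => by
    change q (s w - r (m w)) = w
    rw [map_sub, hs, hqr, sub_zero]
  let T : D.Induced (LinearMap.ker g) →ₗ[Λ] LinearMap.ker f := D.inducedLift t
  have hT : ∀ w, (T w : P) = t w.1 + ∑ j, D.x j • (t (w.2.1 j) : P) := fun w => by
    simp [T, D.inducedLift_apply]
  have hqT : ∀ w, q (T w : P) = (w.1 : reduction hp P) := fun w => by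
    rw [hT, map_add, hqt, map_sum]
    simp [D.proj_x]
  -- Reduction gives w.1 = 0. Independence of the x_j then puts each t (w_j) in IP, so its reduction
  -- w_j vanishes as well.
  have hTinj : Function.Injective T := by
    refine (injective_iff_map_eq_zero _).2 fun w hw => ?_
    have h1 : w.1 = 0 := Subtype.ext (by rw [← hqT, hw]; exact map_zero q)
    have h2 : ∑ j, D.x j • (t (w.2.1 j) : P) = 0 := by
      have := hT w
      rw [hw, h1, map_zero] at this
      simpa using this.symm
    refine Induced.ext D h1 fun j => Subtype.ext ?_
    have h3 := D.mem_ker_smul_of_sum_eq_zero (fun j => (t (w.2.1 j) : P)) (fun j => by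
      have := t.map_smulₛₗ (D.e j) (w.2.1 j)
      rw [Induced.e_smul] at this
      exact (congrArg Subtype.val this).symm) h2 j
    rw [← hqt]
    exact apply_eq_zero_of_mem_ker_smul q h3
  let K : Submodule Λ (LinearMap.ker f) := IP.comap (LinearMap.ker f).subtype
  have hK : IsSemisimpleModule Λ K := by
    let i : K →ₗ[Λ] IP := ((LinearMap.ker f).subtype.comp K.subtype).codRestrict IP fun x => x.2
    exact IsSemisimpleModule.of_injective i fun x y h =>
      Subtype.ext (Subtype.ext (congrArg (fun z : IP => (z : P)) h))
  -- The syzygy is the sum of the range of `T` and K, its intersection with IP. As K is semisimple,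
  -- a complement inside K of the part of K lying in the range is a complement of the range itself.
  obtain ⟨C', hC'⟩ := exists_isCompl ((LinearMap.range T).comap K.subtype)
  let C : Submodule Λ (LinearMap.ker f) := C'.map K.subtype
  have hCs : IsSemisimpleModule Λ C :=
    IsSemisimpleModule.of_injective (Submodule.inclusion (Submodule.map_subtype_le K C'))
      (Submodule.inclusion_injective _)
  have hcompl : IsCompl (LinearMap.range T) C := by
    rw [isCompl_iff, Submodule.disjoint_def, codisjoint_iff, eq_top_iff]
    constructor
    · rintro x hx ⟨y, hy, rfl⟩
      have := Submodule.disjoint_def.1 hC'.disjoint y hx hy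
      rw [this, map_zero]
    · rintro x -
      have hx0 : g (q x) = 0 := by
        rw [hg', LinearMap.mem_ker.1 x.2, map_zero]
      let y : LinearMap.ker f := T (D.toInduced _ ⟨q x, hx0⟩)
      have hy : q (y : P) = q x := by
        rw [hqT]
        rfl
      have hxy : x - y ∈ K := hq.mem_of_apply_eq_zero _ (by
        rw [Submodule.subtype_apply, Submodule.coe_sub, map_sub, hy, sub_self])
      have h1 : (⟨x - y, hxy⟩ : K) ∈ (LinearMap.range T).comap K.subtype ⊔ C' := by
        rw [hC'.sup_eq_top]
        exact Submodule.mem_top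
      obtain ⟨a, ha, b, hb, hab⟩ := Submodule.mem_sup.1 h1
      have h2 : x = (y + a) + b := by
        have := congrArg Subtype.val hab
        rw [add_assoc]
        exact (eq_add_of_sub_eq' this.symm)
      rw [h2]
      exact Submodule.add_mem_sup (Submodule.add_mem _ ⟨_, rfl⟩ ha) ⟨b, hb, rfl⟩
  refine ⟨FGModuleCat.of Λ C, hCs, ?_⟩
  have h1 : syzygyHom Γ (reductionHom hp (K0.mk M)) =
      K0.mk (FGModuleCat.of Γ (LinearMap.ker g)) := by
    rw [reductionHom_mk hp hqM, syzygyHom_mk]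
    exact K0.mk_syzygy (P := reduction hp P) g hgs hPR
  rw [h1, inducedHom_mk, syzygyHom_mk]
  let e : LinearMap.ker f ≃ₗ[Λ] (D.Induced (LinearMap.ker g) × C) :=
    (Submodule.prodEquivOfIsCompl _ _ hcompl).symm.trans
      (LinearEquiv.prodCongr (LinearEquiv.ofInjective T hTinj).symm (LinearEquiv.refl Λ C))
  exact K0.mk_eq_add (M := syzygy M) (M' := FGModuleCat.of Λ (D.Induced (LinearMap.ker g)))
    (M'' := FGModuleCat.of Λ C) e

/-- The case of an ideal annihilated on the left by the radical. -/
theorem leftPhiDim_le [Algebra k Λ] [Module.Finite k Λ]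
    (hJ : ∀ j ∈ Ring.jacobson Λ, ∀ i ∈ RingHom.ker D.proj, j * i = 0)
    {V : Type*} [Fintype V] (hV : HasSimplesIndexedBy Λ V) :
    leftPhiDim Γ ≤ leftPhiDim Λ ∧ leftPhiDim Λ ≤ leftPhiDim Γ + Fintype.card V + 1 := by
  obtain ⟨S, hS⟩ := hV
  have hrj := D.reductionHom_inducedHom
  constructor
  · refine le_of_forall_natCast_le fun d hd => ?_
    rw [leftPhiDim_le_iff_kerStable] at hd ⊢
    exact KerStable.of_injective _ _ D.inducedHom D.syzygyHom_inducedHom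
      (fun y hy => by rw [← hrj y, hy, map_zero]) hd
  · have hg : ∀ x, syzygyHom Λ x -
        D.inducedHom (syzygyHom Γ (reductionHom D.proj_surjective x)) ∈
          AddSubgroup.closure (Set.range fun v => K0.mk (S v)) := by
      intro x
      obtain ⟨M, N, rfl⟩ := K0.exists_eq_sub x
      obtain ⟨C, hC, h⟩ := D.exists_mk_syzygy_eq_add hJ M
      obtain ⟨C', hC', h'⟩ := D.exists_mk_syzygy_eq_add hJ N
      have : syzygyHom Λ (K0.mk M - K0.mk N) - D.inducedHom (syzygyHom Γ
          (reductionHom D.proj_surjective (K0.mk M - K0.mk N))) = K0.mk C - K0.mk C' := by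
        rw [map_sub, map_sub, map_sub, map_sub, h, h']
        abel
      rw [this]
      exact sub_mem (mk_mem_closure_of_isSemisimpleModule hS C)
        (mk_mem_closure_of_isSemisimpleModule hS C')
    generalize hd : leftPhiDim Γ = d
    induction d using ENat.recTopCoe with
    | top => simp
    | coe d =>
      have h := (leftPhiDim_le_iff_kerStable d).1 hd.le
      have := (leftPhiDim_le_iff_kerStable (d + Fintype.card V + 1)).2
        (KerStable.of_section (syzygyHom Λ) _ _ D.inducedHom D.syzygyHom_inducedHom hrj
          (fun c x hc hx => K0.eq_zero_of_zsmul_eq_zero k hc hx) _ hg h)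
      exact_mod_cast this

end GlueData

/-! ### Split basic rings -/

section Characters

variable {k : Type w} [Field k] {R : Type u} [Ring R]

/-- If χ x ≠ 0, then some y makes χ (y x) = -1, so y x + 1 has no left inverse. -/
theorem apply_eq_zero_of_mem_jacobson (χ : R →+* k) (hχ : Function.Surjective χ) {x : R}
    (hx : x ∈ Ring.jacobson R) : χ x = 0 := by
  by_contra h
  obtain ⟨y, hy⟩ := hχ (-(χ x)⁻¹)
  rw [← Ideal.jacobson_bot] at hx
  obtain ⟨z, hz⟩ := Ideal.mem_jacobson_iff.1 hx y
  have := congrArg χ (Ideal.mem_bot.1 hz)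
  rw [map_sub, map_add, map_mul, map_mul, hy, map_one, map_zero] at this
  field_simp at this
  simp at this

/-- `R` is basic and split: the characters `χ v` are surjective, with common kernel a nil ideal,
and there are elements `ε v` with sum `1` such that `χ u (ε v) = 0` for `u ≠ v`. -/
structure IsSplitBasic {V : Type*} [Fintype V] (χ : V → R →+* k) (ε : V → R) : Prop where
  surjective : ∀ v, Function.Surjective (χ v)
  apply_of_ne : ∀ u v, u ≠ v → χ u (ε v) = 0
  sum_eq_one : ∑ v, ε v = 1
  isNilpotent : ∀ r, (∀ v, χ v r = 0) → IsNilpotent r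

namespace IsSplitBasic

variable {V : Type*} [Fintype V] {χ : V → R →+* k} {ε : V → R}

/-- On a simple module M the common kernel of the characters acts by zero: r m ≠ 0 would give s r m
= m for some s, although s r is nilpotent. Some ε_v m is nonzero because the ε_v sum to 1. Its
annihilator is ker χ_v, so M ≅ R / ker χ_v. -/
theorem hasSimplesIndexedBy (h : IsSplitBasic χ ε) : HasSimplesIndexedBy R V := by
  refine ⟨fun v => FGModuleCat.of R (R ⧸ RingHom.ker (χ v)), fun M hM => ?_⟩
  have := IsSimpleModule.nontrivial R M
  have hnil : ∀ r, (∀ v, χ v r = 0) → ∀ m : M, r • m = 0 := by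
    intro r hr m
    by_contra hm
    obtain ⟨s, hs⟩ := IsSimpleModule.toSpanSingleton_surjective R hm m
    rw [LinearMap.toSpanSingleton_apply, smul_smul] at hs
    obtain ⟨n, hn⟩ := h.isNilpotent (s * r) fun v => by rw [map_mul, hr, mul_zero]
    have hpow : ∀ i : ℕ, (s * r) ^ i • m = m := fun i => by
      induction i with
      | zero => rw [pow_zero, one_smul]
      | succ i ih => rw [pow_succ, mul_smul, hs, ih]
    refine hm ?_
    rw [← hpow n, hn, zero_smul, smul_zero]
  obtain ⟨m, hm⟩ := exists_ne (0 : M)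
  obtain ⟨v, hv⟩ : ∃ v, ε v • m ≠ 0 := by
    by_contra! hcon
    refine hm ?_
    rw [← one_smul R m, ← h.sum_eq_one, Finset.sum_smul]
    exact Finset.sum_eq_zero fun v _ => hcon v
  have hker : ∀ r, χ v r = 0 → r • ε v • m = 0 := by
    intro r hr
    rw [smul_smul]
    refine hnil _ (fun u => ?_) m
    rcases eq_or_ne u v with rfl | huv
    · rw [map_mul, hr, zero_mul]
    · rw [map_mul, h.apply_of_ne u v huv, mul_zero]
  refine ⟨v, ⟨((Submodule.quotEquivOfEq _ _ (Submodule.ext fun r => ?_)).trans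
    (LinearMap.quotKerEquivOfSurjective _
      (IsSimpleModule.toSpanSingleton_surjective R hv))).symm⟩⟩
  rw [LinearMap.mem_ker, LinearMap.toSpanSingleton_apply]
  refine ⟨hker r, fun hr => RingHom.mem_ker.2 ?_⟩
  by_contra hne
  obtain ⟨s, hs⟩ := h.surjective v (χ v r)⁻¹
  have := hker (1 - s * r) (by rw [map_sub, map_mul, hs, map_one, inv_mul_cancel₀ hne, sub_self])
  rw [sub_smul, one_smul, mul_smul, hr, smul_zero, sub_zero] at this
  exact hv this

theorem op (h : IsSplitBasic χ ε) :
    IsSplitBasic (fun v => (χ v).fromOpposite fun _ _ => Commute.all _ _)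
      fun v => MulOpposite.op (ε v) where
  surjective v a := by
    obtain ⟨r, hr⟩ := h.surjective v a
    exact ⟨MulOpposite.op r, hr⟩
  apply_of_ne := h.apply_of_ne
  sum_eq_one := by rw [← Finset.op_sum, h.sum_eq_one, MulOpposite.op_one]
  isNilpotent r hr := by
    obtain ⟨n, hn⟩ := h.isNilpotent r.unop hr
    exact ⟨n, MulOpposite.unop_injective (by rw [MulOpposite.unop_pow, hn]; rfl)⟩

theorem prod {R' : Type*} [Ring R'] {V' : Type*} [Fintype V'] {χ' : V' → R' →+* k} {ε' : V' → R'}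
    (h : IsSplitBasic χ ε) (h' : IsSplitBasic χ' ε') :
    IsSplitBasic (Sum.elim (fun v => (χ v).comp (RingHom.fst R R'))
      fun v => (χ' v).comp (RingHom.snd R R'))
      (Sum.elim (fun v => (ε v, 0)) fun v => (0, ε' v)) where
  surjective := by
    rintro (v | v) a
    · obtain ⟨r, hr⟩ := h.surjective v a
      exact ⟨(r, 0), hr⟩
    · obtain ⟨r, hr⟩ := h'.surjective v a
      exact ⟨(0, r), hr⟩
  apply_of_ne := by
    rintro (u | u) (v | v) huv
    · exact h.apply_of_ne u v fun h => huv (congrArg _ h)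
    · exact map_zero (χ u)
    · exact map_zero (χ' u)
    · exact h'.apply_of_ne u v fun h => huv (congrArg _ h)
  sum_eq_one := by
    rw [Fintype.sum_sum_type]
    ext <;> simp [Prod.fst_sum, Prod.snd_sum, h.sum_eq_one, h'.sum_eq_one]
  isNilpotent := by
    rintro ⟨r, r'⟩ hr
    obtain ⟨n, hn⟩ := h.isNilpotent r fun v => hr (Sum.inl v)
    obtain ⟨n', hn'⟩ := h'.isNilpotent r' fun v => hr (Sum.inr v)
    refine ⟨n + n', ?_⟩
    ext
    · simp [pow_add, hn]
    · simp [pow_add, hn']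

end IsSplitBasic

end Characters

/-! ### The two bounds for left and for right modules -/

namespace GlueData

variable {k : Type w} {Γ Λ : Type u} [Field k] [Ring Γ] [Algebra k Γ] [Ring Λ] {J : Type}
  [Fintype J] (D : GlueData k Γ Λ J)

/-- Moving a across x_j turns it into the scalar χ_j(a), which vanishes for a in the radical. -/
theorem mul_eq_zero_of_mem_jacobson (hχ : ∀ j, Function.Surjective (D.χ j)) :
    ∀ a ∈ Ring.jacobson Λ, ∀ i ∈ RingHom.ker D.proj, a * i = 0 := by
  intro a ha i hi
  rw [D.expand i, (RingHom.mem_ker).1 hi, map_zero, zero_add, Finset.mul_sum]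
  refine Finset.sum_eq_zero fun j _ => ?_
  have := apply_eq_zero_of_mem_jacobson ((D.χ j).comp D.proj)
    ((hχ j).comp D.proj_surjective) ha
  rw [← mul_assoc, D.mul_x, ← RingHom.comp_apply (D.χ j), this, map_zero, map_zero, mul_zero,
    zero_mul]

theorem mul_eq_zero_of_mem_jacobson_op (hχ : ∀ j, Function.Surjective (D.χ j)) :
    ∀ i ∈ RingHom.ker (RingHom.op D.proj), ∀ a ∈ Ring.jacobson Λᵐᵒᵖ, i * a = 0 := by
  intro i hi a ha
  have hi' : D.proj i.unop = 0 := congrArg MulOpposite.unop hi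
  refine MulOpposite.unop_injective ?_
  rw [MulOpposite.unop_mul, MulOpposite.unop_zero]
  rw [D.expand i.unop, hi', map_zero, zero_add, Finset.mul_sum]
  refine Finset.sum_eq_zero fun j _ => ?_
  have := apply_eq_zero_of_mem_jacobson
    (((D.χ j).comp D.proj).fromOpposite fun _ _ => Commute.all _ _) (fun b => by
      obtain ⟨r, hr⟩ := ((hχ j).comp D.proj_surjective) b
      exact ⟨MulOpposite.op r, hr⟩) ha
  have h0 : D.χ j (D.proj a.unop) = 0 := this
  rw [← mul_assoc, D.mul_x, h0, map_zero, map_zero, mul_zero, zero_mul]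

/-- By `expand`, the right Γ-module Λ is a summand of Γ ⊕ Γ^J, with `proj` and the coordinates `c j`
as the embedding. -/
theorem projective_op :
    @Module.Projective Γᵐᵒᵖ _ Λᵐᵒᵖ _ (Module.compHom Λᵐᵒᵖ (RingHom.op D.incl)) := by
  let _ : Module Γᵐᵒᵖ Λᵐᵒᵖ := Module.compHom Λᵐᵒᵖ (RingHom.op D.incl)
  have hsmul : ∀ (g : Γᵐᵒᵖ) (a : Λᵐᵒᵖ), g • a = MulOpposite.op (a.unop * D.incl g.unop) :=
    fun _ _ => rfl
  let i : Λᵐᵒᵖ →ₗ[Γᵐᵒᵖ] (Γᵐᵒᵖ × (J → Γᵐᵒᵖ)) :=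
    { toFun := fun a => (MulOpposite.op (D.proj a.unop), fun j => MulOpposite.op (D.c j a.unop))
      map_add' := fun a b => by ext <;> simp
      map_smul' := fun g a => by
        rw [hsmul]
        ext j
        · simp [D.proj_incl]
        · simp [D.c_mul_incl] }
  let r : (Γᵐᵒᵖ × (J → Γᵐᵒᵖ)) →ₗ[Γᵐᵒᵖ] Λᵐᵒᵖ :=
    { toFun := fun z => MulOpposite.op (D.incl z.1.unop + ∑ j, D.x j * D.incl (z.2 j).unop)
      map_add' := fun a b => by
        refine MulOpposite.unop_injective ?_
        simp only [Prod.fst_add, Prod.snd_add, Pi.add_apply, MulOpposite.unop_add, map_add,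
          mul_add, Finset.sum_add_distrib, MulOpposite.unop_op]
        abel
      map_smul' := fun g a => by
        refine MulOpposite.unop_injective ?_
        simp [hsmul, add_mul, Finset.sum_mul, mul_assoc] }
  exact Module.Projective.of_split i r (LinearMap.ext fun a =>
    MulOpposite.unop_injective (D.expand a.unop).symm)

/-- The kernel of `proj` squares to zero by `c_mul`, so nilpotency lifts from Γ to Λ at the cost of
doubling the exponent. -/
theorem isSplitBasic {V : Type*} [Fintype V] {χ : V → Γ →+* k} {ε : V → Γ}
    (h : IsSplitBasic χ ε) :
    IsSplitBasic (fun v => (χ v).comp D.proj) fun v => D.incl (ε v) where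
  surjective v := (h.surjective v).comp D.proj_surjective
  apply_of_ne u v huv := by rw [RingHom.comp_apply, D.proj_incl, h.apply_of_ne u v huv]
  sum_eq_one := by rw [← map_sum, h.sum_eq_one, map_one]
  isNilpotent a ha := by
    obtain ⟨n, hn⟩ := h.isNilpotent (D.proj a) ha
    have hz : D.proj (a ^ n) = 0 := by rw [map_pow, hn]
    refine ⟨n + n, ?_⟩
    rw [pow_add, D.expand (a ^ n * a ^ n), map_mul, hz, zero_mul, map_zero, zero_add]
    refine Finset.sum_eq_zero fun j _ => ?_
    rw [D.c_mul, hz, map_zero, map_zero, zero_mul, mul_zero, zero_add, map_zero, mul_zero]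

variable [Algebra k Λ] [Module.Finite k Λ]

theorem leftPhiDim_bounds [IsArtinianRing Γ] [IsArtinianRing Λ]
    (hχ : ∀ j, Function.Surjective (D.χ j)) {V : Type*} [Fintype V]
    {χ : V → Γ →+* k} {ε : V → Γ} (h : IsSplitBasic χ ε) :
    leftPhiDim Γ ≤ leftPhiDim Λ ∧ leftPhiDim Λ ≤ leftPhiDim Γ + Fintype.card V + 1 :=
  D.leftPhiDim_le (D.mul_eq_zero_of_mem_jacobson hχ) (D.isSplitBasic h).hasSimplesIndexedBy

/-- Over the opposite rings, rad · I = 0 reads I · rad = 0. The count here is of the simples of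
Γᵐᵒᵖ, which index its indecomposable projectives, whereas `leftPhiDim_bounds` counts the simples of
Λ. -/
theorem leftPhiDim_op_bounds [Module.Finite k Γ] [IsArtinianRing Γᵐᵒᵖ] [IsArtinianRing Λᵐᵒᵖ]
    (hχ : ∀ j, Function.Surjective (D.χ j)) {V : Type*} [Fintype V]
    {χ : V → Γ →+* k} {ε : V → Γ} (h : IsSplitBasic χ ε) :
    leftPhiDim Γᵐᵒᵖ ≤ leftPhiDim Λᵐᵒᵖ ∧
      leftPhiDim Λᵐᵒᵖ ≤ leftPhiDim Γᵐᵒᵖ + Fintype.card V + 1 :=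
  leftPhiDim_le_of_ker_mul_jacobson k (p := RingHom.op D.proj)
    (fun g => ⟨MulOpposite.op (D.incl g.unop), MulOpposite.unop_injective (D.proj_incl _)⟩)
    (RingHom.op D.incl) (fun _ => MulOpposite.unop_injective (D.proj_incl _)) D.projective_op
    (D.mul_eq_zero_of_mem_jacobson_op hχ) h.op.hasSimplesIndexedBy

end GlueData

end IgusaTodorov

/-! ### Homomorphisms from path algebras -/

namespace PathAlgebra

section Lift

variable {k : Type w} [Field k] {V : Type u} [Quiver.{v} V]

/-- A representation of a quiver in an algebra: orthogonal idempotents `E` with sum `1`, and an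
element `F e` with `E a * F e * E b = F e` for every arrow `e : a → b`. -/
structure QuiverRep (V : Type u) [Quiver.{v} V] [Fintype V] (S : Type*) [Ring S] where
  E : V → S
  F : ∀ {a b : V}, (a ⟶ b) → S
  E_mul_self : ∀ a, E a * E a = E a
  E_mul_of_ne : ∀ a b, a ≠ b → E a * E b = 0
  sum_E : ∑ a, E a = 1
  E_mul_F : ∀ {a b : V} (e : a ⟶ b), E a * F e = F e
  F_mul_E : ∀ {a b : V} (e : a ⟶ b), F e * E b = F e

variable [Fintype V] {S : Type*} [Ring S] (ρ : QuiverRep V S)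

namespace QuiverRep

/-- The value of a representation at a path. -/
def path {a : V} : ∀ {b : V}, Quiver.Path a b → S
  | _, .nil => ρ.E a
  | _, .cons p e => path p * ρ.F e

theorem E_mul_path {a b : V} (p : Quiver.Path a b) : ρ.E a * ρ.path p = ρ.path p := by
  induction p with
  | nil => exact ρ.E_mul_self a
  | cons p e ih => rw [path, ← mul_assoc, ih]

theorem path_mul_E {a b : V} (p : Quiver.Path a b) : ρ.path p * ρ.E b = ρ.path p := by
  cases p with
  | nil => exact ρ.E_mul_self a
  | cons p e => rw [path, mul_assoc, ρ.F_mul_E]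

theorem path_comp {a b c : V} (p : Quiver.Path a b) (q : Quiver.Path b c) :
    ρ.path (p.comp q) = ρ.path p * ρ.path q := by
  induction q with
  | nil => exact (ρ.path_mul_E p).symm
  | cons q e ih => rw [Quiver.Path.comp_cons, path, ih, path, mul_assoc]

end QuiverRep

variable [Algebra k S]

variable (k) in
/-- The algebra homomorphism `kQ → S` defined by a representation of `Q` in `S`. -/
noncomputable def lift : PathAlgebra k V →ₐ[k] S :=
  AlgHom.ofLinearMap ((basis k V).constr k fun p => ρ.path p.2.2)
    (by
      rw [one_def, map_sum, ← ρ.sum_E]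
      refine Finset.sum_congr rfl fun a _ => ?_
      rw [ofPath, Module.Basis.constr_basis]
      rfl)
    (fun x y => by
      induction x using induction_path with
      | zero => simp
      | add _ _ h1 h2 => simp only [add_mul, map_add, h1, h2]
      | smul _ _ h => simp only [smul_mul_assoc, map_smul, h]
      | path a b p =>
        induction y using induction_path with
        | zero => simp
        | add _ _ h1 h2 => simp only [mul_add, map_add, h1, h2]
        | smul _ _ h => simp only [mul_smul_comm, map_smul, h]
        | path c d q =>
          by_cases h : b = c
          · subst h
            rw [ofPath_mul_ofPath]
            simp only [ofPath, Module.Basis.constr_basis, ρ.path_comp]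
          · rw [ofPath_mul_ofPath_of_ne _ _ h, map_zero]
            simp only [ofPath, Module.Basis.constr_basis]
            rw [← ρ.path_mul_E p, ← ρ.E_mul_path q, mul_assoc, ← mul_assoc (ρ.E b),
              ρ.E_mul_of_ne _ _ h, zero_mul, mul_zero])

theorem lift_ofPath {a b : V} (p : Quiver.Path a b) : lift k ρ (ofPath k p) = ρ.path p := by
  refine ((basis k V).constr_basis k _ _)

theorem lift_nil (a : V) : lift k ρ (ofPath k (Quiver.Path.nil : Quiver.Path a a)) = ρ.E a :=
  lift_ofPath ρ _

theorem lift_arrow {a b : V} (e : a ⟶ b) : lift k ρ (arrow k e) = ρ.F e :=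
  (lift_ofPath ρ _).trans (ρ.E_mul_F e)

/-- Induction on elements of a path algebra via vertices and arrows. -/
theorem induction_arrow {P : PathAlgebra k V → Prop} (x : PathAlgebra k V)
    (zero : P 0) (add : ∀ x y, P x → P y → P (x + y)) (smul : ∀ (c : k) x, P x → P (c • x))
    (mul : ∀ x y, P x → P y → P (x * y))
    (nil : ∀ a : V, P (ofPath k (Quiver.Path.nil : Quiver.Path a a)))
    (arr : ∀ (a b : V) (e : a ⟶ b), P (arrow k e)) : P x := by
  induction x using induction_path with
  | zero => exact zero
  | add x y hx hy => exact add x y hx hy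
  | smul c x hx => exact smul c x hx
  | path a b p =>
    induction p with
    | nil => exact nil a
    | cons p e ih =>
      rw [GluedQuiver.ofPath_cons]
      exact mul _ _ ih (arr _ _ e)

end Lift

/-! ### Characters at the vertices -/

section Characters

variable {k : Type w} [Field k] {V : Type u} [Quiver.{v} V] [Fintype V]

open Classical in
variable (k) in
/-- The one-dimensional representation at the vertex `v`. -/
noncomputable def vertexRep (v : V) : QuiverRep V k where
  E a := if v = a then 1 else 0
  F _ := 0
  E_mul_self a := by split <;> simp
  E_mul_of_ne a b h := by
    by_cases ha : v = a
    · rw [if_neg fun hb : v = b => h (ha.symm.trans hb), mul_zero]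
    · rw [if_neg ha, zero_mul]
  sum_E := by simp
  E_mul_F _ := mul_zero _
  F_mul_E _ := zero_mul _

theorem lift_vertexRep_self (v : V) :
    lift k (vertexRep k v) (ofPath k (Quiver.Path.nil : Quiver.Path v v)) = 1 :=
  (lift_nil _ _).trans (if_pos rfl)

theorem lift_vertexRep_of_ne {v a : V} (h : v ≠ a) :
    lift k (vertexRep k v) (ofPath k (Quiver.Path.nil : Quiver.Path a a)) = 0 :=
  (lift_nil _ _).trans (if_neg h)

theorem lift_vertexRep_arrow (v : V) {a b : V} (e : a ⟶ b) :
    lift k (vertexRep k v) (arrow k e) = 0 :=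
  lift_arrow _ _

theorem arrow_mem_arrowIdeal {a b : V} (e : a ⟶ b) : arrow k e ∈ arrowIdeal k V :=
  TwoSidedIdeal.subset_span ⟨a, b, e, rfl⟩

/-- The vertex character kills all arrows, and I ⊆ J² ⊆ J. -/
theorem lift_vertexRep_eq_zero {I : TwoSidedIdeal (PathAlgebra k V)} (hI : IsAdmissible I) (v : V)
    {z : PathAlgebra k V} (hz : z ∈ I) : lift k (vertexRep k v) z = 0 := by
  have h1 : z ∈ arrowIdeal k V :=
    TwoSidedIdeal.mem_asIdeal.1 (Ideal.pow_le_self two_ne_zero (hI.1 (TwoSidedIdeal.mem_asIdeal.2 hz)))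
  have h2 : arrowIdeal k V ≤ TwoSidedIdeal.ker (lift k (vertexRep k v)) :=
    TwoSidedIdeal.span_le.2 (by
      rintro _ ⟨a, b, e, rfl⟩
      exact (TwoSidedIdeal.mem_ker _).2 (lift_vertexRep_arrow v e))
  exact (TwoSidedIdeal.mem_ker _).1 (h2 h1)

/-- Paths of positive length lie in J, so modulo J only the trivial paths remain, with the vertex
characters as coefficients. Hence the common kernel of these characters lies in J. -/
theorem sub_sum_mem_arrowIdeal (z : PathAlgebra k V) :
    z - ∑ v, lift k (vertexRep k v) z • ofPath k (Quiver.Path.nil : Quiver.Path v v) ∈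
      arrowIdeal k V := by
  induction z using induction_path with
  | zero => simp [zero_mem]
  | add x y hx hy =>
    simp only [map_add, add_smul, Finset.sum_add_distrib]
    rw [add_sub_add_comm]
    exact add_mem hx hy
  | smul c x hx =>
    simp only [map_smul, smul_assoc, ← Finset.smul_sum, ← smul_sub]
    rw [← one_mul (x - _), ← smul_mul_assoc]
    exact TwoSidedIdeal.mul_mem_left _ _ _ hx
  | path a b p =>
    cases p with
    | nil =>
      rw [Finset.sum_eq_single a (fun v _ hv => by rw [lift_vertexRep_of_ne hv, zero_smul])
        (fun h => absurd (Finset.mem_univ a) h), lift_vertexRep_self, one_smul, sub_self]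
      exact zero_mem _
    | cons p e =>
      rw [GluedQuiver.ofPath_cons, Finset.sum_eq_zero fun v _ => by
        rw [map_mul, lift_vertexRep_arrow, mul_zero, zero_smul], sub_zero]
      exact TwoSidedIdeal.mul_mem_left _ _ _ (arrow_mem_arrowIdeal e)

end Characters

end PathAlgebra

/-! ### Bound quiver algebras are split basic -/

namespace BoundQuiverAlgebra

open PathAlgebra IgusaTodorov

variable {k : Type w} [Field k] {V : Type u} [Quiver.{v} V] [Fintype V]

/-- The projection of the path algebra to a bound quiver algebra. -/
noncomputable def mk (I : TwoSidedIdeal (PathAlgebra k V)) :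
    PathAlgebra k V →ₐ[k] BoundQuiverAlgebra I :=
  I.ringCon.mkₐ k

variable {I : TwoSidedIdeal (PathAlgebra k V)}

theorem mk_surjective : Function.Surjective (mk I) := I.ringCon.mk'_surjective

theorem mk_eq_zero {z : PathAlgebra k V} : mk I z = 0 ↔ z ∈ I :=
  GluedQuiver.mk_eq_zero_iff I z

/-- The descent of a homomorphism of algebras to a bound quiver algebra. -/
noncomputable def desc {S : Type*} [Ring S] [Algebra k S] (f : PathAlgebra k V →ₐ[k] S)
    (hf : ∀ z ∈ I, f z = 0) : BoundQuiverAlgebra I →ₐ[k] S :=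
  I.ringCon.liftₐ f fun x y h => by
    have := hf _ ((TwoSidedIdeal.rel_iff I x y).1 h)
    rw [map_sub, sub_eq_zero] at this
    exact this

/-- The trivial path at `v`. -/
noncomputable def vertex (I : TwoSidedIdeal (PathAlgebra k V)) (v : V) : BoundQuiverAlgebra I :=
  mk I (ofPath k (Quiver.Path.nil : Quiver.Path v v))

/-- The character of a bound quiver algebra at the vertex `v`. -/
noncomputable def character (hI : IsAdmissible I) (v : V) : BoundQuiverAlgebra I →ₐ[k] k :=
  desc (lift k (vertexRep k v)) fun _ => lift_vertexRep_eq_zero hI v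

theorem character_surjective (hI : IsAdmissible I) (v : V) :
    Function.Surjective (character hI v) := fun c =>
  ⟨algebraMap k _ c, (character hI v).commutes c⟩

/-- An element killed by all the characters comes from J, and J^m ⊆ I makes it nilpotent. -/
theorem isSplitBasic (hI : IsAdmissible I) :
    IsSplitBasic (fun v => (character hI v : BoundQuiverAlgebra I →+* k)) (vertex I) where
  surjective := character_surjective hI
  apply_of_ne _ _ h := lift_vertexRep_of_ne h
  sum_eq_one := by
    rw [← map_one (mk I), one_def, map_sum]
    rfl
  isNilpotent r hr := by
    obtain ⟨z, rfl⟩ := mk_surjective r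
    have hz : ∀ v, lift k (vertexRep k v) z = 0 := hr
    have h := sub_sum_mem_arrowIdeal z
    simp only [hz, zero_smul, Finset.sum_const_zero, sub_zero] at h
    obtain ⟨m, -, hm⟩ := hI.2
    refine ⟨m, ?_⟩
    rw [← map_pow, mk_eq_zero]
    exact TwoSidedIdeal.mem_asIdeal.1
      (hm (Ideal.pow_mem_pow (TwoSidedIdeal.mem_asIdeal.2 h) m))

end BoundQuiverAlgebra

/-! ### Functoriality of path algebras and triangular representations -/

namespace PathAlgebra

variable {k : Type w} [Field k] {V V' : Type u} [Quiver.{v} V] [Quiver.{v} V']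

/-- Injectivity on vertices keeps non-composable paths non-composable. -/
theorem map_mul_of_injective {F : V ⥤q V'} (hF : Function.Injective F.obj)
    (x y : PathAlgebra k V) : map k F (x * y) = map k F x * map k F y := by
  induction x using induction_path with
  | zero => simp only [PathAlgebra.zero_mul', map_zero]
  | add _ _ h1 h2 => simp only [PathAlgebra.add_mul', map_add, h1, h2]
  | smul _ _ h => simp only [PathAlgebra.smul_mul', map_smul, h]
  | path a b p =>
    induction y using induction_path with
    | zero => simp only [PathAlgebra.mul_zero', map_zero]
    | add _ _ h1 h2 => simp only [PathAlgebra.mul_add', map_add, h1, h2]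
    | smul _ _ h => simp only [PathAlgebra.mul_smul', map_smul, h]
    | path c d q =>
      by_cases h : b = c
      · subst h
        simp only [ofPath_mul_ofPath, map_ofPath, Prefunctor.mapPath_comp]
      · rw [ofPath_mul_ofPath_of_ne _ _ h, map_zero, map_ofPath, map_ofPath,
          ofPath_mul_ofPath_of_ne _ _ fun h' => h (hF h')]

theorem map_mul_map_eq_zero {W : Type u} [Quiver.{v} W] {F : V ⥤q W} {F' : V' ⥤q W}
    (h : ∀ a b, F.obj a ≠ F'.obj b) (x : PathAlgebra k V) (y : PathAlgebra k V') :
    map k F x * map k F' y = 0 := by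
  induction x using induction_path with
  | zero => simp only [map_zero, PathAlgebra.zero_mul']
  | add _ _ h1 h2 => simp only [map_add, PathAlgebra.add_mul', h1, h2, add_zero]
  | smul _ _ h => simp only [map_smul, PathAlgebra.smul_mul', h, smul_zero]
  | path a b p =>
    induction y using induction_path with
    | zero => simp only [map_zero, PathAlgebra.mul_zero']
    | add _ _ h1 h2 => simp only [map_add, PathAlgebra.mul_add', h1, h2, add_zero]
    | smul _ _ h => simp only [map_smul, PathAlgebra.mul_smul', h, smul_zero]
    | path c d q =>
      rw [map_ofPath, map_ofPath, ofPath_mul_ofPath_of_ne _ _ (h _ _)]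

section Triangular

variable {V : Type u} [Quiver.{v} V] [Fintype V] {S : Type*} [Ring S]

/-- The corner entry obeys a Leibniz rule; this is the source of `c_mul` for the coordinates on C.
-/
theorem triangular_mul (a c d a' c' d' : S) : (!![a, c; 0, d] * !![a', c'; 0, d'] : Matrix _ _ S) =
    !![a * a', a * c' + c * d'; 0, d * d'] := by
  rw [Matrix.mul_fin_two]
  simp

/-- The triangular representation defined by a representation `ρ`, an endomorphism `τ` and a family
of elements `c` with `τ (E a) * c e * E b = c e`. -/
def QuiverRep.triangular (ρ : QuiverRep V S) (τ : S →+* S) (c : ∀ {a b : V}, (a ⟶ b) → S)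
    (hτ : ∀ {a b : V} (e : a ⟶ b), τ (ρ.E a) * c e = c e)
    (hc : ∀ {a b : V} (e : a ⟶ b), c e * ρ.E b = c e) :
    QuiverRep V (Matrix (Fin 2) (Fin 2) S) where
  E a := !![τ (ρ.E a), 0; 0, ρ.E a]
  F e := !![τ (ρ.F e), c e; 0, ρ.F e]
  E_mul_self a := by
    rw [triangular_mul, ← map_mul, ρ.E_mul_self, mul_zero, zero_mul, add_zero]
  E_mul_of_ne a b h := by
    rw [triangular_mul, ← map_mul, ρ.E_mul_of_ne a b h, mul_zero, zero_mul, add_zero, map_zero]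
    ext i j
    fin_cases i <;> fin_cases j <;> rfl
  sum_E := by
    ext i j
    rw [Matrix.sum_apply]
    fin_cases i <;> fin_cases j
    · change ∑ a, τ (ρ.E a) = 1
      rw [← map_sum, ρ.sum_E, map_one]
    · exact Finset.sum_const_zero
    · exact Finset.sum_const_zero
    · exact ρ.sum_E
  E_mul_F e := by
    rw [triangular_mul, ← map_mul, ρ.E_mul_F, hτ, zero_mul, add_zero]
  F_mul_E e := by
    rw [triangular_mul, ← map_mul, ρ.F_mul_E, hc, mul_zero, zero_add]

variable [Algebra k S] (ρ : QuiverRep V S) (τ : S →ₐ[k] S) (c : ∀ {a b : V}, (a ⟶ b) → S)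
    (hτ : ∀ {a b : V} (e : a ⟶ b), τ (ρ.E a) * c e = c e)
    (hc : ∀ {a b : V} (e : a ⟶ b), c e * ρ.E b = c e)

/-- The diagonal is known and the lower corner vanishes, so the upper corner is the only new
information. -/
theorem lift_triangular (z : PathAlgebra k V) :
    lift k (ρ.triangular (τ : S →+* S) c hτ hc) z =
      !![τ (lift k ρ z), lift k (ρ.triangular (τ : S →+* S) c hτ hc) z 0 1; 0, lift k ρ z] := by
  set f := lift k (ρ.triangular (τ : S →+* S) c hτ hc)
  suffices h : f z 0 0 = τ (lift k ρ z) ∧ f z 1 0 = 0 ∧ f z 1 1 = lift k ρ z by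
    ext i j
    fin_cases i <;> fin_cases j
    · exact h.1
    · rfl
    · exact h.2.1
    · exact h.2.2
  induction z using induction_arrow with
  | zero => simp
  | add x y hx hy => simp [hx, hy]
  | smul a x hx => simp [hx]
  | mul x y hx hy => simp [Matrix.mul_apply, Fin.sum_univ_two, hx, hy]
  | nil a =>
    rw [show f _ = _ from lift_nil _ a, lift_nil]
    exact ⟨rfl, rfl, rfl⟩
  | arr a b e =>
    rw [show f _ = _ from lift_arrow _ e, lift_arrow]
    exact ⟨rfl, rfl, rfl⟩

end Triangular

end PathAlgebra

/-! ### Representations of the glued quiver over A × B -/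

namespace GluedQuiver

theorem sum_eq {VA VB : Type u} [Fintype VA] [Fintype VB] {X : VA → VB → Type v}
    {Y : VB → VA → Type v} {M : Type*} [AddCommMonoid M] (f : GluedQuiver X Y → M) :
    ∑ v, f v = ∑ a, f (inA a) + ∑ b, f (inB b) := by
  rw [← (equivSum X Y).sum_comp, Fintype.sum_sum_type]
  rfl

open PathAlgebra BoundQuiverAlgebra

variable {VA VB : Type u} [Quiver.{v} VA] [Quiver.{v} VB] {X : VA → VB → Type v}
  {Y : VB → VA → Type v}

/-- The additional arrows of the glued quiver are the arrows `v → w` with `IsBridge v w`. -/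
def IsBridge : GluedQuiver X Y → GluedQuiver X Y → Prop
  | inA _, inA _ => False
  | inA _, inB _ => True
  | inB _, inA _ => True
  | inB _, inB _ => False

variable (X Y) in
/-- The additional arrows of the glued quiver. -/
abbrev Bridge : Type (max u v) :=
  {t : Σ (v w : GluedQuiver X Y), v ⟶ w // IsBridge t.1 t.2.1}

variable {k : Type w} [Field k] [Fintype VA] [Fintype VB] (IA : TwoSidedIdeal (PathAlgebra k VA))
  (IB : TwoSidedIdeal (PathAlgebra k VB))

/-- The trivial path at a vertex of the glued quiver, as an element of `A × B`. -/
noncomputable def vertexProd : GluedQuiver X Y → BoundQuiverAlgebra IA × BoundQuiverAlgebra IB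
  | inA a => (vertex IA a, 0)
  | inB b => (0, vertex IB b)

/-- The image in `A × B` of an arrow of the glued quiver. -/
noncomputable def arrowProd : ∀ {v w : GluedQuiver X Y}, (v ⟶ w) →
    BoundQuiverAlgebra IA × BoundQuiverAlgebra IB
  | inA _, inA _, e => (mk IA (arrow k e), 0)
  | inA _, inB _, _ => 0
  | inB _, inA _, _ => 0
  | inB _, inB _, e => (0, mk IB (arrow k e))

theorem arrowProd_of_isBridge : ∀ {v w : GluedQuiver X Y} (_ : IsBridge v w) (e : v ⟶ w),
    arrowProd IA IB e = 0
  | inA _, inB _, _, _ => rfl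
  | inB _, inA _, _, _ => rfl

theorem vertex_mul_self {V : Type u} [Quiver.{v} V] [Fintype V]
    (I : TwoSidedIdeal (PathAlgebra k V)) (v : V) : vertex I v * vertex I v = vertex I v := by
  rw [vertex, ← map_mul, ofPath_mul_ofPath]
  rfl

theorem vertex_mul_of_ne {V : Type u} [Quiver.{v} V] [Fintype V]
    (I : TwoSidedIdeal (PathAlgebra k V)) {v w : V} (h : v ≠ w) : vertex I v * vertex I w = 0 := by
  rw [vertex, vertex, ← map_mul, ofPath_mul_ofPath_of_ne _ _ h, map_zero]

theorem vertex_mul_arrow {V : Type u} [Quiver.{v} V] [Fintype V]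
    (I : TwoSidedIdeal (PathAlgebra k V)) {v w : V} (e : v ⟶ w) :
    vertex I v * mk I (arrow k e) = mk I (arrow k e) := by
  rw [vertex, ← map_mul, arrow, ofPath_mul_ofPath, Quiver.Path.nil_comp]

theorem arrow_mul_vertex {V : Type u} [Quiver.{v} V] [Fintype V]
    (I : TwoSidedIdeal (PathAlgebra k V)) {v w : V} (e : v ⟶ w) :
    mk I (arrow k e) * vertex I w = mk I (arrow k e) := by
  rw [vertex, ← map_mul, arrow, ofPath_mul_ofPath]
  rfl

theorem sum_vertex {V : Type u} [Quiver.{v} V] [Fintype V]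
    (I : TwoSidedIdeal (PathAlgebra k V)) : ∑ v, vertex I v = 1 := by
  rw [← map_one (mk I), one_def, map_sum]
  rfl

variable (X Y) in
/-- The representation of the glued quiver in `A × B`. -/
noncomputable def prodRep :
    QuiverRep (GluedQuiver X Y) (BoundQuiverAlgebra IA × BoundQuiverAlgebra IB) where
  E := vertexProd IA IB
  F := arrowProd IA IB
  E_mul_self
    | inA a => Prod.ext (vertex_mul_self IA a) (zero_mul _)
    | inB b => Prod.ext (zero_mul _) (vertex_mul_self IB b)
  E_mul_of_ne
    | inA _, inA _, h => Prod.ext (vertex_mul_of_ne IA fun h' => h (congrArg _ h')) (zero_mul _)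
    | inA _, inB _, _ => Prod.ext (mul_zero _) (zero_mul _)
    | inB _, inA _, _ => Prod.ext (zero_mul _) (mul_zero _)
    | inB _, inB _, h => Prod.ext (zero_mul _) (vertex_mul_of_ne IB fun h' => h (congrArg _ h'))
  sum_E := by
    rw [sum_eq]
    ext <;> simp [vertexProd, Prod.fst_sum, Prod.snd_sum, sum_vertex]
  E_mul_F {v w} e := match v, w, e with
    | inA _, inA _, e => Prod.ext (vertex_mul_arrow IA e) (zero_mul _)
    | inA _, inB _, _ => mul_zero _
    | inB _, inA _, _ => mul_zero _
    | inB _, inB _, e => Prod.ext (zero_mul _) (vertex_mul_arrow IB e)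
  F_mul_E {v w} e := match v, w, e with
    | inA _, inA _, e => Prod.ext (arrow_mul_vertex IA e) (zero_mul _)
    | inA _, inB _, _ => zero_mul _
    | inB _, inA _, _ => zero_mul _
    | inB _, inB _, e => Prod.ext (zero_mul _) (arrow_mul_vertex IB e)

variable {IA IB} (hIA : IsAdmissible IA) (hIB : IsAdmissible IB)

/-- The character of `A × B` at a vertex of the glued quiver. -/
noncomputable def characterProd : GluedQuiver X Y →
    (BoundQuiverAlgebra IA × BoundQuiverAlgebra IB →ₐ[k] k)
  | inA a => (character hIA a).comp (AlgHom.fst k _ _)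
  | inB b => (character hIB b).comp (AlgHom.snd k _ _)

theorem characterProd_surjective (v : GluedQuiver X Y) :
    Function.Surjective (characterProd hIA hIB v) := fun c =>
  ⟨algebraMap k _ c, (characterProd hIA hIB v).commutes c⟩

theorem characterProd_self (v : GluedQuiver X Y) :
    characterProd hIA hIB v (vertexProd IA IB v) = 1 := by
  cases v with
  | inA a => exact lift_vertexRep_self a
  | inB b => exact lift_vertexRep_self b

theorem characterProd_arrowProd (u : GluedQuiver X Y) : ∀ {v w : GluedQuiver X Y} (e : v ⟶ w),
    characterProd hIA hIB u (arrowProd IA IB e) = 0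
  | inA _, inA _, e => by
    cases u with
    | inA a => exact lift_vertexRep_arrow a e
    | inB b => exact map_zero (character hIB b)
  | inA _, inB _, _ => map_zero _
  | inB _, inA _, _ => map_zero _
  | inB _, inB _, e => by
    cases u with
    | inA a => exact map_zero (character hIA a)
    | inB b => exact lift_vertexRep_arrow b e

open Classical in
/-- The coordinate of an arrow with respect to an additional arrow. -/
noncomputable def coordArrow (IA : TwoSidedIdeal (PathAlgebra k VA))
    (IB : TwoSidedIdeal (PathAlgebra k VB)) (j : Bridge X Y) {v w : GluedQuiver X Y} (e : v ⟶ w) :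
    BoundQuiverAlgebra IA × BoundQuiverAlgebra IB :=
  if (⟨v, w, e⟩ : Σ (v w : GluedQuiver X Y), v ⟶ w) = j.1 then vertexProd IA IB w else 0

theorem coordArrow_mul_vertexProd (j : Bridge X Y) {v w : GluedQuiver X Y} (e : v ⟶ w) :
    coordArrow IA IB j e * vertexProd IA IB w = coordArrow IA IB j e := by
  unfold coordArrow
  split
  · exact (prodRep X Y IA IB).E_mul_self w
  · rw [zero_mul]

theorem character_smul_coordArrow (j : Bridge X Y) {v w : GluedQuiver X Y} (e : v ⟶ w) :
    algebraMap k _ (characterProd hIA hIB j.1.1 (vertexProd IA IB v)) * coordArrow IA IB j e =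
      coordArrow IA IB j e := by
  unfold coordArrow
  split
  · next heq => rw [← heq, characterProd_self, map_one, one_mul]
  · rw [mul_zero]

/-- The character of `A × B` at the source of an additional arrow, as an endomorphism. -/
noncomputable def characterEnd (j : Bridge X Y) : BoundQuiverAlgebra IA × BoundQuiverAlgebra IB →ₐ[k]
    BoundQuiverAlgebra IA × BoundQuiverAlgebra IB :=
  (Algebra.ofId k _).comp (characterProd hIA hIB j.1.1)

/-- The triangular representation of the glued quiver that reads off the coordinate with respect to
an additional arrow. -/
noncomputable def coordRep (j : Bridge X Y) : QuiverRep (GluedQuiver X Y)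
    (Matrix (Fin 2) (Fin 2) (BoundQuiverAlgebra IA × BoundQuiverAlgebra IB)) :=
  (prodRep X Y IA IB).triangular
    (characterEnd hIA hIB j : BoundQuiverAlgebra IA × BoundQuiverAlgebra IB →+*
      BoundQuiverAlgebra IA × BoundQuiverAlgebra IB)
    (coordArrow IA IB j) (character_smul_coordArrow hIA hIB j) (coordArrow_mul_vertexProd j)

end GluedQuiver

/-! ### The algebra C as an extension of A × B -/

namespace GluedQuiver

open PathAlgebra BoundQuiverAlgebra IgusaTodorov

section

variable {VA VB : Type u} [Quiver.{v} VA] [Quiver.{v} VB] {X : VA → VB → Type v}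
  {Y : VB → VA → Type v}

theorem inclA_injective : Function.Injective (inclA X Y).obj := fun _ _ h => by
  injection h

theorem inclB_injective : Function.Injective (inclB X Y).obj := fun _ _ h => by
  injection h

theorem inclA_ne_inclB (a : VA) (b : VB) : (inclA X Y).obj a ≠ (inclB X Y).obj b := fun h => by
  injection h

theorem inclB_ne_inclA (b : VB) (a : VA) : (inclB X Y).obj b ≠ (inclA X Y).obj a := fun h => by
  injection h

instance [∀ a a' : VA, Finite (a ⟶ a')] [∀ b b' : VB, Finite (b ⟶ b')]
    [∀ a b, Finite (X a b)] [∀ b a, Finite (Y b a)] :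
    ∀ v w : GluedQuiver X Y, Finite (v ⟶ w)
  | inA a, inA a' => inferInstanceAs (Finite (a ⟶ a'))
  | inA a, inB b => inferInstanceAs (Finite (X a b))
  | inB b, inA a => inferInstanceAs (Finite (Y b a))
  | inB b, inB b' => inferInstanceAs (Finite (b ⟶ b'))

variable {k : Type w} [Field k] [Fintype VA] [Fintype VB] {IA : TwoSidedIdeal (PathAlgebra k VA)}
  {IB : TwoSidedIdeal (PathAlgebra k VB)}

section Values

theorem lift_prodRep_map_inclA (z : PathAlgebra k VA) :
    lift k (prodRep X Y IA IB) (PathAlgebra.map k (inclA X Y) z) = (mk IA z, 0) := by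
  induction z using induction_arrow with
  | zero => rw [map_zero, map_zero, map_zero]; rfl
  | add x y hx hy => rw [map_add, map_add, hx, hy, map_add, Prod.mk_add_mk, add_zero]
  | smul c x hx => rw [map_smul, map_smul, hx, map_smul, Prod.smul_mk, smul_zero]
  | mul x y hx hy =>
    rw [map_mul_of_injective inclA_injective, map_mul, hx, hy, map_mul, Prod.mk_mul_mk, zero_mul]
  | nil a => rw [map_ofPath]; exact lift_nil _ _
  | arr a b e => rw [arrow, map_ofPath]; exact lift_arrow (prodRep X Y IA IB) ((inclA X Y).map e)

theorem lift_prodRep_map_inclB (z : PathAlgebra k VB) :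
    lift k (prodRep X Y IA IB) (PathAlgebra.map k (inclB X Y) z) = (0, mk IB z) := by
  induction z using induction_arrow with
  | zero => rw [map_zero, map_zero, map_zero]; rfl
  | add x y hx hy => rw [map_add, map_add, hx, hy, map_add, Prod.mk_add_mk, add_zero]
  | smul c x hx => rw [map_smul, map_smul, hx, map_smul, Prod.smul_mk, smul_zero]
  | mul x y hx hy =>
    rw [map_mul_of_injective inclB_injective, map_mul, hx, hy, map_mul, Prod.mk_mul_mk, zero_mul]
  | nil a => rw [map_ofPath]; exact lift_nil _ _
  | arr a b e => rw [arrow, map_ofPath]; exact lift_arrow (prodRep X Y IA IB) ((inclB X Y).map e)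

variable (hIA : IsAdmissible IA) (hIB : IsAdmissible IB) (j : Bridge X Y)

/-- The coordinate of an element of the path algebra with respect to an additional arrow. -/
noncomputable def coord : PathAlgebra k (GluedQuiver X Y) →ₗ[k]
    BoundQuiverAlgebra IA × BoundQuiverAlgebra IB where
  toFun z := lift k (coordRep hIA hIB j) z 0 1
  map_add' x y := by rw [map_add]; rfl
  map_smul' c x := by rw [map_smul]; rfl

theorem lift_coordRep (z : PathAlgebra k (GluedQuiver X Y)) : lift k (coordRep hIA hIB j) z =
    !![algebraMap k _ (characterProd hIA hIB j.1.1 (lift k (prodRep X Y IA IB) z)),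
      coord hIA hIB j z; 0, lift k (prodRep X Y IA IB) z] :=
  lift_triangular (prodRep X Y IA IB) (characterEnd hIA hIB j) (coordArrow IA IB j)
    (character_smul_coordArrow hIA hIB j) (coordArrow_mul_vertexProd j) z

theorem coord_mul (x y : PathAlgebra k (GluedQuiver X Y)) : coord hIA hIB j (x * y) =
    algebraMap k _ (characterProd hIA hIB j.1.1 (lift k (prodRep X Y IA IB) x)) *
      coord hIA hIB j y + coord hIA hIB j x * lift k (prodRep X Y IA IB) y := by
  have h : lift k (coordRep hIA hIB j) (x * y) = _ := map_mul _ _ _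
  rw [lift_coordRep hIA hIB j x, lift_coordRep hIA hIB j y, triangular_mul] at h
  exact congrFun (congrFun h 0) 1

theorem coord_nil (v : GluedQuiver X Y) :
    coord hIA hIB j (ofPath k (Quiver.Path.nil : Quiver.Path v v)) = 0 :=
  congrFun (congrFun (lift_nil (coordRep hIA hIB j) v) 0) 1

theorem coord_arrow {v w : GluedQuiver X Y} (e : v ⟶ w) :
    coord hIA hIB j (arrow k e) = coordArrow IA IB j e :=
  congrFun (congrFun (lift_arrow (coordRep hIA hIB j) e) 0) 1

theorem coordArrow_of_not_isBridge {v w : GluedQuiver X Y} (e : v ⟶ w) (h : ¬ IsBridge v w) :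
    coordArrow IA IB j e = 0 := by
  refine if_neg fun heq => h ?_
  have := j.2
  rwa [← heq] at this

theorem coord_map_inclA (z : PathAlgebra k VA) :
    coord hIA hIB j (PathAlgebra.map k (inclA X Y) z) = 0 := by
  induction z using induction_arrow with
  | zero => rw [map_zero, map_zero]
  | add x y hx hy => rw [map_add, map_add, hx, hy, add_zero]
  | smul c x hx => rw [map_smul, map_smul, hx, smul_zero]
  | mul x y hx hy =>
    rw [map_mul_of_injective inclA_injective, coord_mul, hx, hy, mul_zero, zero_mul, add_zero]
  | nil a => rw [map_ofPath]; exact coord_nil hIA hIB j _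
  | arr a b e =>
    rw [arrow, map_ofPath]
    exact (coord_arrow hIA hIB j ((inclA X Y).map e)).trans
      (coordArrow_of_not_isBridge j _ fun h => h)

theorem coord_map_inclB (z : PathAlgebra k VB) :
    coord hIA hIB j (PathAlgebra.map k (inclB X Y) z) = 0 := by
  induction z using induction_arrow with
  | zero => rw [map_zero, map_zero]
  | add x y hx hy => rw [map_add, map_add, hx, hy, add_zero]
  | smul c x hx => rw [map_smul, map_smul, hx, smul_zero]
  | mul x y hx hy =>
    rw [map_mul_of_injective inclB_injective, coord_mul, hx, hy, mul_zero, zero_mul, add_zero]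
  | nil a => rw [map_ofPath]; exact coord_nil hIA hIB j _
  | arr a b e =>
    rw [arrow, map_ofPath]
    exact (coord_arrow hIA hIB j ((inclB X Y).map e)).trans
      (coordArrow_of_not_isBridge j _ fun h => h)

theorem lift_prodRep_arrow {v w : GluedQuiver X Y} (e : v ⟶ w) :
    lift k (prodRep X Y IA IB) (arrow k e) = arrowProd IA IB e :=
  lift_arrow _ e

/-- Both Leibniz terms vanish: characters kill the first arrow, and the additional arrow is zero in
A × B. -/
theorem coord_arrow_mul_bridge {v w w' : GluedQuiver X Y} (e : v ⟶ w) (e' : w ⟶ w')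
    (h : IsBridge w w') : coord hIA hIB j (arrow k e * arrow k e') = 0 := by
  rw [coord_mul, lift_prodRep_arrow, characterProd_arrowProd, map_zero, zero_mul, zero_add,
    lift_prodRep_arrow, arrowProd_of_isBridge IA IB h, mul_zero]

theorem lift_arrow_mul_bridge {v w w' : GluedQuiver X Y} (e : v ⟶ w) (e' : w ⟶ w')
    (h : IsBridge w w') : lift k (prodRep X Y IA IB) (arrow k e * arrow k e') = 0 := by
  rw [map_mul, lift_prodRep_arrow e', arrowProd_of_isBridge IA IB h, mul_zero]

/-- All four families of products among the generators have one shape, an arrow followed by an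
additional arrow. -/
theorem gluedIdeal_le {I : TwoSidedIdeal (PathAlgebra k (GluedQuiver X Y))}
    (hA : ∀ z ∈ IA, PathAlgebra.map k (inclA X Y) z ∈ I)
    (hB : ∀ z ∈ IB, PathAlgebra.map k (inclB X Y) z ∈ I)
    (h : ∀ {v w w' : GluedQuiver X Y} (e : v ⟶ w) (e' : w ⟶ w'), IsBridge w w' →
      arrow k e * arrow k e' ∈ I) : gluedIdeal X Y IA IB ≤ I := by
  refine TwoSidedIdeal.span_le.2 ?_
  rintro _ (((((⟨z, hz, rfl⟩ | ⟨z, hz, rfl⟩) | ⟨a, a', b, e, x, rfl⟩) | ⟨b, b', a, e, y, rfl⟩) |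
    ⟨a, b, a', x, y, rfl⟩) | ⟨b, a, b', y, x, rfl⟩)
  · exact hA z hz
  · exact hB z hz
  · exact h _ _ trivial
  · exact h _ _ trivial
  · exact h _ _ trivial
  · exact h _ _ trivial

theorem lift_prodRep_eq_zero {z : PathAlgebra k (GluedQuiver X Y)}
    (hz : z ∈ gluedIdeal X Y IA IB) : lift k (prodRep X Y IA IB) z = 0 := by
  refine (TwoSidedIdeal.mem_ker (lift k (prodRep X Y IA IB))).1 (gluedIdeal_le ?_ ?_ ?_ hz)
  · intro z hz
    rw [TwoSidedIdeal.mem_ker, lift_prodRep_map_inclA, mk_eq_zero.2 hz]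
    rfl
  · intro z hz
    rw [TwoSidedIdeal.mem_ker, lift_prodRep_map_inclB, mk_eq_zero.2 hz]
    rfl
  · intro v w w' e e' h
    rw [TwoSidedIdeal.mem_ker, lift_arrow_mul_bridge e e' h]

theorem lift_coordRep_eq_zero {z : PathAlgebra k (GluedQuiver X Y)}
    (hz : z ∈ gluedIdeal X Y IA IB) : lift k (coordRep hIA hIB j) z = 0 := by
  have key : ∀ z, lift k (prodRep X Y IA IB) z = 0 → coord hIA hIB j z = 0 →
      z ∈ TwoSidedIdeal.ker (lift k (coordRep hIA hIB j)) := by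
    intro z h h'
    rw [TwoSidedIdeal.mem_ker, lift_coordRep, h, h', map_zero, map_zero]
    refine Matrix.ext fun i j => ?_
    fin_cases i <;> fin_cases j <;> rfl
  have h : z ∈ TwoSidedIdeal.ker (lift k (coordRep hIA hIB j)) :=
    gluedIdeal_le
      (fun z hz => key _ (by rw [lift_prodRep_map_inclA, mk_eq_zero.2 hz]; rfl)
        (coord_map_inclA hIA hIB j z))
      (fun z hz => key _ (by rw [lift_prodRep_map_inclB, mk_eq_zero.2 hz]; rfl)
        (coord_map_inclB hIA hIB j z))
      (fun e e' h => key _ (lift_arrow_mul_bridge e e' h)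
        (coord_arrow_mul_bridge hIA hIB j e e' h)) hz
  exact (TwoSidedIdeal.mem_ker (lift k (coordRep hIA hIB j))).1 h

end Values

section Inclusion

variable (X Y IA IB) in
/-- The homomorphism `kQ_A × kQ_B → C`. -/
noncomputable def inclPath : PathAlgebra k VA × PathAlgebra k VB →+*
    BoundQuiverAlgebra (gluedIdeal X Y IA IB) where
  toFun z := mk _ (PathAlgebra.map k (inclA X Y) z.1) + mk _ (PathAlgebra.map k (inclB X Y) z.2)
  map_zero' := by simp
  map_add' x y := by
    simp only [Prod.fst_add, Prod.snd_add, map_add]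
    abel
  map_one' := by
    rw [← map_add, ← map_one (mk (gluedIdeal X Y IA IB))]
    congr 1
    simp only [Prod.fst_one, Prod.snd_one, one_def, map_sum, map_ofPath]
    exact (sum_eq (fun v : GluedQuiver X Y =>
      ofPath k (Quiver.Path.nil : Quiver.Path v v))).symm
  map_mul' x y := by
    simp only [← map_add, ← map_mul]
    congr 1
    rw [add_mul, mul_add, mul_add, map_mul_map_eq_zero inclA_ne_inclB,
      map_mul_map_eq_zero inclB_ne_inclA, add_zero, zero_add, Prod.fst_mul, Prod.snd_mul,
      map_mul_of_injective inclA_injective, map_mul_of_injective inclB_injective]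

variable (IA IB) in
/-- The homomorphism `kQ_A × kQ_B → A × B`. -/
noncomputable def mkProd : PathAlgebra k VA × PathAlgebra k VB →+*
    BoundQuiverAlgebra IA × BoundQuiverAlgebra IB :=
  RingHom.prodMap (mk IA : PathAlgebra k VA →+* _) (mk IB : PathAlgebra k VB →+* _)

theorem mkProd_surjective : Function.Surjective (mkProd IA IB) :=
  Function.Surjective.prodMap mk_surjective mk_surjective

variable (X Y IA IB) in
/-- The homomorphism `A × B → C`. -/
noncomputable def inclProd : BoundQuiverAlgebra IA × BoundQuiverAlgebra IB →+*
    BoundQuiverAlgebra (gluedIdeal X Y IA IB) :=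
  (mkProd IA IB).liftOfSurjective mkProd_surjective ⟨inclPath X Y IA IB, by
    rintro ⟨z, z'⟩ hz
    rw [RingHom.mem_ker, Prod.ext_iff] at hz
    have h1 : mk _ (PathAlgebra.map k (inclA X Y) z) = 0 := toC_map_inclA (X := X) (Y := Y) IA IB (mk_eq_zero.1 hz.1)
    have h2 : mk _ (PathAlgebra.map k (inclB X Y) z') = 0 := toC_map_inclB (X := X) (Y := Y) IA IB (mk_eq_zero.1 hz.2)
    exact (congrArg₂ (· + ·) h1 h2).trans (add_zero _)⟩

theorem inclProd_mk (z : PathAlgebra k VA) (z' : PathAlgebra k VB) :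
    inclProd X Y IA IB (mk IA z, mk IB z') =
      mk _ (PathAlgebra.map k (inclA X Y) z) + mk _ (PathAlgebra.map k (inclB X Y) z') :=
  RingHom.liftOfSurjective_comp_apply (mkProd IA IB) mkProd_surjective _ (z, z')

theorem inclProd_smul (c : k) (g : BoundQuiverAlgebra IA × BoundQuiverAlgebra IB) :
    inclProd X Y IA IB (c • g) = c • inclProd X Y IA IB g := by
  obtain ⟨⟨z, z'⟩, rfl⟩ := mkProd_surjective g
  change inclProd X Y IA IB (c • mk IA z, c • mk IB z') = c • inclProd X Y IA IB (mk IA z, mk IB z')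
  rw [← map_smul, ← map_smul, inclProd_mk, inclProd_mk, map_smul, map_smul, map_smul, map_smul,
    smul_add]

theorem inclProd_pathA {a a' : VA} (q : Quiver.Path a a') :
    inclProd X Y IA IB (mk IA (ofPath k q), 0) = pathA IA IB q := by
  rw [← map_zero (mk IB), inclProd_mk, map_zero, map_zero, add_zero, map_ofPath]
  rfl

theorem inclProd_pathB {b b' : VB} (q : Quiver.Path b b') :
    inclProd X Y IA IB (0, mk IB (ofPath k q)) = pathB IA IB q := by
  rw [← map_zero (mk IA), inclProd_mk, map_zero, map_zero, zero_add, map_ofPath]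
  rfl

end Inclusion

section Data

variable (hIA : IsAdmissible IA) (hIB : IsAdmissible IB)

/-- The projection `C → A × B`. -/
noncomputable def projProd (X : VA → VB → Type v) (Y : VB → VA → Type v)
    (IA : TwoSidedIdeal (PathAlgebra k VA)) (IB : TwoSidedIdeal (PathAlgebra k VB)) :
    BoundQuiverAlgebra (gluedIdeal X Y IA IB) →ₐ[k] BoundQuiverAlgebra IA × BoundQuiverAlgebra IB :=
  desc (lift k (prodRep X Y IA IB)) fun _ => lift_prodRep_eq_zero

theorem projProd_mk (z : PathAlgebra k (GluedQuiver X Y)) :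
    projProd X Y IA IB (mk _ z) = lift k (prodRep X Y IA IB) z := rfl

theorem projProd_inclProd (g : BoundQuiverAlgebra IA × BoundQuiverAlgebra IB) :
    projProd X Y IA IB (inclProd X Y IA IB g) = g := by
  obtain ⟨⟨z, z'⟩, rfl⟩ := mkProd_surjective g
  change projProd X Y IA IB (inclProd X Y IA IB (mk IA z, mk IB z')) = (mk IA z, mk IB z')
  rw [inclProd_mk, ← map_add, projProd_mk, map_add, lift_prodRep_map_inclA,
    lift_prodRep_map_inclB, Prod.mk_add_mk, add_zero, zero_add]

variable (j : Bridge X Y)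

/-- The homomorphism from `C` to triangular matrices induced by `coordRep`. -/
noncomputable def coordMatrix : BoundQuiverAlgebra (gluedIdeal X Y IA IB) →ₐ[k]
    Matrix (Fin 2) (Fin 2) (BoundQuiverAlgebra IA × BoundQuiverAlgebra IB) :=
  desc (lift k (coordRep hIA hIB j)) fun _ => lift_coordRep_eq_zero hIA hIB j

/-- The coordinate of an element of `C` with respect to an additional arrow. -/
noncomputable def coordC : BoundQuiverAlgebra (gluedIdeal X Y IA IB) →ₗ[k]
    BoundQuiverAlgebra IA × BoundQuiverAlgebra IB where
  toFun z := coordMatrix hIA hIB j z 0 1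
  map_add' x y := by rw [map_add]; rfl
  map_smul' c x := by rw [map_smul]; rfl

theorem coordC_mk (z : PathAlgebra k (GluedQuiver X Y)) :
    coordC hIA hIB j (mk _ z) = coord hIA hIB j z := rfl

theorem coordC_inclProd (g : BoundQuiverAlgebra IA × BoundQuiverAlgebra IB) :
    coordC hIA hIB j (inclProd X Y IA IB g) = 0 := by
  obtain ⟨⟨z, z'⟩, rfl⟩ := mkProd_surjective g
  change coordC hIA hIB j (inclProd X Y IA IB (mk IA z, mk IB z')) = 0
  rw [inclProd_mk, ← map_add, coordC_mk, map_add, coord_map_inclA, coord_map_inclB, add_zero]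

theorem coordC_mul (x y : BoundQuiverAlgebra (gluedIdeal X Y IA IB)) : coordC hIA hIB j (x * y) =
    algebraMap k _ (characterProd hIA hIB j.1.1 (projProd X Y IA IB x)) * coordC hIA hIB j y +
      coordC hIA hIB j x * projProd X Y IA IB y := by
  obtain ⟨x, rfl⟩ := mk_surjective x
  obtain ⟨y, rfl⟩ := mk_surjective y
  rw [← map_mul]
  exact coord_mul hIA hIB j x y

/-- The class in `C` of an additional arrow. -/
noncomputable def bridge (IA : TwoSidedIdeal (PathAlgebra k VA))
    (IB : TwoSidedIdeal (PathAlgebra k VB)) (j : Bridge X Y) :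
    BoundQuiverAlgebra (gluedIdeal X Y IA IB) :=
  mk _ (arrow k j.1.2.2)

theorem projProd_bridge : projProd X Y IA IB (bridge IA IB j) = 0 := by
  rw [bridge, projProd_mk, lift_prodRep_arrow]
  exact arrowProd_of_isBridge IA IB j.2 _

theorem coordC_bridge_self : coordC hIA hIB j (bridge IA IB j) = vertexProd IA IB j.1.2.1 :=
  (coord_arrow hIA hIB j j.1.2.2).trans (if_pos rfl)

theorem coordC_bridge_of_ne {i j : Bridge X Y} (h : i ≠ j) :
    coordC hIA hIB i (bridge IA IB j) = 0 :=
  (coord_arrow hIA hIB i j.1.2.2).trans (if_neg fun h' => h (Subtype.ext h'.symm))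

theorem bridge_mul_vertex : ∀ j : Bridge X Y,
    bridge IA IB j * inclProd X Y IA IB (vertexProd IA IB j.1.2.1) = bridge IA IB j
  | ⟨⟨inA _, inB _, x⟩, _⟩ =>
    (congrArg _ (inclProd_pathB _)).trans (AB_mul_pathB_nil IA IB x)
  | ⟨⟨inB _, inA _, y⟩, _⟩ =>
    (congrArg _ (inclProd_pathA _)).trans (BA_mul_pathA_nil IA IB y)

variable [Fintype (Bridge X Y)]

/-- By linearity it suffices to treat paths. Their classes are zero, or come from A or B, or are an
additional arrow times such a class (`normalForm_ofPath`); in each case the coordinates can be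
computed. -/
theorem expand (z : BoundQuiverAlgebra (gluedIdeal X Y IA IB)) :
    z = inclProd X Y IA IB (projProd X Y IA IB z) +
      ∑ j, bridge IA IB j * inclProd X Y IA IB (coordC hIA hIB j z) := by
  have h0 : ∀ g, inclProd X Y IA IB g = inclProd X Y IA IB (projProd X Y IA IB
      (inclProd X Y IA IB g)) + ∑ j, bridge IA IB j * inclProd X Y IA IB
        (coordC hIA hIB j (inclProd X Y IA IB g)) := by
    intro g
    rw [projProd_inclProd, Finset.sum_eq_zero, add_zero]
    intro j _
    rw [coordC_inclProd, map_zero, mul_zero]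
  have h1 : ∀ i g, bridge IA IB i * inclProd X Y IA IB g = inclProd X Y IA IB (projProd X Y IA IB
      (bridge IA IB i * inclProd X Y IA IB g)) + ∑ j, bridge IA IB j * inclProd X Y IA IB
        (coordC hIA hIB j (bridge IA IB i * inclProd X Y IA IB g)) := by
    intro i g
    have hc : ∀ j, coordC hIA hIB j (bridge IA IB i * inclProd X Y IA IB g) =
        coordC hIA hIB j (bridge IA IB i) * g := fun j => by
      rw [coordC_mul, coordC_inclProd, mul_zero, zero_add, projProd_inclProd]
    rw [map_mul, projProd_bridge, zero_mul, map_zero, zero_add, Finset.sum_eq_single i]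
    · rw [hc, coordC_bridge_self, map_mul, ← mul_assoc, bridge_mul_vertex]
    · intro j _ hj
      rw [hc, coordC_bridge_of_ne hIA hIB hj, zero_mul, map_zero, mul_zero]
    · exact fun h => absurd (Finset.mem_univ _) h
  obtain ⟨z, rfl⟩ := mk_surjective z
  induction z using induction_path with
  | zero => simp
  | add x y hx hy =>
    simp only [map_add, mul_add, Finset.sum_add_distrib]
    rw [add_add_add_comm, ← hx, ← hy]
  | smul c x hx =>
    simp only [map_smul, inclProd_smul, mul_smul_comm, ← Finset.smul_sum, ← smul_add]
    rw [← hx]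
  | path v w p =>
    have hp := normalForm_ofPath (k := k) IA IB p
    change NormalForm IA IB w (mk _ (ofPath k p)) at hp
    cases w with
    | inA a =>
      rcases hp with h | ⟨a₀, q, h⟩ | ⟨b, a₀, y, q, h⟩ <;> rw [h]
      · simp
      · rw [← inclProd_pathA]
        exact h0 _
      · rw [← inclProd_pathA]
        exact h1 ⟨⟨inB b, inA a₀, y⟩, trivial⟩ _
    | inB b =>
      rcases hp with h | ⟨b₀, q, h⟩ | ⟨a, b₀, x, q, h⟩ <;> rw [h]
      · simp
      · rw [← inclProd_pathB]
        exact h0 _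
      · rw [← inclProd_pathB]
        exact h1 ⟨⟨inA a, inB b₀, x⟩, trivial⟩ _

/-- The algebra `C` as an extension of `A × B`. -/
noncomputable def glueData {n : ℕ} (f : Fin n ≃ Bridge X Y) :
    GlueData k (BoundQuiverAlgebra IA × BoundQuiverAlgebra IB)
      (BoundQuiverAlgebra (gluedIdeal X Y IA IB)) (Fin n) where
  proj := projProd X Y IA IB
  incl := inclProd X Y IA IB
  x i := bridge IA IB (f i)
  e i := vertexProd IA IB (f i).1.2.1
  χ i := characterProd hIA hIB (f i).1.1
  c i := coordC hIA hIB (f i)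
  proj_incl := projProd_inclProd
  expand z := by
    conv_lhs => rw [expand hIA hIB z, ← f.sum_comp]
    rfl
  c_incl i := coordC_inclProd hIA hIB (f i)
  proj_x i := projProd_bridge (f i)
  c_x_self i := coordC_bridge_self hIA hIB (f i)
  c_x_of_ne _ _ h := coordC_bridge_of_ne hIA hIB (f.injective.ne h)
  c_mul i := coordC_mul hIA hIB (f i)

end Data

end

end GluedQuiver

/-! ### Products, opposites and the final assembly -/

namespace IgusaTodorov

theorem leftPhiDim_prod {A B : Type u} [Ring A] [Ring B] [IsArtinianRing A] [IsArtinianRing B]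
    [IsArtinianRing (A × B)] : leftPhiDim (A × B) = max (leftPhiDim A) (leftPhiDim B) :=
  leftPhiDim_eq_max (p := RingHom.fst A B) (p' := RingHom.snd A B) (ε := (1, 0))
    Prod.fst_surjective Prod.snd_surjective
    ⟨rfl, fun s h => Prod.ext ((one_mul _).trans h) (zero_mul _),
      fun s h => Prod.ext ((mul_one _).trans h) (mul_zero _)⟩
    ⟨sub_zero _, fun s h => Prod.ext (by simp) (by simpa using h),
      fun s h => Prod.ext (by simp) (by simpa using h)⟩

theorem leftPhiDim_prod_op {A B : Type u} [Ring A] [Ring B] [IsArtinianRing Aᵐᵒᵖ]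
    [IsArtinianRing Bᵐᵒᵖ] [IsArtinianRing (A × B)ᵐᵒᵖ] :
    leftPhiDim (A × B)ᵐᵒᵖ = max (leftPhiDim Aᵐᵒᵖ) (leftPhiDim Bᵐᵒᵖ) :=
  leftPhiDim_eq_max (p := RingHom.op (RingHom.fst A B)) (p' := RingHom.op (RingHom.snd A B))
    (ε := MulOpposite.op (1, 0))
    (fun a => ⟨MulOpposite.op (a.unop, 0), rfl⟩) (fun b => ⟨MulOpposite.op (0, b.unop), rfl⟩)
    ⟨rfl, fun s h => MulOpposite.unop_injective (Prod.ext
      ((mul_one _).trans (congrArg MulOpposite.unop h)) (mul_zero _)),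
      fun s h => MulOpposite.unop_injective (Prod.ext
        ((one_mul _).trans (congrArg MulOpposite.unop h)) (zero_mul _))⟩
    ⟨congrArg MulOpposite.op (sub_zero (1 : B)), fun s h => MulOpposite.unop_injective (Prod.ext
      (by simp) (by simpa using congrArg MulOpposite.unop h)),
      fun s h => MulOpposite.unop_injective (Prod.ext
        (by simp) (by simpa using congrArg MulOpposite.unop h))⟩

theorem phiDim_op (k : Type*) [Field k] (A : Type u) [Ring A] [Algebra k A] [Module.Finite k A]
    [IsArtinianRing A] : phiDim k Aᵐᵒᵖ = leftPhiDim A := by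
  have : IsArtinianRing Aᵐᵒᵖᵐᵒᵖ := IsArtinianRing.of_finite k _
  exact leftPhiDim_congr (RingEquiv.opOp A).symm

end IgusaTodorov

theorem proposition3p5 {k : Type w} [Field k]
    {VA VB : Type u} [Quiver.{v} VA] [Quiver.{v} VB] [Fintype VA] [Fintype VB]
    [∀ a a' : VA, Finite (a ⟶ a')] [∀ b b' : VB, Finite (b ⟶ b')]
    (IA : TwoSidedIdeal (PathAlgebra k VA)) (IB : TwoSidedIdeal (PathAlgebra k VB))
    (hIA : PathAlgebra.IsAdmissible IA) (hIB : PathAlgebra.IsAdmissible IB)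
    [Module.Finite k (BoundQuiverAlgebra IA)] [Module.Finite k (BoundQuiverAlgebra IB)]
    (X : VA → VB → Type v) (Y : VB → VA → Type v)
    [∀ a b, Finite (X a b)] [∀ b a, Finite (Y b a)] :
    (max (IgusaTodorov.phiDim k (BoundQuiverAlgebra IA))
          (IgusaTodorov.phiDim k (BoundQuiverAlgebra IB)) ≤
        IgusaTodorov.phiDim k (BoundQuiverAlgebra (GluedQuiver.gluedIdeal X Y IA IB)) ∧
      IgusaTodorov.phiDim k (BoundQuiverAlgebra (GluedQuiver.gluedIdeal X Y IA IB)) ≤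
        max (IgusaTodorov.phiDim k (BoundQuiverAlgebra IA))
          (IgusaTodorov.phiDim k (BoundQuiverAlgebra IB)) +
            (Fintype.card VA : ℕ∞) + (Fintype.card VB : ℕ∞) + 1) ∧
    (max (IgusaTodorov.phiDim k (BoundQuiverAlgebra IA)ᵐᵒᵖ)
          (IgusaTodorov.phiDim k (BoundQuiverAlgebra IB)ᵐᵒᵖ) ≤
        IgusaTodorov.phiDim k (BoundQuiverAlgebra (GluedQuiver.gluedIdeal X Y IA IB))ᵐᵒᵖ ∧
      IgusaTodorov.phiDim k (BoundQuiverAlgebra (GluedQuiver.gluedIdeal X Y IA IB))ᵐᵒᵖ ≤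
        max (IgusaTodorov.phiDim k (BoundQuiverAlgebra IA)ᵐᵒᵖ)
          (IgusaTodorov.phiDim k (BoundQuiverAlgebra IB)ᵐᵒᵖ) +
            (Fintype.card VA : ℕ∞) + (Fintype.card VB : ℕ∞) + 1) := by
  have artinian : ∀ (R : Type (max u v w)) [Ring R] [Algebra k R] [Module.Finite k R],
      IsArtinianRing R ∧ IsArtinianRing Rᵐᵒᵖ := fun R _ _ _ =>
    ⟨IsArtinianRing.of_finite k R, IsArtinianRing.of_finite k Rᵐᵒᵖ⟩
  obtain ⟨hA, hA'⟩ := artinian (BoundQuiverAlgebra IA)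
  obtain ⟨hB, hB'⟩ := artinian (BoundQuiverAlgebra IB)
  obtain ⟨hP, hP'⟩ := artinian (BoundQuiverAlgebra IA × BoundQuiverAlgebra IB)
  obtain ⟨hC, hC'⟩ := artinian (BoundQuiverAlgebra (GluedQuiver.gluedIdeal X Y IA IB))
  have := Fintype.ofFinite (GluedQuiver.Bridge X Y)
  -- The index type of `GlueData` lives in `Type`, so the additional arrows are enumerated by `Fin
  -- n`.
  let D := GluedQuiver.glueData (X := X) (Y := Y) hIA hIB
    (Fintype.equivFin (GluedQuiver.Bridge X Y)).symm
  have hχ : ∀ i, Function.Surjective (D.χ i) := fun i =>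
    GluedQuiver.characterProd_surjective hIA hIB _
  have h := (BoundQuiverAlgebra.isSplitBasic hIA).prod (BoundQuiverAlgebra.isSplitBasic hIB)
  have hcard : ∀ d : ℕ∞, d + (Fintype.card (VA ⊕ VB) : ℕ∞) + 1 =
      d + (Fintype.card VA : ℕ∞) + (Fintype.card VB : ℕ∞) + 1 := fun d => by
    rw [Fintype.card_sum, Nat.cast_add, ← add_assoc d]
  -- Right C-modules are left modules over the opposite of C, so the bounds for opposites give the
  -- first assertion and the direct ones the second.
  have h1 := D.leftPhiDim_op_bounds hχ h
  have h2 := D.leftPhiDim_bounds hχ h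
  rw [IgusaTodorov.leftPhiDim_prod_op, hcard] at h1
  rw [IgusaTodorov.leftPhiDim_prod, hcard] at h2
  simp only [IgusaTodorov.phiDim_op]
  exact ⟨h1, h2⟩
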